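/- Let $\mathbb{K}$ be an algebraically closed field of characteristic zero, $G$ a finite group, and $\mathcal{C}$ a $G$-graded spherical fusion category over $\mathbb{K}$: a $\mathbb{K}$-linear abelian, finitely semisimple, rigid monoidal category with finite-dimensional morphism spaces, $\mathrm{End}(\mathbb{1})\cong\mathbb{K}$, and a spherical pivotal structure, together with full subcategories $\mathcal{C}_g$ ($g\in G$), closed under isomorphisms and finite direct sums, such that every object is a finite direct sum of homogeneous objects, $\mathcal{C}_g\otimes\mathcal{C}_h\subset\mathcal{C}_{gh}$, $\mathrm{Hom}(\mathcal{C}_g,\mathcal{C}_h)=0$ for $g\ne h$, $\mathbb{1}\in\mathcal{C}_e$, and each $\mathcal{C}_g$ contains a simple object. We suppress associativity and unit constraints. For an object $X$ with dual $X^*$ write $\mathrm{ev}_X:X^*\otimes X\to\mathbb{1}$ for the evaluation and $\widetilde{\mathrm{coev}}_X:\mathbb{1}\to X^*\otimes X$ for the coevaluation obtained from the pivotal structure. The $G$-center $\mathsf{Z}_G(\mathcal{C})$ is the monoidal category of pairs $(c,\gamma_c)$, where $c\in\mathcal{C}$ and $\gamma_{c,X}:c\otimes X\to X\otimes c$ ($X\in\mathcal{C}_e$)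 is a half-braiding, i.e. a natural isomorphism with $\gamma_{c,X\otimes Y}=(\mathrm{id}_X\otimes\gamma_{c,Y})(\gamma_{c,X}\otimes\mathrm{id}_Y)$; its morphisms are the morphisms of $\mathcal{C}$ compatible with the half-braidings. $\mathsf{Z}_G(\mathcal{C})_g$ is the full subcategory of pairs with $c\in\mathcal{C}_g$. Choose representatives of the isomorphism classes of simple objects, and let $I_h$ be the set of those in $\mathcal{C}_h$. Let $d_i$ be the dimension of $i$ and $D=\sum_{i\in I_e}d_i^2$. For $h\in G$ and $c\in\mathsf{Z}_G(\mathcal{C})$ put $I^h(c)=\bigoplus_{i\in I_h}i^*\otimes c\otimes i$, and for $X\in\mathcal{C}_e$ let $$\Gamma^{h}_{c,X}:I^h(c)\otimes X\to X\otimes I^h(c)$$ be the morphism whose component $i^*\otimes c\otimes i\otimes X\to X\otimes j^*\otimes c\otimes j$ ($i,j\in I_h$) is $\frac{d_i}{D}$ times $$(\mathrm{ev}_i\otimes \mathrm{id}_{X\otimes j^*\otimes c\otimes j})\circ(\mathrm{id}_{i^*}\otimes\gamma_{c,\,i\otimes X\otimes j^*}\otimes\mathrm{id}_j)\circ(\mathrm{id}_{i^*\otimes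 c\otimes i\otimes X}\otimes\widetilde{\mathrm{coev}}_j).$$ Let $\pi^h_c:I^h(c)\to I^h(c)$ be given by the same formula without the strand $X$ (i.e. with $\gamma_{c,\,i\otimes j^*}$). Let $P(c)=\mathrm{Im}(\pi^h_c)$, with inclusion $e_c:P(c)\to I^h(c)$ and restriction $r_c:I^h(c)\to P(c)$, $e_c r_c=\pi^h_c$. Put $\gamma_{P(c),X}=(\mathrm{id}_X\otimes r_c)\circ\Gamma^h_{c,X}\circ(e_c\otimes\mathrm{id}_X)$, and, for a morphism $f:c\to d$ of $\mathsf{Z}_G(\mathcal{C})$, $P(f)=r_d\circ\big(\bigoplus_{i\in I_h}\mathrm{id}_{i^*}\otimes f\otimes\mathrm{id}_i\big)\circ e_c$. Then $\mathsf{Z}_G(\mathcal{C})$ is $G$-graded by the subcategories $\mathsf{Z}_G(\mathcal{C})_g$; each $\pi^h_c$ is idempotent; each $\gamma_{P(c),\bullet}$ is a half-braiding; and $\phi_h:c\mapsto(P(c),\gamma_{P(c),\bullet})$, $f\mapsto P(f)$, is a functor $\mathsf{Z}_G(\mathcal{C})\to\mathsf{Z}_G(\mathcal{C})$ for every $h\in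 G$. Moreover, the functors $\phi_h$ constitute a $G$-crossing on $\mathsf{Z}_G(\mathcal{C})$: each $\phi_h$ is a $\mathbb{K}$-linear equivalence with $\phi_h(\mathsf{Z}_G(\mathcal{C})_g)\subset\mathsf{Z}_G(\mathcal{C})_{h^{-1}gh}$ for all $g\in G$, and there are strong monoidal structures on the $\phi_h$ and monoidal natural isomorphisms $\phi_g\phi_h\cong\phi_{hg}$ ($g,h\in G$) and $\mathrm{Id}\cong\phi_e$ satisfying the associativity and unit coherence conditions, so that $h\mapsto\phi_h$ is a strong monoidal functor from $G$ (as a discrete monoidal category) to the monoidal auto-equivalences of $\mathsf{Z}_G(\mathcal{C})$. -/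

import Mathlib

open CategoryTheory CategoryTheory.Limits CategoryTheory.MonoidalCategory

universe w v u

noncomputable section

/-! ## Pivotal and spherical fusion categories -/

attribute [local instance] Abelian.hasFiniteBiproducts

/-- The chosen dual `X*`, with evaluation `X* ⊗ X ⟶ 𝟙_` and coevaluation `𝟙_ ⟶ X ⊗ X*`. -/
abbrev rdual {C : Type u} [Category.{v} C] [MonoidalCategory C] [RightRigidCategory C] (X : C) : C :=
  HasRightDual.rightDual X

/-- A pivotal structure on a category with duals: a monoidal natural isomorphism from the identity
to the double dual functor. Such an isomorphism also makes `X*` a dual of `X` on the other side. -/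
class PivotalCategory (C : Type u) [Category.{v} C] [MonoidalCategory C]
    [RightRigidCategory C] where
  pivot : ∀ X : C, X ≅ rdual (rdual X)
  naturality : ∀ {X Y : C} (f : X ⟶ Y), f ≫ (pivot Y).hom = (pivot X).hom ≫ fᘁᘁ
  /-- Compatibility with the canonical isomorphism `(X ⊗ Y)** ≅ X** ⊗ Y**`; compatibility with the
  unit is a consequence. -/
  monoidal : ∀ X Y : C,
    (pivot (X ⊗ Y)).hom ≫ ((rightDualTensorIso X Y).inv)ᘁ ≫ (rightDualTensorIso (rdual Y) (rdual X)).hom =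
      (pivot X).hom ⊗ₘ (pivot Y).hom

section Pivotal

variable {C : Type u} [Category.{v} C] [MonoidalCategory C] [RightRigidCategory C]
  [PivotalCategory C]

/-- The evaluation `X ⊗ X* ⟶ 𝟙_` of the pivotal structure. -/
def pivEv (X : C) : X ⊗ rdual X ⟶ 𝟙_ C :=
  (PivotalCategory.pivot X).hom ▷ rdual X ≫ ε_ (rdual X) (rdual (rdual X))

/-- The coevaluation `𝟙_ ⟶ X* ⊗ X` of the pivotal structure. -/
def pivCoev (X : C) : 𝟙_ C ⟶ rdual X ⊗ X :=
  η_ (rdual X) (rdual (rdual X)) ≫ rdual X ◁ (PivotalCategory.pivot X).inv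

def leftTrace {X : C} (f : X ⟶ X) : 𝟙_ C ⟶ 𝟙_ C :=
  η_ X (rdual X) ≫ f ▷ rdual X ≫ pivEv X

def rightTrace {X : C} (f : X ⟶ X) : 𝟙_ C ⟶ 𝟙_ C :=
  pivCoev X ≫ rdual X ◁ f ≫ ε_ X (rdual X)

end Pivotal

/-- A pivotal category is spherical if left and right traces coincide. -/
def IsSpherical (C : Type u) [Category.{v} C] [MonoidalCategory C] [RightRigidCategory C]
    [PivotalCategory C] : Prop :=
  ∀ (X : C) (f : X ⟶ X), leftTrace f = rightTrace f

/-- `S` is a family of representatives of the isomorphism classes of simple objects. -/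
structure IsSimpleReps {C : Type u} [Category.{v} C] [HasZeroMorphisms C] {ι : Type*}
    (S : ι → C) : Prop where
  simple : ∀ i, Simple (S i)
  inj : ∀ i j, Nonempty (S i ≅ S j) → i = j
  surj : ∀ X : C, Simple X → ∃ i, Nonempty (X ≅ S i)

/-- Fusion categories over `𝕂` (duals are provided by `RightRigidCategory`). -/
structure IsFusion (𝕂 : Type w) [Field 𝕂] (C : Type u) [Category.{v} C] [Abelian C] [Linear 𝕂 C]
    [MonoidalCategory C] [MonoidalPreadditive C] [MonoidalLinear 𝕂 C]
    [RightRigidCategory C] : Prop where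
  finiteDimensional_hom : ∀ X Y : C, FiniteDimensional 𝕂 (X ⟶ Y)
  finite_simples : ∃ (n : ℕ) (S : Fin n → C), IsSimpleReps S
  semisimple : ∀ X : C, ∃ (n : ℕ) (f : Fin n → C), (∀ k, Simple (f k)) ∧ Nonempty (X ≅ ⨁ f)
  end_unit : Module.finrank 𝕂 (𝟙_ C ⟶ 𝟙_ C) = 1

/-- The scalar `a` with `f = a • 𝟙`, for an endomorphism `f` of the unit object. -/
def unitScalar (𝕂 : Type w) [Field 𝕂] {C : Type u} [Category.{v} C] [Preadditive C] [Linear 𝕂 C]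
    [MonoidalCategory C] (f : 𝟙_ C ⟶ 𝟙_ C) : 𝕂 :=
  Function.invFun (fun a : 𝕂 => a • 𝟙 (𝟙_ C)) f

theorem unitScalar_smul {𝕂 : Type w} [Field 𝕂] {C : Type u} [Category.{v} C] [Preadditive C]
    [Linear 𝕂 C] [MonoidalCategory C] (h : Module.finrank 𝕂 (𝟙_ C ⟶ 𝟙_ C) = 1)
    (f : 𝟙_ C ⟶ 𝟙_ C) : unitScalar 𝕂 f • 𝟙 (𝟙_ C) = f := by
  have hne : 𝟙 (𝟙_ C) ≠ 0 := by
    intro h0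
    have : ∀ g : 𝟙_ C ⟶ 𝟙_ C, g = 0 := fun g => by
      rw [← Category.id_comp g, h0, zero_comp]
    have hs : Subsingleton (𝟙_ C ⟶ 𝟙_ C) := ⟨fun a b => by rw [this a, this b]⟩
    rw [Module.finrank_zero_of_subsingleton] at h
    exact zero_ne_one h
  have hex := (finrank_eq_one_iff_of_nonzero' (𝟙 (𝟙_ C)) hne).1 h f
  exact Function.invFun_eq (f := fun a : 𝕂 => a • 𝟙 (𝟙_ C)) hex

/-- The dimension of an object, as a scalar. -/
def objDim (𝕂 : Type w) [Field 𝕂] {C : Type u} [Category.{v} C] [Preadditive C] [Linear 𝕂 C]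
    [MonoidalCategory C] [RightRigidCategory C] [PivotalCategory C] (X : C) : 𝕂 :=
  unitScalar 𝕂 (leftTrace (𝟙 X))

/-! ## Gradings and crossings -/

/-- A `G`-grading of a monoidal preadditive category by full subcategories `deg g`. Each `deg g` is
closed under all finite direct sums in the ambient category; in particular it contains the zero
objects and is closed under isomorphisms. -/
class IsGGrading {G : Type*} [Group G] {D : Type u} [Category.{v} D] [Preadditive D]
    [MonoidalCategory D] (deg : G → ObjectProperty D) : Prop where
  sum_mem : ∀ (g : G) {n : ℕ} (f : Fin n → D) (b : Bicone f), Nonempty b.IsBilimit →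
    (∀ k, deg g (f k)) → deg g b.pt
  decomp : ∀ X : D, ∃ (n : ℕ) (γ : Fin n → G) (f : Fin n → D) (b : Bicone f),
    (∀ k, deg (γ k) (f k)) ∧ Nonempty b.IsBilimit ∧ Nonempty (X ≅ b.pt)
  tensor_mem : ∀ {g h : G} {X Y : D}, deg g X → deg h Y → deg (g * h) (X ⊗ Y)
  hom_eq_zero : ∀ {g h : G} {X Y : D}, deg g X → deg h Y → g ≠ h → ∀ f : X ⟶ Y, f = 0
  unit_mem : deg 1 (𝟙_ D)

/-- The structure of a `G`-crossing on the family of functors `F h : D ⥤ D`: a strong monoidal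
functor from the discrete monoidal category on `G` to the linear monoidal auto-equivalences of `D`,
with underlying functors `F h`, such that `F h` sends degree `g` to degree `h⁻¹ * g * h`. The
structure maps are `mul h g : F g (F h X) ≅ F (h * g) X` and `one : X ≅ F 1 X`. -/
structure GCrossing (𝕂 : Type w) [Field 𝕂] {G : Type*} [Group G] {D : Type u} [Category.{v} D]
    [Preadditive D] [Linear 𝕂 D] [MonoidalCategory D] (deg : G → ObjectProperty D)
    (F : G → D ⥤ D) where
  additive : ∀ h, (F h).Additive
  linear : ∀ h, (F h).Linear 𝕂
  isEquivalence : ∀ h, (F h).IsEquivalence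
  monoidal : ∀ h, (F h).Monoidal
  map_deg : ∀ (h g : G) (X : D), deg g X → deg (h⁻¹ * g * h) ((F h).obj X)
  mul : ∀ h g, F h ⋙ F g ≅ F (h * g)
  one : 𝟭 D ≅ F 1
  mul_monoidal : ∀ h g, NatTrans.IsMonoidal (mul h g).hom
  one_monoidal : NatTrans.IsMonoidal one.hom
  assoc : ∀ (h g k : G) (X : D),
    (F k).map ((mul h g).hom.app X) ≫ (mul (h * g) k).hom.app X ≫
        eqToHom (by rw [mul_assoc]) =
      (mul g k).hom.app ((F h).obj X) ≫ (mul h (g * k)).hom.app X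
  one_left : ∀ (h : G) (X : D),
    (F h).map (one.hom.app X) ≫ (mul 1 h).hom.app X = eqToHom (by rw [one_mul]; rfl)
  one_right : ∀ (h : G) (X : D),
    one.hom.app ((F h).obj X) ≫ (mul h 1).hom.app X = eqToHom (by rw [mul_one]; rfl)

/-! ## The relative center -/

section RelCenter

variable {C : Type u} [Category.{v} C] [MonoidalCategory C]

/-- `β` is a half-braiding of `X` with the objects satisfying `S`. -/
structure IsHalfBraiding (S : ObjectProperty C) (X : C)
    (β : ∀ U : C, S U → (X ⊗ U ⟶ U ⊗ X)) : Prop where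
  isIso : ∀ U (hU : S U), IsIso (β U hU)
  naturality : ∀ U V (hU : S U) (hV : S V) (f : U ⟶ V), X ◁ f ≫ β V hV = β U hU ≫ f ▷ X
  monoidal : ∀ U V (hU : S U) (hV : S V) (hUV : S (U ⊗ V)),
    β (U ⊗ V) hUV =
      (α_ X U V).inv ≫ β U hU ▷ V ≫ (α_ U X V).hom ≫ U ◁ β V hV ≫ (α_ U V X).inv

/-- Objects of the center of `C` relative to the full monoidal subcategory `S`. -/
structure RelCenter (S : ObjectProperty C) where
  obj : C
  β : ∀ U : C, S U → (obj ⊗ U ⟶ U ⊗ obj)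
  isHalfBraiding : IsHalfBraiding S obj β

namespace RelCenter

variable {S : ObjectProperty C}

@[ext]
structure Hom (X Y : RelCenter S) where
  hom : X.obj ⟶ Y.obj
  comm : ∀ U (hU : S U), hom ▷ U ≫ Y.β U hU = X.β U hU ≫ U ◁ hom

instance : Category (RelCenter S) where
  Hom := Hom
  id X := ⟨𝟙 X.obj, fun U hU => by simp⟩
  comp f g := ⟨f.hom ≫ g.hom, fun U hU => by
    rw [comp_whiskerRight, Category.assoc, g.comm, ← Category.assoc, f.comm, Category.assoc,
      MonoidalCategory.whiskerLeft_comp]⟩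
  id_comp f := Hom.ext (Category.id_comp f.hom)
  comp_id f := Hom.ext (Category.comp_id f.hom)
  assoc f g h := Hom.ext (Category.assoc f.hom g.hom h.hom)

@[ext]
theorem hom_ext {X Y : RelCenter S} (f g : X ⟶ Y) (w : f.hom = g.hom) : f = g := Hom.ext w

@[simp] theorem id_hom (X : RelCenter S) : Hom.hom (𝟙 X) = 𝟙 X.obj := rfl

@[simp] theorem comp_hom {X Y Z : RelCenter S} (f : X ⟶ Y) (g : Y ⟶ Z) :
    (f ≫ g).hom = f.hom ≫ g.hom := rfl

/-- A morphism of the relative center whose underlying morphism is invertible is invertible. -/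
def isoMk {X Y : RelCenter S} (e : X.obj ≅ Y.obj)
    (comm : ∀ U (hU : S U), e.hom ▷ U ≫ Y.β U hU = X.β U hU ≫ U ◁ e.hom) : X ≅ Y where
  hom := ⟨e.hom, comm⟩
  inv := ⟨e.inv, fun U hU => by
    rw [← cancel_epi (e.hom ▷ U), ← Category.assoc, ← comp_whiskerRight, e.hom_inv_id,
      ← Category.assoc, comm, Category.assoc, ← MonoidalCategory.whiskerLeft_comp, e.hom_inv_id]
    simp⟩
  hom_inv_id := Hom.ext e.hom_inv_id
  inv_hom_id := Hom.ext e.inv_hom_id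

/-- The half-braiding of a tensor product. -/
def tensorβ (X Y : RelCenter S) (U : C) (hU : S U) :
    (X.obj ⊗ Y.obj) ⊗ U ⟶ U ⊗ (X.obj ⊗ Y.obj) :=
  (α_ _ _ _).hom ≫ X.obj ◁ Y.β U hU ≫ (α_ _ _ _).inv ≫ X.β U hU ▷ Y.obj ≫ (α_ _ _ _).hom

def tensorObj (X Y : RelCenter S) : RelCenter S where
  obj := X.obj ⊗ Y.obj
  β := tensorβ X Y
  isHalfBraiding :=
    { isIso := fun U hU => by
        have := X.isHalfBraiding.isIso U hU
        have := Y.isHalfBraiding.isIso U hU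
        unfold tensorβ
        infer_instance
      naturality := fun U V hU hV f => by
        unfold tensorβ
        calc
          _ = 𝟙 _ ⊗≫ (X.obj ◁ (Y.obj ◁ f ≫ Y.β V hV)) ⊗≫ X.β V hV ▷ Y.obj ⊗≫ 𝟙 _ := by monoidal
          _ = 𝟙 _ ⊗≫ X.obj ◁ Y.β U hU ⊗≫ (X.obj ◁ f ≫ X.β V hV) ▷ Y.obj ⊗≫ 𝟙 _ := by
            rw [Y.isHalfBraiding.naturality U V hU hV]; monoidal
          _ = _ := by rw [X.isHalfBraiding.naturality U V hU hV]; monoidal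
      monoidal := fun U V hU hV hUV => by
        unfold tensorβ
        rw [X.isHalfBraiding.monoidal U V hU hV, Y.isHalfBraiding.monoidal U V hU hV]
        calc
          _ = 𝟙 _ ⊗≫ X.obj ◁ Y.β U hU ▷ V ⊗≫ (_ ◁ Y.β V hV ≫ X.β U hU ▷ _) ⊗≫
                U ◁ X.β V hV ▷ Y.obj ⊗≫ 𝟙 _ := by monoidal
          _ = _ := by rw [whisker_exchange]; monoidal }

theorem whiskerLeft_comm (X : RelCenter S) {Y₁ Y₂ : RelCenter S} (f : Y₁ ⟶ Y₂) (U : C)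
    (hU : S U) :
    (X.obj ◁ f.hom) ▷ U ≫ tensorβ X Y₂ U hU = tensorβ X Y₁ U hU ≫ U ◁ X.obj ◁ f.hom := by
  unfold tensorβ
  calc
    _ = 𝟙 _ ⊗≫ X.obj ◁ (f.hom ▷ U ≫ Y₂.β U hU) ⊗≫ X.β U hU ▷ Y₂.obj ⊗≫ 𝟙 _ := by monoidal
    _ = 𝟙 _ ⊗≫ X.obj ◁ Y₁.β U hU ⊗≫ ((X.obj ⊗ U) ◁ f.hom ≫ X.β U hU ▷ Y₂.obj) ⊗≫ 𝟙 _ := by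
      rw [f.comm]; monoidal
    _ = _ := by rw [whisker_exchange]; monoidal

theorem whiskerRight_comm {X₁ X₂ : RelCenter S} (f : X₁ ⟶ X₂) (Y : RelCenter S) (U : C)
    (hU : S U) :
    (f.hom ▷ Y.obj) ▷ U ≫ tensorβ X₂ Y U hU = tensorβ X₁ Y U hU ≫ U ◁ f.hom ▷ Y.obj := by
  unfold tensorβ
  calc
    _ = 𝟙 _ ⊗≫ (f.hom ▷ (Y.obj ⊗ U) ≫ X₂.obj ◁ Y.β U hU) ⊗≫ X₂.β U hU ▷ Y.obj ⊗≫ 𝟙 _ := by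
      monoidal
    _ = 𝟙 _ ⊗≫ X₁.obj ◁ Y.β U hU ⊗≫ (f.hom ▷ U ≫ X₂.β U hU) ▷ Y.obj ⊗≫ 𝟙 _ := by
      rw [← whisker_exchange]; monoidal
    _ = _ := by rw [f.comm]; monoidal

def tensorUnit : RelCenter S where
  obj := 𝟙_ C
  β U _ := (λ_ U).hom ≫ (ρ_ U).inv
  isHalfBraiding :=
    { isIso := fun U hU => inferInstance
      naturality := fun U V hU hV f => by simp
      monoidal := fun U V hU hV hUV => by monoidal }

instance : MonoidalCategory (RelCenter S) where
  tensorObj := tensorObj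
  whiskerLeft X _ _ f := ⟨X.obj ◁ f.hom, whiskerLeft_comm X f⟩
  whiskerRight f Y := ⟨f.hom ▷ Y.obj, whiskerRight_comm f Y⟩
  tensorHom {X₁ Y₁ X₂ Y₂} f g := ⟨f.hom ⊗ₘ g.hom, fun U hU => by
    change (f.hom ⊗ₘ g.hom) ▷ U ≫ tensorβ Y₁ Y₂ U hU =
      tensorβ X₁ X₂ U hU ≫ (U ◁ (f.hom ⊗ₘ g.hom : X₁.obj ⊗ X₂.obj ⟶ Y₁.obj ⊗ Y₂.obj) :
        U ⊗ (X₁.obj ⊗ X₂.obj) ⟶ U ⊗ (Y₁.obj ⊗ Y₂.obj))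
    rw [MonoidalCategory.tensorHom_def, comp_whiskerRight, Category.assoc, whiskerLeft_comm, ← Category.assoc,
      whiskerRight_comm, Category.assoc, MonoidalCategory.whiskerLeft_comp]⟩
  tensorHom_def f g := Hom.ext (MonoidalCategory.tensorHom_def f.hom g.hom)
  tensorUnit := tensorUnit
  associator X Y Z := isoMk (α_ X.obj Y.obj Z.obj) fun U hU => by
    simp only [tensorObj, tensorβ]; monoidal
  leftUnitor X := isoMk (λ_ X.obj) fun U hU => by
    simp only [tensorObj, tensorβ, tensorUnit]; monoidal
  rightUnitor X := isoMk (ρ_ X.obj) fun U hU => by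
    simp only [tensorObj, tensorβ, tensorUnit]; monoidal
  id_tensorHom_id X Y := Hom.ext (MonoidalCategory.id_tensorHom_id X.obj Y.obj)
  tensorHom_comp_tensorHom f₁ f₂ g₁ g₂ :=
    Hom.ext (MonoidalCategory.tensorHom_comp_tensorHom f₁.hom f₂.hom g₁.hom g₂.hom)
  whiskerLeft_id X Y := Hom.ext (MonoidalCategory.whiskerLeft_id X.obj Y.obj)
  id_whiskerRight X Y := Hom.ext (MonoidalCategory.id_whiskerRight X.obj Y.obj)
  associator_naturality f₁ f₂ f₃ :=
    Hom.ext (MonoidalCategory.associator_naturality f₁.hom f₂.hom f₃.hom)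
  leftUnitor_naturality f := Hom.ext (MonoidalCategory.leftUnitor_naturality f.hom)
  rightUnitor_naturality f := Hom.ext (MonoidalCategory.rightUnitor_naturality f.hom)
  pentagon W X Y Z := Hom.ext (MonoidalCategory.pentagon W.obj X.obj Y.obj Z.obj)
  triangle X Y := Hom.ext (MonoidalCategory.triangle X.obj Y.obj)

section Linear

variable [Preadditive C] [MonoidalPreadditive C]

instance (X Y : RelCenter S) : Zero (X ⟶ Y) := ⟨⟨0, fun U hU => by simp⟩⟩
instance (X Y : RelCenter S) : Add (X ⟶ Y) :=
  ⟨fun f g => ⟨f.hom + g.hom, fun U hU => by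
    rw [MonoidalPreadditive.add_whiskerRight, MonoidalPreadditive.whiskerLeft_add,
      Preadditive.add_comp, Preadditive.comp_add, f.comm, g.comm]⟩⟩
instance (X Y : RelCenter S) : Neg (X ⟶ Y) :=
  ⟨fun f => ⟨-f.hom, fun U hU => by
    have h1 : (-f.hom) ▷ U = -(f.hom ▷ U) := (tensorRight U).map_neg
    have h2 : U ◁ (-f.hom) = -(U ◁ f.hom) := (tensorLeft U).map_neg
    rw [h1, h2, Preadditive.neg_comp, Preadditive.comp_neg, f.comm]⟩⟩

@[simp] theorem zero_hom (X Y : RelCenter S) : Hom.hom (0 : X ⟶ Y) = 0 := rfl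
@[simp] theorem add_hom {X Y : RelCenter S} (f g : X ⟶ Y) : (f + g).hom = f.hom + g.hom := rfl
@[simp] theorem neg_hom {X Y : RelCenter S} (f : X ⟶ Y) : (-f).hom = -f.hom := rfl

instance : Preadditive (RelCenter S) where
  homGroup X Y :=
    { add_assoc := fun a b c => Hom.ext (add_assoc a.hom b.hom c.hom)
      zero_add := fun a => Hom.ext (zero_add a.hom)
      add_zero := fun a => Hom.ext (add_zero a.hom)
      neg_add_cancel := fun a => Hom.ext (neg_add_cancel a.hom)
      add_comm := fun a b => Hom.ext (add_comm a.hom b.hom)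
      nsmul := nsmulRec
      zsmul := zsmulRec }
  add_comp _ _ _ f g h := Hom.ext (Preadditive.add_comp _ _ _ f.hom g.hom h.hom)
  comp_add _ _ _ f g h := Hom.ext (Preadditive.comp_add _ _ _ f.hom g.hom h.hom)

variable {𝕂 : Type w} [Field 𝕂] [Linear 𝕂 C] [MonoidalLinear 𝕂 C]

instance (X Y : RelCenter S) : SMul 𝕂 (X ⟶ Y) :=
  ⟨fun a f => ⟨a • f.hom, fun U hU => by
    rw [MonoidalLinear.smul_whiskerRight, MonoidalLinear.whiskerLeft_smul,
      Linear.smul_comp, Linear.comp_smul, f.comm]⟩⟩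

@[simp] theorem smul_hom {X Y : RelCenter S} (a : 𝕂) (f : X ⟶ Y) :
    (a • f).hom = a • f.hom := rfl

instance : Linear 𝕂 (RelCenter S) where
  homModule _ _ :=
    { one_smul := fun f => Hom.ext (one_smul 𝕂 f.hom)
      mul_smul := fun a b f => Hom.ext (mul_smul a b f.hom)
      smul_zero := fun a => Hom.ext (smul_zero a)
      smul_add := fun a f g => Hom.ext (smul_add a f.hom g.hom)
      add_smul := fun a b f => Hom.ext (add_smul a b f.hom)
      zero_smul := fun f => Hom.ext (zero_smul 𝕂 f.hom) }
  smul_comp _ _ _ a f g := Hom.ext (Linear.smul_comp _ _ _ a f.hom g.hom)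
  comp_smul _ _ _ f a g := Hom.ext (Linear.comp_smul _ _ _ f.hom a g.hom)

end Linear

end RelCenter

end RelCenter

/-! ## The `G`-center and the functors `φ_h` -/

/-- The neutral component of a grading. -/
def neutral {G : Type*} [Group G] {C : Type u} [Category.{v} C]
    (deg : G → ObjectProperty C) : ObjectProperty C := deg 1

/-- The `G`-center: the center relative to the neutral component. -/
abbrev GCenter {G : Type*} [Group G] {C : Type u} [Category.{v} C] [MonoidalCategory C]
    (deg : G → ObjectProperty C) :=
  RelCenter (neutral deg)

/-- The grading of the `G`-center by the degree of the underlying object. -/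
def centerDeg {G : Type*} [Group G] {C : Type u} [Category.{v} C] [MonoidalCategory C]
    (deg : G → ObjectProperty C) : G → ObjectProperty (GCenter deg) :=
  fun g c => deg g c.obj

section Crossing

variable {G : Type*} [Group G] {C : Type u} [Category.{v} C] [Abelian C] [MonoidalCategory C]

section Degrees

variable {deg : G → ObjectProperty C}

theorem deg_of_iso [IsGGrading deg] {g : G} {X Y : C} (e : X ≅ Y) (h : deg g X) : deg g Y := by
  refine IsGGrading.sum_mem (deg := deg) g (fun _ : Fin 1 => X)
    { pt := Y, π := fun _ => e.inv, ι := fun _ => e.hom,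
      ι_π := fun j j' => by obtain rfl := Subsingleton.elim j j'; simp } ⟨?_⟩ (fun _ => h)
  exact isBilimitOfTotal _ (by simp)

/-- The dual of an object of degree `g` has degree `g⁻¹`. -/
theorem deg_dual [RightRigidCategory C] [IsGGrading deg] {g : G} {X : C} (h : deg g X) :
    deg g⁻¹ (rdual X) := by
  obtain ⟨n, γ, f, b, hf, ⟨hb⟩, ⟨e⟩⟩ := IsGGrading.decomp (deg := deg) (rdual X)
  refine deg_of_iso e.symm (IsGGrading.sum_mem g⁻¹ f b ⟨hb⟩ fun k => ?_)
  by_cases hk : γ k = g⁻¹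
  · exact hk ▸ hf k
  have h0 : b.ι k ≫ e.inv = 0 := by
    have hz : ∀ a : f k ⟶ 𝟙_ C ⊗ rdual X, a = 0 := fun a => by
      obtain ⟨a, rfl⟩ := (tensorRightHomEquiv (f k) X (rdual X) (𝟙_ C)).surjective a
      obtain ⟨a', ha'⟩ := (tensorRightHomEquiv (f k) X (rdual X) (𝟙_ C)).surjective 0
      have hne : γ k * g ≠ 1 := fun hh => hk (eq_inv_of_mul_eq_one_left hh)
      have hzero := IsGGrading.hom_eq_zero (IsGGrading.tensor_mem (hf k) h)
        (IsGGrading.unit_mem (deg := deg)) hne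
      rw [hzero a, ← hzero a', ha']
    rw [← cancel_mono (λ_ (rdual X)).inv, hz ((b.ι k ≫ e.inv) ≫ _), zero_comp]
  have hι : b.ι k = 0 := by
    rw [← cancel_mono e.inv, h0, zero_comp]
  have hzero : IsZero (f k) := by
    rw [IsZero.iff_id_eq_zero, ← bicone_ι_π_self b k, hι, zero_comp]
  refine IsGGrading.sum_mem g⁻¹ (fun i : Fin 0 => i.elim0)
    { pt := f k, π := fun i => i.elim0, ι := fun i => i.elim0, ι_π := fun i => i.elim0 } ⟨?_⟩
    (fun i => i.elim0)
  exact isBilimitOfTotal _ (hzero.eq_of_src _ _)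

instance [IsGGrading deg] : (neutral deg).IsMonoidal where
  prop_unit := IsGGrading.unit_mem
  prop_tensor X Y hX hY := by
    have := IsGGrading.tensor_mem (deg := deg) hX hY
    rwa [one_mul] at this

theorem neutral_tensor_dual [RightRigidCategory C] [IsGGrading deg] {h : G} {X Y : C}
    (hX : deg h X) (hY : deg h Y) : neutral deg (X ⊗ rdual Y) := by
  have := IsGGrading.tensor_mem hX (deg_dual hY)
  rwa [mul_inv_cancel] at this

theorem neutral_tensor_tensor_dual [RightRigidCategory C] [IsGGrading deg] {h : G} {X Y U : C}
    (hX : deg h X) (hY : deg h Y) (hU : neutral deg U) : neutral deg (X ⊗ U ⊗ rdual Y) := by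
  have := IsGGrading.tensor_mem hX (IsGGrading.tensor_mem (show deg 1 U from hU) (deg_dual hY))
  rwa [one_mul, mul_inv_cancel] at this

end Degrees

variable (𝕂 : Type w) [Field 𝕂] [Linear 𝕂 C] [RightRigidCategory C] [PivotalCategory C]
  (deg : G → ObjectProperty C) [IsGGrading deg] {ι : Type*} [Finite ι] (S : ι → C)

/-- The index set `I_h` of the chosen simple objects of degree `h`. -/
def SimpleIdx (h : G) : Type _ := {i : ι // deg h (S i)}

instance (h : G) : Finite (SimpleIdx deg S h) := inferInstanceAs (Finite {i : ι // deg h (S i)})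

instance (h : G) : Fintype (SimpleIdx deg S h) := Fintype.ofFinite _

/-- `D = ∑_{i ∈ I_e} d_i²`, the dimension of the neutral component. -/
def neutralDim : 𝕂 := ∑ i : SimpleIdx deg S 1, objDim 𝕂 (S i.1) ^ 2

variable {deg}

/-- `I^h(c) = ⨁_{i ∈ I_h} i* ⊗ c ⊗ i`. -/
def indObj (h : G) (c : GCenter deg) : C :=
  ⨁ fun i : SimpleIdx deg S h => rdual (S i.1) ⊗ c.obj ⊗ S i.1

def indMap (h : G) {c d : GCenter deg} (f : c ⟶ d) : indObj S h c ⟶ indObj S h d :=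
  biproduct.map fun i => rdual (S i.1) ◁ f.hom ▷ S i.1

/-- For `X, Y` of the same degree, the morphism `X* ⊗ c ⊗ X ⟶ Y* ⊗ c ⊗ Y` which creates a pair
`Y* ⊗ Y` on the right, moves `X ⊗ Y*` to the left across `c` and evaluates `X* ⊗ X`. -/
def arc {h : G} (c : GCenter deg) {X Y : C} (hX : deg h X) (hY : deg h Y) :
    rdual X ⊗ c.obj ⊗ X ⟶ rdual Y ⊗ c.obj ⊗ Y :=
  𝟙 _ ⊗≫ (rdual X ⊗ c.obj ⊗ X) ◁ pivCoev Y ⊗≫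
    rdual X ◁ c.β (X ⊗ rdual Y) (neutral_tensor_dual hX hY) ▷ Y ⊗≫
      ε_ X (rdual X) ▷ (rdual Y ⊗ c.obj ⊗ Y) ⊗≫ 𝟙 _

/-- The same with an additional strand `U` of neutral degree, which crosses `c` from right to left
in between `X` and `Y*`. -/
def arcBraid {h : G} (c : GCenter deg) {X Y : C} (hX : deg h X) (hY : deg h Y) (U : C)
    (hU : neutral deg U) : (rdual X ⊗ c.obj ⊗ X) ⊗ U ⟶ U ⊗ (rdual Y ⊗ c.obj ⊗ Y) :=
  𝟙 _ ⊗≫ ((rdual X ⊗ c.obj ⊗ X) ⊗ U) ◁ pivCoev Y ⊗≫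
    rdual X ◁ c.β (X ⊗ U ⊗ rdual Y) (neutral_tensor_tensor_dual hX hY hU) ▷ Y ⊗≫
      ε_ X (rdual X) ▷ (U ⊗ rdual Y ⊗ c.obj ⊗ Y) ⊗≫ 𝟙 _

/-- The endomorphism `π^h_c = ∑_{i, j ∈ I_h} (d_i / D) (i* ⊗ c ⊗ i ⟶ j* ⊗ c ⊗ j)` of `I^h(c)`. -/
def crossProj (h : G) (c : GCenter deg) : indObj S h c ⟶ indObj S h c :=
  ∑ i : SimpleIdx deg S h, ∑ j : SimpleIdx deg S h,
    (objDim 𝕂 (S i.1) / neutralDim 𝕂 deg S) •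
      (biproduct.π (fun i : SimpleIdx deg S h => rdual (S i.1) ⊗ c.obj ⊗ S i.1) i ≫
        arc c i.2 j.2 ≫
          biproduct.ι (fun i : SimpleIdx deg S h => rdual (S i.1) ⊗ c.obj ⊗ S i.1) j)

/-- `P(c)`, the image of `π^h_c`. -/
def crossObj (h : G) (c : GCenter deg) : C := image (crossProj 𝕂 S h c)

/-- The inclusion `e_c : P(c) ⟶ I^h(c)`. -/
def crossIncl (h : G) (c : GCenter deg) : crossObj 𝕂 S h c ⟶ indObj S h c :=
  image.ι (crossProj 𝕂 S h c)

/-- The restriction `r_c : I^h(c) ⟶ P(c)`, with `r_c ≫ e_c = π^h_c`. -/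
def crossRestr (h : G) (c : GCenter deg) : indObj S h c ⟶ crossObj 𝕂 S h c :=
  factorThruImage (crossProj 𝕂 S h c)

/-- The morphisms `γ_{P(c), U} : P(c) ⊗ U ⟶ U ⊗ P(c)`. -/
def crossβ (h : G) (c : GCenter deg) (U : C) (hU : neutral deg U) :
    crossObj 𝕂 S h c ⊗ U ⟶ U ⊗ crossObj 𝕂 S h c :=
  crossIncl 𝕂 S h c ▷ U ≫
    (∑ i : SimpleIdx deg S h, ∑ j : SimpleIdx deg S h,
      (objDim 𝕂 (S i.1) / neutralDim 𝕂 deg S) •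
        (biproduct.π (fun i : SimpleIdx deg S h => rdual (S i.1) ⊗ c.obj ⊗ S i.1) i ▷ U ≫
          arcBraid c i.2 j.2 U hU ≫
            U ◁ biproduct.ι (fun i : SimpleIdx deg S h => rdual (S i.1) ⊗ c.obj ⊗ S i.1) j)) ≫
      U ◁ crossRestr 𝕂 S h c

/-- The action `P(f) = e_c ≫ I^h(f) ≫ r_d` on morphisms `f : c ⟶ d` of the `G`-center. -/
def crossMap (h : G) {c d : GCenter deg} (f : c ⟶ d) : crossObj 𝕂 S h c ⟶ crossObj 𝕂 S h d :=
  crossIncl 𝕂 S h c ≫ indMap S h f ≫ crossRestr 𝕂 S h d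

variable (deg)

/-- The data above define functors from the `G`-center to itself: `π^h_c` is idempotent,
`γ_{P(c)}` is a half-braiding, and `P(f)` is a functorial morphism of the `G`-center. -/
structure CrossWellDefined : Prop where
  idempotent : ∀ (h : G) (c : GCenter deg),
    crossProj 𝕂 S h c ≫ crossProj 𝕂 S h c = crossProj 𝕂 S h c
  isHalfBraiding : ∀ (h : G) (c : GCenter deg),
    IsHalfBraiding (neutral deg) (crossObj 𝕂 S h c) (crossβ 𝕂 S h c)
  map_comm : ∀ (h : G) {c d : GCenter deg} (f : c ⟶ d) (U : C) (hU : neutral deg U),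
    crossMap 𝕂 S h f ▷ U ≫ crossβ 𝕂 S h d U hU = crossβ 𝕂 S h c U hU ≫ U ◁ crossMap 𝕂 S h f
  map_id : ∀ (h : G) (c : GCenter deg), crossMap 𝕂 S h (𝟙 c) = 𝟙 (crossObj 𝕂 S h c)
  map_comp : ∀ (h : G) {c d k : GCenter deg} (f : c ⟶ d) (f' : d ⟶ k),
    crossMap 𝕂 S h (f ≫ f') = crossMap 𝕂 S h f ≫ crossMap 𝕂 S h f'

variable {𝕂 S deg}

/-- The functor `φ_h : c ↦ (P(c), γ_{P(c)})`. -/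
def CrossWellDefined.functor (W : CrossWellDefined 𝕂 deg S) (h : G) :
    GCenter deg ⥤ GCenter deg where
  obj c := ⟨crossObj 𝕂 S h c, crossβ 𝕂 S h c, W.isHalfBraiding h c⟩
  map f := ⟨crossMap 𝕂 S h f, W.map_comm h f⟩
  map_id c := RelCenter.Hom.ext (W.map_id h c)
  map_comp f f' := RelCenter.Hom.ext (W.map_comp h f f')

end Crossing

end

/-!
The functor `φ_h` is governed by a universal property. For `c` in the `G`-center, the object
`P = P(c)` comes with isomorphisms `σ_X : c ⊗ X ≅ X ⊗ P` for all `X` of degree `h`, natural in `X`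
and compatible with the half-braidings of `c` and of `P` under tensoring `X` with neutral objects on
the left and on the right (`CenterTransport`). Such a family determines `P`, with its half-braiding,
up to unique isomorphism: a morphism `c ⟶ d` of the center induces natural maps
`X ⊗ P ⟶ X ⊗ Q`, and their partial trace is the only morphism `P ⟶ Q` which gives them back
(`Transport.exists_lift`, `CenterTransport.hom_ext`). For this the unit only has to be a retract of
`X' ⊗ X` for some `X` of degree `h` and `X'` of degree `h⁻¹`, which holds because simple objects have
nonzero dimension.

Transports can be tensored (`CenterTransport.tensor`) and composed (`CenterTransport.comp`), and the
half-braiding of `c` is a transport of `c` to itself along the neutral degree. Hence all structure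
maps of the crossing are the canonical isomorphisms between two transports of one object, and every
coherence diagram commutes because both its sides are morphisms over the same morphism of
transported objects (`TransportFunctor.gCrossing`). The functor `φ_h` is an equivalence as `φ_{h⁻¹}`
is an inverse of it.

It remains to see that `P(c)` is a transport of `c`. The morphism `crossing : c ⊗ X ⟶ X ⊗ Y* ⊗ c ⊗ Y`
creates a pair `Y* ⊗ Y` and moves `X ⊗ Y*` across `c`. By naturality of the half-braiding it absorbs
the arcs which define `π^h_c` and `γ_{P(c)}`, up to a factor `d_Y` for the bubble that is removed
(`crossing_arc`, `crossing_arcBraid`). Together with `∑_{i ∈ I_h} d_i² = D ≠ 0` this makes `π^h_c`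
idempotent, `crossσ` invertible, and `γ_{P(c)}` the half-braiding forced by the transport. The
identity `∑_{i ∈ I_h} d_i² = D` (`sum_objDim_sq`) and the inequality `D ≠ 0` (`neutralDim_ne_zero`)
follow by counting multiplicities; for the latter, `D` is an eigenvalue of a positive definite integer
matrix.
-/

noncomputable section

attribute [local instance] Abelian.hasFiniteBiproducts

set_option linter.unusedSectionVars false

/-! ### Duality and traces in a pivotal category -/

section Duality

variable {C : Type u} [Category.{v} C] [MonoidalCategory C]

theorem rightDualIso_hom_evaluation {X Y₁ Y₂ : C} (p₁ : ExactPairing X Y₁)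
    (p₂ : ExactPairing X Y₂) :
    (rightDualIso p₁ p₂).hom ▷ X ≫ @ExactPairing.evaluation _ _ _ X Y₂ p₂ =
      @ExactPairing.evaluation _ _ _ X Y₁ p₁ := by
  have := @rightAdjointMate_comp_evaluation C _ _ X X ⟨Y₂⟩ ⟨Y₁⟩ (𝟙 X)
  simpa [rightDualIso] using this

theorem coevaluation_rightDualIso_hom {X Y₁ Y₂ : C} (p₁ : ExactPairing X Y₁)
    (p₂ : ExactPairing X Y₂) :
    @ExactPairing.coevaluation _ _ _ X Y₁ p₁ ≫ X ◁ (rightDualIso p₁ p₂).hom =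
      @ExactPairing.coevaluation _ _ _ X Y₂ p₂ := by
  have := @coevaluation_comp_rightAdjointMate C _ _ X X ⟨Y₂⟩ ⟨Y₁⟩ (𝟙 X)
  simpa [rightDualIso] using this

variable [RightRigidCategory C] [PivotalCategory C]

/-- The pivotal structure exhibits `X` as a right dual of `X*`. -/
abbrev pivPairing (X : C) : ExactPairing (rdual X) X :=
  exactPairingCongrRight (PivotalCategory.pivot X)

theorem pivEv_snake (X : C) :
    pivCoev X ▷ rdual X ⊗≫ rdual X ◁ pivEv X = ⊗𝟙.hom :=
  @ExactPairing.evaluation_coevaluation'' _ _ _ (rdual X) X (pivPairing X)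

theorem pivEv_naturality {X Y : C} (f : X ⟶ Y) :
    f ▷ rdual Y ≫ pivEv Y = X ◁ fᘁ ≫ pivEv X := by
  unfold pivEv
  rw [← comp_whiskerRight_assoc, PivotalCategory.naturality, comp_whiskerRight_assoc,
    rightAdjointMate_comp_evaluation, whisker_exchange_assoc]

/-- Cyclicity of the trace. -/
theorem leftTrace_comp_comm {X Y : C} (f : X ⟶ Y) (g : Y ⟶ X) :
    leftTrace (f ≫ g) = leftTrace (g ≫ f) := by
  unfold leftTrace
  rw [comp_whiskerRight_assoc, comp_whiskerRight_assoc, pivEv_naturality f,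
    ← whisker_exchange_assoc, ← coevaluation_comp_rightAdjointMate_assoc]

theorem pivEv_tensor (X Y : C) :
    pivEv (X ⊗ Y) = (X ⊗ Y) ◁ (rightDualTensorIso X Y).hom ⊗≫
      X ◁ pivEv Y ▷ rdual X ⊗≫ pivEv X := by
  have h := PivotalCategory.monoidal X Y
  have key : (X ⊗ Y) ◁ (rightDualTensorIso X Y).hom ≫
      ((PivotalCategory.pivot X).hom ⊗ₘ (PivotalCategory.pivot Y).hom) ▷ _ ≫
      @ExactPairing.evaluation _ _ _ (rdual Y ⊗ rdual X) (rdual (rdual X) ⊗ rdual (rdual Y))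
        ExactPairing.tensor = pivEv (X ⊗ Y) := by
    rw [← h]
    simp only [comp_whiskerRight, Category.assoc]
    rw [rightDualTensorIso, rightDualTensorIso, rightDualIso_hom_evaluation,
      rightAdjointMate_comp_evaluation, whisker_exchange_assoc]
    rw [← MonoidalCategory.whiskerLeft_comp_assoc, Iso.hom_inv_id]
    simp [pivEv]
  rw [← key, ExactPairing.tensor_evaluation]
  unfold pivEv
  rw [MonoidalCategory.tensorHom_def]
  calc
    _ = (X ⊗ Y) ◁ (rightDualTensorIso X Y).hom ⊗≫ ((PivotalCategory.pivot X).hom ▷ Y ▷ (rdual Y ⊗ rdual X) ≫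
         (rdual (rdual X) ◁ (PivotalCategory.pivot Y).hom) ▷ (rdual Y ⊗ rdual X)) ⊗≫
         rdual (rdual X) ◁ ε_ (rdual Y) (rdual (rdual Y)) ▷ rdual X ⊗≫ ε_ (rdual X) (rdual (rdual X)) := by
      monoidal
    _ = (X ⊗ Y) ◁ (rightDualTensorIso X Y).hom ⊗≫ ((PivotalCategory.pivot X).hom ▷ (Y ⊗ (rdual Y ⊗ rdual X)) ≫
         rdual (rdual X) ◁ ((PivotalCategory.pivot Y).hom ▷ (rdual Y ⊗ rdual X) ⊗≫
          ε_ (rdual Y) (rdual (rdual Y)) ▷ rdual X)) ⊗≫ ε_ (rdual X) (rdual (rdual X)) := by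
      monoidal
    _ = _ := by
      rw [← whisker_exchange]; monoidal

omit [PivotalCategory C] in
theorem coevaluation_tensor (X Y : C) :
    η_ (X ⊗ Y) (rdual (X ⊗ Y)) = η_ X (rdual X) ⊗≫ X ◁ η_ Y (rdual Y) ▷ rdual X ⊗≫
      (X ⊗ Y) ◁ (rightDualTensorIso X Y).inv := by
  have h : η_ (X ⊗ Y) (rdual (X ⊗ Y)) ≫ (X ⊗ Y) ◁ (rightDualTensorIso X Y).hom = _ :=
    coevaluation_rightDualIso_hom HasRightDual.exact ExactPairing.tensor
  rw [← cancel_mono ((X ⊗ Y) ◁ (rightDualTensorIso X Y).hom), h, ExactPairing.tensor_coevaluation]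
  simp [monoidalComp]

/-- The partial trace over the second tensor factor. -/
def partialTrace {X Y : C} (f : X ⊗ Y ⟶ X ⊗ Y) : X ⟶ X :=
  𝟙 _ ⊗≫ X ◁ η_ Y (rdual Y) ⊗≫ f ▷ rdual Y ⊗≫ X ◁ pivEv Y ⊗≫ 𝟙 _

theorem leftTrace_tensor {X Y : C} (f : X ⊗ Y ⟶ X ⊗ Y) :
    leftTrace f = leftTrace (partialTrace f) := by
  unfold leftTrace partialTrace
  rw [pivEv_tensor, coevaluation_tensor]
  calc
    _ = η_ X (rdual X) ⊗≫ X ◁ η_ Y (rdual Y) ▷ rdual X ⊗≫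
      ((X ⊗ Y) ◁ (rightDualTensorIso X Y).inv ≫ f ▷ rdual (X ⊗ Y)) ≫
        (X ⊗ Y) ◁ (rightDualTensorIso X Y).hom ⊗≫ X ◁ pivEv Y ▷ rdual X ⊗≫ pivEv X := by monoidal
    _ = η_ X (rdual X) ⊗≫ X ◁ η_ Y (rdual Y) ▷ rdual X ⊗≫ f ▷ (rdual Y ⊗ rdual X) ≫
      (X ⊗ Y) ◁ ((rightDualTensorIso X Y).inv ≫ (rightDualTensorIso X Y).hom)
         ⊗≫ X ◁ pivEv Y ▷ rdual X ⊗≫ pivEv X := by rw [whisker_exchange]; monoidal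
    _ = _ := by rw [Iso.inv_hom_id]; monoidal

/-- The dimension of the dual: both sides are traces of the endomorphism of `X* ⊗ X` which
evaluates and creates a pair. -/
theorem leftTrace_id_rdual (X : C) :
    leftTrace (𝟙 (rdual X)) = leftTrace (rightTrace (𝟙 X)) := by
  have h : partialTrace (ε_ X (rdual X) ≫ pivCoev X) = 𝟙 (rdual X) := by
    unfold partialTrace
    calc
      _ = 𝟙 _ ⊗≫ (rdual X ◁ η_ X (rdual X) ⊗≫ ε_ X (rdual X) ▷ rdual X) ⊗≫
          (pivCoev X ▷ rdual X ⊗≫ rdual X ◁ pivEv X) ⊗≫ 𝟙 _ := by monoidal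
      _ = _ := by
        rw [pivEv_snake, ExactPairing.coevaluation_evaluation'']; monoidal
  rw [← h, ← leftTrace_tensor, leftTrace_comp_comm]
  simp [rightTrace]

end Duality

/-! ### Dimensions in a spherical fusion category -/

section Dimensions

variable {𝕂 : Type w} [Field 𝕂] {C : Type u} [Category.{v} C] [Abelian C] [Linear 𝕂 C]
  [MonoidalCategory C] [MonoidalPreadditive C] [MonoidalLinear 𝕂 C] [RightRigidCategory C]
  [PivotalCategory C]

omit [Abelian C] in
theorem leftTrace_id_congr {X Y : C} (e : X ≅ Y) : leftTrace (𝟙 X) = leftTrace (𝟙 Y) := by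
  rw [← e.hom_inv_id, leftTrace_comp_comm, e.inv_hom_id]

variable (𝕂) in
theorem objDim_congr {X Y : C} (e : X ≅ Y) : objDim 𝕂 X = objDim 𝕂 Y := by
  unfold objDim
  rw [leftTrace_id_congr e]

theorem leftTrace_smul_id (a : 𝕂) (X : C) : leftTrace (a • 𝟙 X) = a • leftTrace (𝟙 X) := by
  simp [leftTrace]

theorem leftTrace_sum {X : C} {n : ℕ} (f : Fin n → (X ⟶ X)) :
    leftTrace (∑ k, f k) = ∑ k, leftTrace (f k) := by
  simp [leftTrace, sum_whiskerRight, Preadditive.comp_sum, Preadditive.sum_comp]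

variable (hC : IsFusion 𝕂 C)

include hC

theorem leftTrace_id (X : C) : leftTrace (𝟙 X) = objDim 𝕂 X • 𝟙 (𝟙_ C) :=
  (unitScalar_smul hC.end_unit _).symm

theorem id_unit_ne_zero : 𝟙 (𝟙_ C) ≠ 0 := by
  intro h0
  have hs : Subsingleton (𝟙_ C ⟶ 𝟙_ C) := ⟨fun a b => by
    rw [← Category.id_comp a, ← Category.id_comp b, h0, zero_comp, zero_comp]⟩
  have := hC.end_unit
  rw [Module.finrank_zero_of_subsingleton] at this
  exact zero_ne_one this

theorem smul_id_unit_injective {a b : 𝕂} (h : a • 𝟙 (𝟙_ C) = b • 𝟙 (𝟙_ C)) : a = b :=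
  smul_left_injective 𝕂 (id_unit_ne_zero hC) h

theorem objDim_tensor (X Y : C) : objDim 𝕂 (X ⊗ Y) = objDim 𝕂 X * objDim 𝕂 Y := by
  apply smul_id_unit_injective hC
  have h : partialTrace (𝟙 (X ⊗ Y)) = objDim 𝕂 Y • 𝟙 X := by
    have : partialTrace (𝟙 (X ⊗ Y)) = 𝟙 _ ⊗≫ X ◁ leftTrace (𝟙 Y) ⊗≫ 𝟙 _ := by
      unfold partialTrace leftTrace
      monoidal
    rw [this, leftTrace_id hC Y]
    simp [monoidalComp]
  rw [← leftTrace_id hC, leftTrace_tensor, h, leftTrace_smul_id, leftTrace_id hC, smul_smul,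
    mul_comm]

theorem objDim_biproduct {n : ℕ} (f : Fin n → C) : objDim 𝕂 (⨁ f) = ∑ k, objDim 𝕂 (f k) := by
  apply smul_id_unit_injective hC
  rw [← leftTrace_id hC, ← biproduct.total, leftTrace_sum, Finset.sum_smul]
  refine Finset.sum_congr rfl fun k _ => ?_
  rw [leftTrace_comp_comm, biproduct.ι_π_self, leftTrace_id hC]

/-- In a fusion category the unit object is simple, because its endomorphisms are scalars. -/
theorem simple_unit : Simple (𝟙_ C) := by
  obtain ⟨n, f, hf, ⟨e⟩⟩ := hC.semisimple (𝟙_ C)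
  rcases n with _ | n
  · exfalso
    apply id_unit_ne_zero hC
    rw [← e.hom_inv_id, ← Category.id_comp e.inv, ← biproduct.total]
    simp
  have := hf 0
  obtain ⟨a, ha⟩ : ∃ a : 𝕂, a • 𝟙 (𝟙_ C) = (e.hom ≫ biproduct.π f 0) ≫ biproduct.ι f 0 ≫ e.inv :=
    ⟨_, unitScalar_smul hC.end_unit _⟩
  have hsec : (biproduct.ι f 0 ≫ e.inv) ≫ (e.hom ≫ biproduct.π f 0) = 𝟙 (f 0) := by simp
  have ha0 : a ≠ 0 := by
    rintro rfl
    apply id_nonzero (f 0)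
    rw [← Category.comp_id (𝟙 (f 0)), ← hsec, Category.assoc, ← Category.assoc (e.hom ≫ _), ← ha]
    simp
  have h1 : IsSplitEpi (biproduct.ι f 0 ≫ e.inv) := IsSplitEpi.mk'
    ⟨a⁻¹ • (e.hom ≫ biproduct.π f 0), by rw [Linear.smul_comp, ← ha, smul_smul,
      inv_mul_cancel₀ ha0, one_smul]⟩
  have h2 : IsSplitMono (biproduct.ι f 0 ≫ e.inv) := IsSplitMono.mk' ⟨_, hsec⟩
  have := isIso_of_mono_of_isSplitEpi (biproduct.ι f 0 ≫ e.inv)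
  exact Simple.of_iso (asIso (biproduct.ι f 0 ≫ e.inv)).symm

/-- A nonzero morphism out of the unit object splits. -/
theorem exists_retraction_of_unit {Z : C} (f : 𝟙_ C ⟶ Z) (hf : f ≠ 0) :
    ∃ g : Z ⟶ 𝟙_ C, f ≫ g = 𝟙 _ := by
  have := simple_unit hC
  obtain ⟨n, s, hs, ⟨e⟩⟩ := hC.semisimple Z
  obtain ⟨k, hk⟩ : ∃ k, f ≫ e.hom ≫ biproduct.π s k ≠ 0 := by
    by_contra! h
    apply hf
    rw [← cancel_mono e.hom]
    ext k
    simpa using h k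
  have := hs k
  have := isIso_of_hom_simple hk
  exact ⟨e.hom ≫ biproduct.π s k ≫ inv (f ≫ e.hom ≫ biproduct.π s k), by
    simpa only [Category.assoc] using IsIso.hom_inv_id (f ≫ e.hom ≫ biproduct.π s k)⟩

/-- Simple objects have nonzero dimension: `1 ⟶ X ⊗ X*` splits, and by Schur's lemma its
retraction is a multiple of the evaluation. -/
theorem objDim_ne_zero [IsAlgClosed 𝕂] (X : C) [Simple X] : objDim 𝕂 X ≠ 0 := by
  intro h0
  have hη : η_ X (rdual X) ≠ 0 := by
    intro h
    apply id_nonzero X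
    have := ExactPairing.evaluation_coevaluation X (rdual X)
    rw [h] at this
    simp only [MonoidalPreadditive.zero_whiskerRight, zero_comp] at this
    rw [← cancel_epi (λ_ X).hom, ← cancel_mono (ρ_ X).inv, Category.comp_id, ← this]
    simp
  obtain ⟨g, hg⟩ := exists_retraction_of_unit hC _ hη
  have := hC.finiteDimensional_hom X X
  obtain ⟨a, ha⟩ := endomorphism_simple_eq_smul_id 𝕂 (𝟙 _ ⊗≫ X ◁ pivCoev X ⊗≫ g ▷ X ⊗≫ 𝟙 _ : X ⟶ X)
  have h1 : g = a • pivEv X := by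
    have : (𝟙 _ ⊗≫ X ◁ pivCoev X ⊗≫ g ▷ X ⊗≫ 𝟙 _ : X ⟶ X) ▷ rdual X ≫ pivEv X = g := by
      calc
        _ = 𝟙 _ ⊗≫ X ◁ pivCoev X ▷ rdual X ⊗≫ (g ▷ (X ⊗ rdual X) ≫ _ ◁ pivEv X) ⊗≫ 𝟙 _ := by
          monoidal
        _ = 𝟙 _ ⊗≫ X ◁ (pivCoev X ▷ rdual X ⊗≫ rdual X ◁ pivEv X) ⊗≫ g ⊗≫ 𝟙 _ := by
          rw [← whisker_exchange]; monoidal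
        _ = _ := by rw [pivEv_snake]; monoidal
    rw [← this, ← ha]
    simp
  have h2 : η_ X (rdual X) ≫ pivEv X = 0 := by
    have := leftTrace_id hC X
    simpa [leftTrace, h0] using this
  apply id_unit_ne_zero hC
  rw [← hg, h1, Linear.comp_smul, h2, smul_zero]

theorem objDim_unit [IsAlgClosed 𝕂] : objDim 𝕂 (𝟙_ C) = 1 := by
  have := simple_unit hC
  have h := objDim_tensor hC (𝟙_ C) (𝟙_ C)
  rw [objDim_congr 𝕂 (λ_ (𝟙_ C))] at h
  exact (mul_eq_left₀ (objDim_ne_zero hC _)).1 h.symm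

theorem pivCoev_evaluation (hsph : IsSpherical C) (X : C) :
    pivCoev X ≫ ε_ X (rdual X) = objDim 𝕂 X • 𝟙 (𝟙_ C) := by
  rw [← leftTrace_id hC, hsph]
  simp [rightTrace]

theorem objDim_rdual [IsAlgClosed 𝕂] (hsph : IsSpherical C) (X : C) :
    objDim 𝕂 (rdual X) = objDim 𝕂 X := by
  apply smul_id_unit_injective hC
  rw [← leftTrace_id hC, leftTrace_id_rdual, ← hsph, leftTrace_id hC, leftTrace_smul_id,
    leftTrace_id hC, objDim_unit hC, one_smul]

end Dimensions

/-! ### Multiplicities and the dimension of the graded components -/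

section Retracts

variable {G : Type*} [Group G] {C : Type u} [Category.{v} C] [Abelian C] [MonoidalCategory C]
  {deg : G → ObjectProperty C} [IsGGrading deg]

theorem deg_of_isZero {X : C} (g : G) (hX : IsZero X) : deg g X := by
  refine IsGGrading.sum_mem g (fun i : Fin 0 => i.elim0)
    { pt := X, π := fun i => i.elim0, ι := fun i => i.elim0, ι_π := fun i => i.elim0 } ⟨?_⟩
    (fun i => i.elim0)
  exact isBilimitOfTotal _ (hX.eq_of_src _ _)

/-- The homogeneous objects of a given degree are closed under retracts. -/
theorem deg_of_retract {g : G} {X Z : C} (i : X ⟶ Z) (r : Z ⟶ X) (hir : i ≫ r = 𝟙 X)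
    (hZ : deg g Z) : deg g X := by
  obtain ⟨n, γ, f, b, hf, ⟨hb⟩, ⟨e⟩⟩ := IsGGrading.decomp (deg := deg) X
  refine deg_of_iso e.symm (IsGGrading.sum_mem g f b ⟨hb⟩ fun k => ?_)
  by_cases hk : γ k = g
  · exact hk ▸ hf k
  have h0 : b.ι k ≫ e.inv ≫ i = 0 := IsGGrading.hom_eq_zero (hf k) hZ hk _
  have hι : b.ι k = 0 := by
    rw [← cancel_mono e.inv, ← Category.comp_id e.inv, ← hir]
    simp only [← Category.assoc] at h0 ⊢
    rw [h0, zero_comp]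
    simp
  apply deg_of_isZero
  rw [IsZero.iff_id_eq_zero, ← bicone_ι_π_self b k, hι, zero_comp]

end Retracts

section Counting

variable {𝕂 : Type w} [Field 𝕂] [IsAlgClosed 𝕂] {G : Type*} [Group G] {C : Type u} [Category.{v} C]
  [Abelian C] [Linear 𝕂 C]
  [MonoidalCategory C] [MonoidalPreadditive C] [MonoidalLinear 𝕂 C] [RightRigidCategory C]
  [PivotalCategory C] {deg : G → ObjectProperty C} [IsGGrading deg]
  {ι : Type*} [Finite ι] {S : ι → C} (hC : IsFusion 𝕂 C) (hS : IsSimpleReps S)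

include hC hS

theorem exists_iso_biproduct_simpleIdx {h : G} {Z : C} (hZ : deg h Z) :
    ∃ (n : ℕ) (a : Fin n → SimpleIdx deg S h), Nonempty (Z ≅ ⨁ fun k => S (a k).1) := by
  obtain ⟨n, f, hf, ⟨e⟩⟩ := hC.semisimple Z
  choose a ha using fun k => hS.surj (f k) (hf k)
  have hdeg : ∀ k, deg h (S (a k)) := fun k => deg_of_iso (ha k).some
    (deg_of_retract (biproduct.ι f k ≫ e.inv) (e.hom ≫ biproduct.π f k) (by simp) hZ)
  exact ⟨n, fun k => ⟨a k, hdeg k⟩, ⟨e ≪≫ biproduct.mapIso fun k => (ha k).some⟩⟩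

open Classical in
theorem finrank_hom_simpleIdx {h : G} (i j : SimpleIdx deg S h) :
    Module.finrank 𝕂 (S i.1 ⟶ S j.1) = if i = j then 1 else 0 := by
  have := hS.simple i.1
  have := hS.simple j.1
  have := hC.finiteDimensional_hom
  rw [finrank_hom_simple_simple]
  congr 1
  exact propext ⟨fun hij => Subtype.ext (hS.inj _ _ hij), fun hij => hij ▸ ⟨Iso.refl _⟩⟩

omit hS in
theorem finrank_hom_biproduct {n : ℕ} (W : C) (f : Fin n → C) :
    Module.finrank 𝕂 (W ⟶ ⨁ f) = ∑ k, Module.finrank 𝕂 (W ⟶ f k) := by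
  have := hC.finiteDimensional_hom
  have e : (W ⟶ ⨁ f) ≃ₗ[𝕂] (∀ k, W ⟶ f k) :=
    { toFun := fun g k => g ≫ biproduct.π f k
      invFun := fun g => biproduct.lift g
      map_add' := fun g g' => by ext; simp
      map_smul' := fun a g => by ext; simp
      left_inv := fun g => by ext; simp
      right_inv := fun g => by ext; simp }
  rw [e.finrank_eq, Module.finrank_pi_fintype]

omit hS in
theorem finrank_biproduct_hom {n : ℕ} (W : C) (f : Fin n → C) :
    Module.finrank 𝕂 (⨁ f ⟶ W) = ∑ k, Module.finrank 𝕂 (f k ⟶ W) := by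
  have := hC.finiteDimensional_hom
  have e : (⨁ f ⟶ W) ≃ₗ[𝕂] (∀ k, f k ⟶ W) :=
    { toFun := fun g k => biproduct.ι f k ≫ g
      invFun := fun g => biproduct.desc g
      map_add' := fun g g' => by ext; simp
      map_smul' := fun a g => by ext; simp
      left_inv := fun g => by ext; simp
      right_inv := fun g => by ext; simp }
  rw [e.finrank_eq, Module.finrank_pi_fintype]

theorem finrank_hom_comm {h : G} (i : SimpleIdx deg S h) {Z : C} (hZ : deg h Z) :
    Module.finrank 𝕂 (S i.1 ⟶ Z) = Module.finrank 𝕂 (Z ⟶ S i.1) := by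
  obtain ⟨n, a, ⟨e⟩⟩ := exists_iso_biproduct_simpleIdx hC hS hZ
  rw [(Linear.homCongr 𝕂 (Iso.refl _) e).finrank_eq, (Linear.homCongr 𝕂 e (Iso.refl _)).finrank_eq,
    finrank_hom_biproduct hC, finrank_biproduct_hom hC]
  classical
  simp only [finrank_hom_simpleIdx hC hS, eq_comm]

/-- The dimension of a homogeneous object, in terms of its multiplicities. -/
theorem sum_finrank_mul_objDim {h : G} {Z : C} (hZ : deg h Z) :
    ∑ j : SimpleIdx deg S h, (Module.finrank 𝕂 (S j.1 ⟶ Z) : 𝕂) * objDim 𝕂 (S j.1) =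
      objDim 𝕂 Z := by
  obtain ⟨n, a, ⟨e⟩⟩ := exists_iso_biproduct_simpleIdx hC hS hZ
  rw [objDim_congr 𝕂 e, objDim_biproduct hC]
  classical
  simp only [(Linear.homCongr 𝕂 (Iso.refl _) e).finrank_eq, finrank_hom_biproduct hC,
    finrank_hom_simpleIdx hC hS, Nat.cast_sum, Finset.sum_mul]
  rw [Finset.sum_comm]
  simp

omit [PivotalCategory C] [IsAlgClosed 𝕂] hC hS in
theorem finrank_tensor_hom (X Y Z : C) :
    Module.finrank 𝕂 (X ⊗ Y ⟶ Z) = Module.finrank 𝕂 (X ⟶ Z ⊗ rdual Y) := by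
  let e : (X ⊗ Y ⟶ Z) ≃ₗ[𝕂] (X ⟶ Z ⊗ rdual Y) :=
    { tensorRightHomEquiv X Y (rdual Y) Z with
      map_add' := fun f g => by simp [tensorRightHomEquiv]
      map_smul' := fun a f => by simp [tensorRightHomEquiv] }
  exact e.finrank_eq

/-- All components of the grading which contain a simple object have the same dimension. -/
theorem sum_objDim_sq (hsph : IsSpherical C) (h : G) (hne : Nonempty (SimpleIdx deg S h)) :
    ∑ j : SimpleIdx deg S h, objDim 𝕂 (S j.1) ^ 2 = neutralDim 𝕂 deg S := by
  obtain ⟨x⟩ := hne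
  have := hS.simple x.1
  apply mul_right_cancel₀ (objDim_ne_zero hC (S x.1))
  have h1 : ∀ i : SimpleIdx deg S 1, deg h (S i.1 ⊗ S x.1) := fun i => by
    simpa using IsGGrading.tensor_mem i.2 x.2
  have h2 : ∀ j : SimpleIdx deg S h, deg 1 (S j.1 ⊗ rdual (S x.1)) := fun j =>
    neutral_tensor_dual j.2 x.2
  symm
  calc
    _ = ∑ i : SimpleIdx deg S 1, objDim 𝕂 (S i.1) * objDim 𝕂 (S i.1 ⊗ S x.1) := by
      simp only [neutralDim, Finset.sum_mul, objDim_tensor hC]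
      exact Finset.sum_congr rfl fun _ _ => by ring
    _ = ∑ i : SimpleIdx deg S 1, ∑ j : SimpleIdx deg S h, objDim 𝕂 (S i.1) *
          (Module.finrank 𝕂 (S i.1 ⊗ S x.1 ⟶ S j.1) * objDim 𝕂 (S j.1)) := by
      refine Finset.sum_congr rfl fun i _ => ?_
      rw [← sum_finrank_mul_objDim hC hS (h1 i), Finset.mul_sum]
      exact Finset.sum_congr rfl fun j _ => by rw [finrank_hom_comm hC hS j (h1 i)]
    _ = ∑ j : SimpleIdx deg S h, objDim 𝕂 (S j.1) * ∑ i : SimpleIdx deg S 1,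
          Module.finrank 𝕂 (S i.1 ⟶ S j.1 ⊗ rdual (S x.1)) * objDim 𝕂 (S i.1) := by
      rw [Finset.sum_comm]
      refine Finset.sum_congr rfl fun j _ => ?_
      rw [Finset.mul_sum]
      exact Finset.sum_congr rfl fun i _ => by rw [finrank_tensor_hom]; ring
    _ = _ := by
      rw [Finset.sum_mul]
      refine Finset.sum_congr rfl fun j _ => ?_
      rw [sum_finrank_mul_objDim hC hS (h2 j), objDim_tensor hC, objDim_rdual hC hsph]
      ring

/-- The dimension of the neutral component is nonzero: it is an eigenvalue of the integer matrix
`∑ i, R i * (R i)ᵀ`, where `R i` is the matrix of right multiplication by the `i`-th simple object,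
and this matrix is positive definite as `R 1` is the identity. -/
theorem neutralDim_ne_zero [CharZero 𝕂] (hsph : IsSpherical C) : neutralDim 𝕂 deg S ≠ 0 := by
  intro hD
  classical
  have := simple_unit hC
  obtain ⟨u, ⟨eu⟩⟩ := hS.surj (𝟙_ C) this
  let o : SimpleIdx deg S 1 := ⟨u, deg_of_iso eu (IsGGrading.unit_mem (deg := deg))⟩
  let R : SimpleIdx deg S 1 → Matrix (SimpleIdx deg S 1) (SimpleIdx deg S 1) ℤ :=
    fun i => Matrix.of fun j k => (Module.finrank 𝕂 (S j.1 ⟶ S k.1 ⊗ S i.1) : ℤ)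
  let d : SimpleIdx deg S 1 → 𝕂 := fun i => objDim 𝕂 (S i.1)
  have hdeg : ∀ i j : SimpleIdx deg S 1, deg 1 (S i.1 ⊗ S j.1) := fun i j => by
    simpa using IsGGrading.tensor_mem i.2 j.2
  have hRT : ∀ i k, ∑ j, (R i j k : 𝕂) * d j = d i * d k := fun i k => by
    rw [mul_comm, ← objDim_tensor hC, ← sum_finrank_mul_objDim hC hS (hdeg k i)]
    simp [R, d]
  have hR : ∀ i j, ∑ k, (R i j k : 𝕂) * d k = d i * d j := fun i j => by
    have h2 : deg 1 (S j.1 ⊗ rdual (S i.1)) := neutral_tensor_dual j.2 i.2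
    rw [mul_comm]
    simp only [d]
    rw [← objDim_rdual hC hsph (S i.1), ← objDim_tensor hC,
      ← sum_finrank_mul_objDim hC hS h2]
    refine Finset.sum_congr rfl fun k _ => ?_
    simp only [R, Matrix.of_apply, Int.cast_natCast]
    rw [finrank_hom_comm hC hS j (hdeg k i), finrank_tensor_hom]
  let M : Matrix (SimpleIdx deg S 1) (SimpleIdx deg S 1) ℤ := ∑ i, R i * (R i).transpose
  -- `R i` and its transpose both act on `d` by `d i`, so `M` acts on it by `D = 0`
  have hMd : (M.map (Int.castRingHom 𝕂)).mulVec d = 0 := by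
    have h1 : M.map (Int.castRingHom 𝕂) = ∑ i, (R i).map (Int.castRingHom 𝕂) *
        ((R i).map (Int.castRingHom 𝕂)).transpose := by
      change (Int.castRingHom 𝕂).mapMatrix M = _
      rw [map_sum]
      exact Finset.sum_congr rfl fun i _ => by rw [map_mul]; rfl
    have h2 : ∀ i, ((R i).map (Int.castRingHom 𝕂)).transpose.mulVec d = d i • d := fun i => by
      ext k
      simpa [Matrix.mulVec, dotProduct] using hRT i k
    have h3 : ∀ i, ((R i).map (Int.castRingHom 𝕂)).mulVec d = d i • d := fun i => by
      ext k
      simpa [Matrix.mulVec, dotProduct] using hR i k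
    rw [h1, Matrix.sum_mulVec]
    simp only [← Matrix.mulVec_mulVec, h2, Matrix.mulVec_smul, h3, smul_smul, ← Finset.sum_smul]
    simp only [← pow_two]
    change neutralDim 𝕂 deg S • d = 0
    rw [hD, zero_smul]
  have hd : d ≠ 0 := fun h0 => by
    have := hS.simple o.1
    exact objDim_ne_zero hC (S o.1) (congrFun h0 o)
  have hdet : (M.map (Int.castRingHom 𝕂)).det = 0 :=
    Matrix.exists_mulVec_eq_zero_iff.1 ⟨d, hd, hMd⟩
  -- the kernel of `M` over `𝕂` descends to the integers, where squares are nonnegative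
  have hdet' : M.det = 0 := by
    rw [← RingHom.mapMatrix_apply, ← RingHom.map_det] at hdet
    simpa using hdet
  obtain ⟨x, hx, hMx⟩ := Matrix.exists_mulVec_eq_zero_iff.2 hdet'
  have hq : ∑ i, dotProduct ((R i).transpose.mulVec x) ((R i).transpose.mulVec x) = 0 := by
    have : dotProduct x (M.mulVec x) = 0 := by rw [hMx, dotProduct_zero]
    rw [Matrix.sum_mulVec, dotProduct_sum] at this
    rw [← this]
    refine Finset.sum_congr rfl fun i _ => ?_
    rw [← Matrix.mulVec_mulVec, Matrix.dotProduct_mulVec x, ← Matrix.mulVec_transpose]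
  have h0 := (Finset.sum_eq_zero_iff_of_nonneg fun i _ =>
    (Finset.sum_nonneg fun j _ => mul_self_nonneg _)).1 hq o (Finset.mem_univ _)
  have hone : R o = 1 := by
    ext j k
    simp only [R, Matrix.of_apply, Matrix.one_apply]
    rw [(Linear.homCongr 𝕂 (Iso.refl (S j.1)) (whiskerLeftIso (S k.1) eu.symm ≪≫
      ρ_ (S k.1))).finrank_eq, finrank_hom_simpleIdx hC hS]
    split_ifs <;> simp
  rw [hone, Matrix.transpose_one, Matrix.one_mulVec] at h0
  exact hx (dotProduct_self_eq_zero.1 h0)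

end Counting

/-! ### Transports past homogeneous objects -/

section Transport

variable {G : Type*} [Group G] {C : Type u} [Category.{v} C] [Abelian C] [MonoidalCategory C]
  {deg : G → ObjectProperty C} [IsGGrading deg]

variable (deg) in
/-- The degree `h` is split if the unit object is a retract of `X' ⊗ X` for some `X` of degree `h`
and `X'` of degree `h⁻¹`. -/
def IsSplitDegree (h : G) : Prop :=
  ∃ (X X' : C) (s : 𝟙_ C ⟶ X' ⊗ X) (r : X' ⊗ X ⟶ 𝟙_ C), deg h X ∧ deg h⁻¹ X' ∧ s ≫ r = 𝟙 _

omit [Abelian C] in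
theorem whiskerLeft_injective_of_split {X X' : C} (s : 𝟙_ C ⟶ X' ⊗ X) (r : X' ⊗ X ⟶ 𝟙_ C)
    (hsr : s ≫ r = 𝟙 _) {P Q : C} {f f' : P ⟶ Q} (h : X ◁ f = X ◁ f') : f = f' := by
  have key : ∀ a : P ⟶ Q, a = 𝟙 _ ⊗≫ s ▷ P ⊗≫ X' ◁ X ◁ a ⊗≫ r ▷ Q ⊗≫ 𝟙 _ := fun a => by
    symm
    calc
      _ = 𝟙 _ ⊗≫ s ▷ P ⊗≫ ((X' ⊗ X) ◁ a ≫ r ▷ Q) ⊗≫ 𝟙 _ := by monoidal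
      _ = 𝟙 _ ⊗≫ (s ≫ r) ▷ P ⊗≫ a := by rw [whisker_exchange]; monoidal
      _ = a := by rw [hsr]; monoidal
  rw [key f, key f', h]

/-- A transport of `c` along the objects of degree `h`: isomorphisms `c ⊗ X ≅ X ⊗ P` for all `X` of
degree `h`, natural in `X` and compatible with the half-braiding of `c` under tensoring `X` with
neutral objects on the left. Such a `P` is unique up to a unique isomorphism; it is the conjugate of
`c` by the component of degree `h`. -/
structure Transport (h : G) (c : GCenter deg) (P : C) where
  σ : ∀ X : C, deg h X → (c.obj ⊗ X ⟶ X ⊗ P)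
  isIso : ∀ X (hX : deg h X), IsIso (σ X hX)
  natural : ∀ X Y (hX : deg h X) (hY : deg h Y) (f : X ⟶ Y),
    c.obj ◁ f ≫ σ Y hY = σ X hX ≫ f ▷ P
  left : ∀ U X (hU : neutral deg U) (hX : deg h X) (hUX : deg h (U ⊗ X)),
    σ (U ⊗ X) hUX =
      (α_ c.obj U X).inv ≫ c.β U hU ▷ X ≫ (α_ U c.obj X).hom ≫ U ◁ σ X hX ≫ (α_ U X P).inv

namespace Transport

variable {h : G} {c d : GCenter deg} {P Q : C}

theorem deg_neutral_tensor {h : G} {U X : C} (hU : neutral deg U) (hX : deg h X) :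
    deg h (U ⊗ X) := by
  simpa using IsGGrading.tensor_mem (show deg 1 U from hU) hX

theorem deg_tensor_neutral {h : G} {U X : C} (hX : deg h X) (hU : neutral deg U) :
    deg h (X ⊗ U) := by
  simpa using IsGGrading.tensor_mem hX (show deg 1 U from hU)

theorem left_natural (T : Transport h c P) {U X Y : C} (hU : neutral deg U) (hX : deg h X)
    (hY : deg h Y) (g : U ⊗ X ⟶ Y) :
    c.obj ◁ g ≫ T.σ Y hY =
      (α_ c.obj U X).inv ≫ c.β U hU ▷ X ≫ (α_ U c.obj X).hom ≫ U ◁ T.σ X hX ≫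
        (α_ U X P).inv ≫ g ▷ P := by
  rw [T.natural _ _ (deg_neutral_tensor hU hX) hY, T.left U X hU hX]
  simp only [Category.assoc]

/-- A morphism of the center induces a morphism between transports. It is a partial trace of
the morphisms `X ⊗ P ⟶ X ⊗ Q` obtained by conjugation. -/
theorem exists_lift (T : Transport h c P) (T' : Transport h d Q) (hs : IsSplitDegree deg h)
    (f : c ⟶ d) :
    ∃ f' : P ⟶ Q, ∀ X hX, f.hom ▷ X ≫ T'.σ X hX = T.σ X hX ≫ X ◁ f' := by
  obtain ⟨X, X', s, r, hX, hX', hsr⟩ := hs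
  have hi := T.isIso
  let θ : ∀ Z (hZ : deg h Z), Z ⊗ P ⟶ Z ⊗ Q := fun Z hZ => inv (T.σ Z hZ) ≫ f.hom ▷ Z ≫ T'.σ Z hZ
  have hθ : ∀ Z hZ, T.σ Z hZ ≫ θ Z hZ = f.hom ▷ Z ≫ T'.σ Z hZ := fun Z hZ => by simp [θ]
  -- the family `θ` commutes with the maps `g : U ⊗ X ⟶ Z`
  have hmod : ∀ U Z (hU : neutral deg U) (hZ : deg h Z) (g : U ⊗ X ⟶ Z),
      U ◁ θ X hX ≫ (α_ U X Q).inv ≫ g ▷ Q = (α_ U X P).inv ≫ g ▷ P ≫ θ Z hZ := by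
    intro U Z hU hZ g
    have := c.isHalfBraiding.isIso U hU
    rw [← cancel_epi ((α_ c.obj U X).inv ≫ c.β U hU ▷ X ≫ (α_ U c.obj X).hom ≫ U ◁ T.σ X hX)]
    symm
    calc
      _ = (c.obj ◁ g ≫ T.σ Z hZ) ≫ θ Z hZ := by
        rw [T.left_natural hU hX hZ]; simp only [Category.assoc]
      _ = f.hom ▷ _ ≫ (d.obj ◁ g ≫ T'.σ Z hZ) := by
        rw [Category.assoc, hθ, whisker_exchange_assoc]
      _ = (α_ c.obj U X).inv ≫ (f.hom ▷ U ≫ d.β U hU) ▷ X ≫ (α_ U d.obj X).hom ≫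
            U ◁ T'.σ X hX ≫ (α_ U X Q).inv ≫ g ▷ Q := by
        rw [T'.left_natural hU hX hZ]; simp
      _ = (α_ c.obj U X).inv ≫ c.β U hU ▷ X ≫ (α_ U c.obj X).hom ≫
            U ◁ (f.hom ▷ X ≫ T'.σ X hX) ≫ (α_ U X Q).inv ≫ g ▷ Q := by
        rw [f.comm]; simp
      _ = _ := by rw [← hθ]; simp
  refine ⟨𝟙 _ ⊗≫ s ▷ P ⊗≫ X' ◁ θ X hX ⊗≫ r ▷ Q ⊗≫ 𝟙 _, fun Z hZ => ?_⟩
  have hU : neutral deg (Z ⊗ X') := by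
    have := IsGGrading.tensor_mem hZ hX'
    rwa [mul_inv_cancel] at this
  rw [← hθ]
  congr 1
  symm
  calc
    _ = 𝟙 _ ⊗≫ Z ◁ s ▷ P ⊗≫ ((Z ⊗ X') ◁ θ X hX ≫ (α_ _ X Q).inv ≫
          ((α_ Z X' X).hom ≫ Z ◁ r ≫ (ρ_ Z).hom) ▷ Q) := by monoidal
    _ = 𝟙 _ ⊗≫ Z ◁ (s ≫ r) ▷ P ⊗≫ θ Z hZ := by
      rw [hmod _ Z hU hZ]; monoidal
    _ = _ := by rw [hsr]; monoidal

/-- Compatibility of a transport with a braiding of `P` with neutral objects, under tensoring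
with neutral objects on the right. -/
def IsRight (T : Transport h c P) (β : ∀ U : C, neutral deg U → (P ⊗ U ⟶ U ⊗ P)) : Prop :=
  ∀ X U (hX : deg h X) (hU : neutral deg U) (hXU : deg h (X ⊗ U)),
    T.σ (X ⊗ U) hXU =
      (α_ c.obj X U).inv ≫ T.σ X hX ▷ U ≫ (α_ X P U).hom ≫ X ◁ β U hU ≫ (α_ X U P).inv

theorem IsRight.σ_whiskerRight {T : Transport h c P}
    {β : ∀ U : C, neutral deg U → (P ⊗ U ⟶ U ⊗ P)} (hβ : T.IsRight β) {X U : C} (hX : deg h X)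
    (hU : neutral deg U) :
    T.σ X hX ▷ U ≫ (α_ X P U).hom ≫ X ◁ β U hU =
      (α_ c.obj X U).hom ≫ T.σ (X ⊗ U) (deg_tensor_neutral hX hU) ≫ (α_ X U P).hom := by
  rw [hβ X U hX hU]
  simp

/-- The half-braiding of `P` is forced by the transport. -/
theorem IsRight.isHalfBraiding {T : Transport h c P}
    {β : ∀ U : C, neutral deg U → (P ⊗ U ⟶ U ⊗ P)} (hβ : T.IsRight β)
    (hs : IsSplitDegree deg h) : IsHalfBraiding (neutral deg) P β := by
  obtain ⟨X, X', s, r, hX, hX', hsr⟩ := hs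
  have hi := T.isIso
  have hfaith : ∀ {P Q : C} {f f' : P ⟶ Q}, X ◁ f = X ◁ f' → f = f' := fun h =>
    whiskerLeft_injective_of_split s r hsr h
  have : (tensorLeft X).Faithful := ⟨fun h => hfaith h⟩
  refine ⟨fun U hU => ?_, fun U V hU hV f => ?_, fun U V hU hV hUV => ?_⟩
  -- each property holds for `X ◁ β`, which the transport expresses through `σ` alone
  · have h1 : X ◁ β U hU = (α_ X P U).inv ≫ inv (T.σ X hX ▷ U) ≫
        (α_ c.obj X U).hom ≫ T.σ (X ⊗ U) (deg_tensor_neutral hX hU) ≫ (α_ X U P).hom := by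
      rw [← hβ.σ_whiskerRight hX hU]; simp
    have : IsIso ((tensorLeft X).map (β U hU)) := by
      change IsIso (X ◁ β U hU)
      rw [h1]
      infer_instance
    exact isIso_of_reflects_iso (β U hU) (tensorLeft X)
  · apply hfaith
    rw [← cancel_epi (T.σ X hX ▷ U ≫ (α_ X P U).hom)]
    calc
      _ = (c.obj ⊗ X) ◁ f ≫ (T.σ X hX ▷ V ≫ (α_ X P V).hom ≫ X ◁ β V hV) := by
        rw [whisker_exchange_assoc]; simp
      _ = 𝟙 _ ⊗≫ (c.obj ◁ (X ◁ f) ≫ T.σ (X ⊗ V) (deg_tensor_neutral hX hV)) ⊗≫ 𝟙 _ := by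
        rw [hβ.σ_whiskerRight hX hV]; monoidal
      _ = ((α_ c.obj X U).hom ≫ T.σ (X ⊗ U) (deg_tensor_neutral hX hU) ≫ (α_ X U P).hom) ≫
          X ◁ f ▷ P := by
        rw [T.natural _ _ (deg_tensor_neutral hX hU)]; monoidal
      _ = _ := by
        rw [← hβ.σ_whiskerRight hX hU]; simp
  · apply hfaith
    rw [← cancel_epi (T.σ X hX ▷ (U ⊗ V) ≫ (α_ X P (U ⊗ V)).hom)]
    have hXU := deg_tensor_neutral hX hU
    calc
      _ = (α_ c.obj X (U ⊗ V)).hom ≫ T.σ (X ⊗ U ⊗ V) (deg_tensor_neutral hX hUV) ≫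
          (α_ X _ P).hom := by
        rw [← hβ.σ_whiskerRight hX hUV]; simp
      _ = 𝟙 _ ⊗≫ (c.obj ◁ (α_ X U V).inv ≫ T.σ ((X ⊗ U) ⊗ V) (deg_tensor_neutral hXU hV)) ⊗≫
          𝟙 _ := by
        rw [T.natural _ _ (deg_tensor_neutral hX hUV)]; monoidal
      _ = 𝟙 _ ⊗≫ ((α_ c.obj X U).hom ≫ T.σ (X ⊗ U) hXU ≫ (α_ X U P).hom) ▷ V ⊗≫
            X ◁ U ◁ β V hV ⊗≫ 𝟙 _ := by
        rw [hβ _ _ hXU hV]; monoidal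
      _ = _ := by
        rw [← hβ.σ_whiskerRight hX hU]; monoidal

end Transport

end Transport

/-! ### Transports in the center -/

section CenterTransport

variable {G : Type*} [Group G] {C : Type u} [Category.{v} C] [Abelian C] [MonoidalCategory C]
  {deg : G → ObjectProperty C} [IsGGrading deg]

/-- A transport of `c` along degree `h` whose target is an object of the center, with compatible
half-braiding. -/
structure CenterTransport (h : G) (c P : GCenter deg) extends Transport h c P.obj where
  right : toTransport.IsRight P.β

namespace CenterTransport

open Transport

variable {h g k : G} {c d e P Q R : GCenter deg}

/-- The morphism of the center induced on transports. -/
theorem exists_map (T : CenterTransport h c P) (T' : CenterTransport h d Q)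
    (hs : IsSplitDegree deg h) (f : c ⟶ d) :
    ∃ f' : P ⟶ Q, ∀ X hX, f.hom ▷ X ≫ T'.σ X hX = T.σ X hX ≫ X ◁ f'.hom := by
  obtain ⟨f', hf'⟩ := T.exists_lift T'.toTransport hs f
  refine ⟨⟨f', fun U hU => ?_⟩, hf'⟩
  obtain ⟨X, X', s, r, hX, hX', hsr⟩ := hs
  have hi := T.isIso
  apply whiskerLeft_injective_of_split s r hsr
  rw [← cancel_epi (T.σ X hX ▷ U ≫ (α_ X P.obj U).hom)]
  have hXU := deg_tensor_neutral hX hU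
  calc
    _ = (T.σ X hX ≫ X ◁ f') ▷ U ≫ (α_ X Q.obj U).hom ≫ X ◁ Q.β U hU := by simp
    _ = (f.hom ▷ X) ▷ U ≫ (T'.σ X hX ▷ U ≫ (α_ X Q.obj U).hom ≫ X ◁ Q.β U hU) := by
      rw [← hf', comp_whiskerRight, Category.assoc]
    _ = 𝟙 _ ⊗≫ (f.hom ▷ (X ⊗ U) ≫ T'.σ (X ⊗ U) hXU) ⊗≫ 𝟙 _ := by
      rw [T'.right.σ_whiskerRight hX hU]; monoidal
    _ = ((α_ c.obj X U).hom ≫ T.σ (X ⊗ U) hXU ≫ (α_ X U P.obj).hom) ≫ X ◁ U ◁ f' := by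
      rw [hf']; monoidal
    _ = _ := by
      rw [← T.right.σ_whiskerRight hX hU]; simp

/-- The morphism `P ⟶ Q` induced by `f : c ⟶ d` on transports. It is characterized by `map_spec`
and `hom_ext`. -/
def map (T : CenterTransport h c P) (T' : CenterTransport h d Q)
    (hs : IsSplitDegree deg h) (f : c ⟶ d) : P ⟶ Q := (T.exists_map T' hs f).choose

theorem map_spec (T : CenterTransport h c P) (T' : CenterTransport h d Q)
    (hs : IsSplitDegree deg h) (f : c ⟶ d) (X : C) (hX : deg h X) :
    T.σ X hX ≫ X ◁ (T.map T' hs f).hom = f.hom ▷ X ≫ T'.σ X hX :=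
  ((T.exists_map T' hs f).choose_spec X hX).symm

theorem map_spec_assoc (T : CenterTransport h c P) (T' : CenterTransport h d Q)
    (hs : IsSplitDegree deg h) (f : c ⟶ d) (X : C) (hX : deg h X) {Z : C} (z : X ⊗ Q.obj ⟶ Z) :
    T.σ X hX ≫ X ◁ (T.map T' hs f).hom ≫ z = f.hom ▷ X ≫ T'.σ X hX ≫ z := by
  rw [← Category.assoc, map_spec, Category.assoc]

theorem hom_ext (T : CenterTransport h c P) (hs : IsSplitDegree deg h) {f f' : P ⟶ Q}
    (H : ∀ X hX, T.σ X hX ≫ X ◁ f.hom = T.σ X hX ≫ X ◁ f'.hom) : f = f' := by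
  obtain ⟨X, X', s, r, hX, hX', hsr⟩ := hs
  have hi := T.isIso
  ext
  apply whiskerLeft_injective_of_split s r hsr
  rw [← cancel_epi (T.σ X hX), H]

theorem eq_map (T : CenterTransport h c P) (T' : CenterTransport h d Q)
    (hs : IsSplitDegree deg h) (f : c ⟶ d) (f' : P ⟶ Q)
    (H : ∀ X hX, T.σ X hX ≫ X ◁ f'.hom = f.hom ▷ X ≫ T'.σ X hX) : f' = T.map T' hs f :=
  T.hom_ext hs fun X hX => by rw [H, map_spec]

theorem map_comp_map (T : CenterTransport h c P) (T' : CenterTransport h d Q)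
    (T'' : CenterTransport h e R) (hs : IsSplitDegree deg h) (f : c ⟶ d) (f' : d ⟶ e) :
    T.map T' hs f ≫ T'.map T'' hs f' = T.map T'' hs (f ≫ f') :=
  T.eq_map _ _ _ _ fun X hX => by
    rw [RelCenter.comp_hom, MonoidalCategory.whiskerLeft_comp, map_spec_assoc, map_spec]
    simp

theorem map_id (T : CenterTransport h c P) (hs : IsSplitDegree deg h) :
    T.map T hs (𝟙 c) = 𝟙 P :=
  (T.eq_map _ _ _ _ fun X hX => by simp).symm

/-- Two transports of the same object have isomorphic targets. -/
def iso (T : CenterTransport h c P) (T' : CenterTransport h c Q) (hs : IsSplitDegree deg h) :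
    P ≅ Q where
  hom := T.map T' hs (𝟙 c)
  inv := T'.map T hs (𝟙 c)
  hom_inv_id := by rw [map_comp_map, Category.comp_id, map_id]
  inv_hom_id := by rw [map_comp_map, Category.comp_id, map_id]

/-- The half-braiding of `c` transports `c` to itself along the neutral degree. -/
def refl (c : GCenter deg) : CenterTransport 1 c c where
  σ := c.β
  isIso := c.isHalfBraiding.isIso
  natural := c.isHalfBraiding.naturality
  left U X hU hX hUX := c.isHalfBraiding.monoidal U X hU hX hUX
  right X U hX hU hXU := c.isHalfBraiding.monoidal X U hX hU hXU

variable (deg) in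
/-- The unit object is transported to itself. -/
def unit (h : G) : CenterTransport h (𝟙_ (GCenter deg)) (𝟙_ (GCenter deg)) where
  σ X _ := (λ_ X).hom ≫ (ρ_ X).inv
  isIso X hX := (inferInstance : IsIso ((λ_ X).hom ≫ (ρ_ X).inv))
  natural X Y hX hY f := by
    change 𝟙_ C ◁ f ≫ (λ_ Y).hom ≫ (ρ_ Y).inv = ((λ_ X).hom ≫ (ρ_ X).inv) ≫ f ▷ 𝟙_ C
    monoidal
  left U X hU hX hUX := by
    change (λ_ _).hom ≫ (ρ_ _).inv = (α_ (𝟙_ C) U X).inv ≫ ((λ_ U).hom ≫ (ρ_ U).inv) ▷ X ≫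
      (α_ U (𝟙_ C) X).hom ≫ U ◁ ((λ_ X).hom ≫ (ρ_ X).inv) ≫ (α_ U X (𝟙_ C)).inv
    monoidal
  right X U hX hU hXU := by
    change (λ_ _).hom ≫ (ρ_ _).inv = (α_ (𝟙_ C) X U).inv ≫ ((λ_ X).hom ≫ (ρ_ X).inv) ▷ U ≫
      (α_ X (𝟙_ C) U).hom ≫ X ◁ ((λ_ U).hom ≫ (ρ_ U).inv) ≫ (α_ X U (𝟙_ C)).inv
    monoidal

/-- The transports of a tensor product, by moving both factors past `X` in turn. -/
def tensor (T : CenterTransport h c P) (T' : CenterTransport h d Q) :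
    CenterTransport h (c ⊗ d) (P ⊗ Q) where
  σ X hX := (α_ c.obj d.obj X).hom ≫ c.obj ◁ T'.σ X hX ≫ (α_ c.obj X Q.obj).inv ≫
    T.σ X hX ▷ Q.obj ≫ (α_ X P.obj Q.obj).hom
  isIso X hX := by
    have := T.isIso X hX
    have := T'.isIso X hX
    exact (inferInstance : IsIso ((α_ c.obj d.obj X).hom ≫ c.obj ◁ T'.σ X hX ≫
      (α_ c.obj X Q.obj).inv ≫ T.σ X hX ▷ Q.obj ≫ (α_ X P.obj Q.obj).hom))
  natural X Y hX hY f := by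
    change (c.obj ⊗ d.obj) ◁ f ≫ (α_ c.obj d.obj Y).hom ≫ c.obj ◁ T'.σ Y hY ≫
      (α_ c.obj Y Q.obj).inv ≫ T.σ Y hY ▷ Q.obj ≫ (α_ Y P.obj Q.obj).hom =
      ((α_ c.obj d.obj X).hom ≫ c.obj ◁ T'.σ X hX ≫ (α_ c.obj X Q.obj).inv ≫
        T.σ X hX ▷ Q.obj ≫ (α_ X P.obj Q.obj).hom) ≫ f ▷ (P.obj ⊗ Q.obj)
    calc
      _ = 𝟙 _ ⊗≫ (c.obj ◁ (d.obj ◁ f ≫ T'.σ Y hY)) ⊗≫ T.σ Y hY ▷ Q.obj ⊗≫ 𝟙 _ := by monoidal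
      _ = 𝟙 _ ⊗≫ c.obj ◁ T'.σ X hX ⊗≫ (c.obj ◁ f ≫ T.σ Y hY) ▷ Q.obj ⊗≫ 𝟙 _ := by
        rw [T'.natural X Y hX hY]; monoidal
      _ = _ := by rw [T.natural X Y hX hY]; monoidal
  left U X hU hX hUX := by
    change (α_ c.obj d.obj (U ⊗ X)).hom ≫ c.obj ◁ T'.σ (U ⊗ X) hUX ≫
      (α_ c.obj (U ⊗ X) Q.obj).inv ≫ T.σ (U ⊗ X) hUX ▷ Q.obj ≫ (α_ (U ⊗ X) P.obj Q.obj).hom =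
      (α_ (c.obj ⊗ d.obj) U X).inv ≫ RelCenter.tensorβ c d U hU ▷ X ≫
        (α_ U (c.obj ⊗ d.obj) X).hom ≫ U ◁ ((α_ c.obj d.obj X).hom ≫ c.obj ◁ T'.σ X hX ≫
          (α_ c.obj X Q.obj).inv ≫ T.σ X hX ▷ Q.obj ≫ (α_ X P.obj Q.obj).hom) ≫
          (α_ U X (P.obj ⊗ Q.obj)).inv
    unfold RelCenter.tensorβ
    rw [T.left U X hU hX hUX, T'.left U X hU hX hUX]
    calc
      _ = 𝟙 _ ⊗≫ c.obj ◁ d.β U hU ▷ X ⊗≫ (_ ◁ T'.σ X hX ≫ c.β U hU ▷ _) ⊗≫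
            U ◁ T.σ X hX ▷ Q.obj ⊗≫ 𝟙 _ := by monoidal
      _ = _ := by rw [whisker_exchange]; monoidal
  right X U hX hU hXU := by
    change (α_ c.obj d.obj (X ⊗ U)).hom ≫ c.obj ◁ T'.σ (X ⊗ U) hXU ≫
      (α_ c.obj (X ⊗ U) Q.obj).inv ≫ T.σ (X ⊗ U) hXU ▷ Q.obj ≫ (α_ (X ⊗ U) P.obj Q.obj).hom =
      (α_ (c.obj ⊗ d.obj) X U).inv ≫ ((α_ c.obj d.obj X).hom ≫ c.obj ◁ T'.σ X hX ≫
          (α_ c.obj X Q.obj).inv ≫ T.σ X hX ▷ Q.obj ≫ (α_ X P.obj Q.obj).hom) ▷ U ≫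
        (α_ X (P.obj ⊗ Q.obj) U).hom ≫ X ◁ RelCenter.tensorβ P Q U hU ≫
          (α_ X U (P.obj ⊗ Q.obj)).inv
    unfold RelCenter.tensorβ
    rw [T.right X U hX hU hXU, T'.right X U hX hU hXU]
    calc
      _ = 𝟙 _ ⊗≫ c.obj ◁ T'.σ X hX ▷ U ⊗≫ (_ ◁ Q.β U hU ≫ T.σ X hX ▷ _) ⊗≫
            X ◁ P.β U hU ▷ Q.obj ⊗≫ 𝟙 _ := by monoidal
      _ = _ := by rw [whisker_exchange]; monoidal

theorem tensor_σ (T : CenterTransport h c P) (T' : CenterTransport h d Q) (X : C) (hX : deg h X) :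
    (T.tensor T').σ X hX = (α_ c.obj d.obj X).hom ≫ c.obj ◁ T'.σ X hX ≫ (α_ c.obj X Q.obj).inv ≫
    T.σ X hX ▷ Q.obj ≫ (α_ X P.obj Q.obj).hom := rfl

/-! ### Composition of transports -/

/-- The transport of `c` past `X ⊗ Y`, where `X` and `Y` have degrees `h` and `g`. -/
def pair (T : CenterTransport h c P) (T' : CenterTransport g P Q) {X Y : C} (hX : deg h X)
    (hY : deg g Y) : c.obj ⊗ (X ⊗ Y) ⟶ (X ⊗ Y) ⊗ Q.obj :=
  (α_ c.obj X Y).inv ≫ T.σ X hX ▷ Y ≫ (α_ X P.obj Y).hom ≫ X ◁ T'.σ Y hY ≫ (α_ X Y Q.obj).inv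

theorem pair_natural_left (T : CenterTransport h c P) (T' : CenterTransport g P Q) {X X' Y : C}
    (hX : deg h X) (hX' : deg h X') (hY : deg g Y) (f : X ⟶ X') :
    c.obj ◁ (f ▷ Y) ≫ T.pair T' hX' hY = T.pair T' hX hY ≫ (f ▷ Y) ▷ Q.obj := by
  unfold pair
  calc
    _ = 𝟙 _ ⊗≫ (c.obj ◁ f ≫ T.σ X' hX') ▷ Y ⊗≫ X' ◁ T'.σ Y hY ⊗≫ 𝟙 _ := by monoidal
    _ = 𝟙 _ ⊗≫ T.σ X hX ▷ Y ⊗≫ (f ▷ (P.obj ⊗ Y) ≫ X' ◁ T'.σ Y hY) ⊗≫ 𝟙 _ := by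
      rw [T.natural X X' hX hX']; monoidal
    _ = _ := by rw [← whisker_exchange]; monoidal

theorem pair_natural_right (T : CenterTransport h c P) (T' : CenterTransport g P Q) {X Y Y' : C}
    (hX : deg h X) (hY : deg g Y) (hY' : deg g Y') (f : Y ⟶ Y') :
    c.obj ◁ (X ◁ f) ≫ T.pair T' hX hY' = T.pair T' hX hY ≫ (X ◁ f) ▷ Q.obj := by
  unfold pair
  calc
    _ = 𝟙 _ ⊗≫ ((c.obj ⊗ X) ◁ f ≫ T.σ X hX ▷ Y') ⊗≫ X ◁ T'.σ Y' hY' ⊗≫ 𝟙 _ := by monoidal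
    _ = 𝟙 _ ⊗≫ T.σ X hX ▷ Y ⊗≫ X ◁ (P.obj ◁ f ≫ T'.σ Y' hY') ⊗≫ 𝟙 _ := by
      rw [whisker_exchange]; monoidal
    _ = _ := by rw [T'.natural Y Y' hY hY']; monoidal

/-- A neutral object may be absorbed into either factor. -/
theorem pair_balanced (T : CenterTransport h c P) (T' : CenterTransport g P Q) {X U Y : C}
    (hX : deg h X) (hU : neutral deg U) (hY : deg g Y) :
    c.obj ◁ (α_ X U Y).hom ≫ T.pair T' hX (deg_neutral_tensor hU hY) =
      T.pair T' (deg_tensor_neutral hX hU) hY ≫ (α_ X U Y).hom ▷ Q.obj := by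
  unfold pair
  rw [T'.left U Y hU hY, T.right X U hX hU]
  monoidal

theorem pair_left (T : CenterTransport h c P) (T' : CenterTransport g P Q) {X U Y : C}
    (hX : deg h X) (hU : neutral deg U) (hY : deg g Y) :
    T.pair T' (deg_neutral_tensor hU hX) hY =
      𝟙 _ ⊗≫ c.β U hU ▷ (X ⊗ Y) ⊗≫ U ◁ T.pair T' hX hY ⊗≫ 𝟙 _ := by
  unfold pair
  rw [T.left U X hU hX]
  monoidal

theorem pair_right (T : CenterTransport h c P) (T' : CenterTransport g P Q) {X U Y : C}
    (hX : deg h X) (hU : neutral deg U) (hY : deg g Y) :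
    T.pair T' hX (deg_tensor_neutral hY hU) =
      𝟙 _ ⊗≫ T.pair T' hX hY ▷ U ⊗≫ (X ⊗ Y) ◁ Q.β U hU ⊗≫ 𝟙 _ := by
  unfold pair
  rw [T'.right Y U hY hU]
  monoidal

/-- Inserting a pair on the left of an object. -/
def insertPair {V W : C} (s : 𝟙_ C ⟶ W ⊗ V) (X : C) : X ⟶ W ⊗ (V ⊗ X) :=
  (λ_ X).inv ≫ s ▷ X ≫ (α_ W V X).hom

/-- Removing a pair on the left of an object. -/
def removePair {V W : C} (r : W ⊗ V ⟶ 𝟙_ C) (X : C) : W ⊗ (V ⊗ X) ⟶ X :=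
  (α_ W V X).inv ≫ r ▷ X ≫ (λ_ X).hom

omit [Abelian C] in
theorem insertPair_removePair {V W : C} (s : 𝟙_ C ⟶ W ⊗ V) (r : W ⊗ V ⟶ 𝟙_ C)
    (hsr : s ≫ r = 𝟙 _) (X : C) : insertPair s X ≫ removePair r X = 𝟙 X := by
  have : insertPair s X ≫ removePair r X = 𝟙 _ ⊗≫ (s ≫ r) ▷ X ⊗≫ 𝟙 _ := by
    unfold insertPair removePair; monoidal
  rw [this, hsr]
  monoidal

/-- The transport past `X ⊗ Y` is natural for all morphisms `X ⊗ Y ⟶ X' ⊗ Y'`, since these are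
composed of morphisms of the two factors and of reassociations of a neutral object. -/
theorem pair_natural (T : CenterTransport h c P) (T' : CenterTransport g P Q)
    (hs : IsSplitDegree deg h⁻¹) {X X' Y Y' : C}
    (hX : deg h X) (hX' : deg h X') (hY : deg g Y) (hY' : deg g Y') (f : X ⊗ Y ⟶ X' ⊗ Y') :
    c.obj ◁ f ≫ T.pair T' hX' hY' = T.pair T' hX hY ≫ f ▷ Q.obj := by
  obtain ⟨V, W, s, r, hV, hW, hsr⟩ := hs
  rw [inv_inv] at hW
  have hVX : ∀ {X}, deg h X → neutral deg (V ⊗ X) := fun hX => by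
    have := IsGGrading.tensor_mem hV hX
    rwa [inv_mul_cancel] at this
  -- as `V ⊗ X` and `V ⊗ X'` are neutral, `f₁` may be read as a morphism of second factors
  let f₁ : (V ⊗ X) ⊗ Y ⟶ (V ⊗ X') ⊗ Y' := (α_ V X Y).hom ≫ V ◁ f ≫ (α_ V X' Y').inv
  have hf : f = insertPair s X ▷ Y ≫ (α_ W (V ⊗ X) Y).hom ≫ W ◁ f₁ ≫ (α_ W (V ⊗ X') Y').inv ≫
      removePair r X' ▷ Y' := by
    symm
    calc
      _ = 𝟙 _ ⊗≫ s ▷ (X ⊗ Y) ⊗≫ ((W ⊗ V) ◁ f ≫ r ▷ (X' ⊗ Y')) ⊗≫ 𝟙 _ := by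
        simp only [insertPair, removePair, f₁]; monoidal
      _ = 𝟙 _ ⊗≫ (s ≫ r) ▷ (X ⊗ Y) ⊗≫ f := by rw [whisker_exchange]; monoidal
      _ = _ := by rw [hsr]; monoidal
  have h1 := T.pair_natural_left T' hX (deg_tensor_neutral hW (hVX hX)) hY (insertPair s X)
  have h2 := T.pair_balanced T' hW (hVX hX) hY
  have h3 := T.pair_natural_right T' hW (deg_neutral_tensor (hVX hX) hY)
    (deg_neutral_tensor (hVX hX') hY') f₁
  have h4 : c.obj ◁ (α_ W (V ⊗ X') Y').inv ≫ T.pair T' (deg_tensor_neutral hW (hVX hX')) hY' =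
      T.pair T' hW (deg_neutral_tensor (hVX hX') hY') ≫ (α_ W (V ⊗ X') Y').inv ▷ Q.obj := by
    have := T.pair_balanced T' hW (hVX hX') hY'
    rw [← cancel_epi (c.obj ◁ (α_ W (V ⊗ X') Y').hom), ← cancel_mono
      ((α_ W (V ⊗ X') Y').hom ▷ Q.obj)]
    simp only [Category.assoc, ← comp_whiskerRight, Iso.inv_hom_id, id_whiskerRight,
      Category.comp_id]
    rw [this, ← MonoidalCategory.whiskerLeft_comp_assoc, Iso.hom_inv_id]
    simp
  have h5 := T.pair_natural_left T' (deg_tensor_neutral hW (hVX hX')) hX' hY' (removePair r X')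
  rw [hf]
  simp only [MonoidalCategory.whiskerLeft_comp, comp_whiskerRight, Category.assoc]
  rw [h5, reassoc_of% h4, reassoc_of% h3, reassoc_of% h2, reassoc_of% h1]

end CenterTransport

end CenterTransport

section CenterTransport

variable {G : Type*} [Group G] {C : Type u} [Category.{v} C] [Abelian C] [MonoidalCategory C]
  {deg : G → ObjectProperty C} [IsGGrading deg]

namespace CenterTransport

open Transport

variable {h g k : G} {c d e P Q R : GCenter deg}

theorem isIso_pair (T : CenterTransport h c P) (T' : CenterTransport g P Q) {X Y : C}
    (hX : deg h X) (hY : deg g Y) : IsIso (T.pair T' hX hY) := by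
  have := T.isIso X hX
  have := T'.isIso Y hY
  unfold pair
  infer_instance

/-- Transports along `h` and `g` compose to a transport along `h * g`: every `Z` of degree `h * g`
is a retract of some `X ⊗ Y` with `X` and `Y` of degrees `h` and `g`, and the retract of the
transport past `X ⊗ Y` does not depend on the choices. -/
theorem exists_comp (T : CenterTransport h c P) (T' : CenterTransport g P Q)
    (hs : IsSplitDegree deg h⁻¹) :
    ∃ T'' : CenterTransport (h * g) c Q, ∀ {X Y Z : C} (hX : deg h X) (hY : deg g Y)
      (hZ : deg (h * g) Z) (i : Z ⟶ X ⊗ Y) (p : X ⊗ Y ⟶ Z), i ≫ p = 𝟙 Z →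
        T''.σ Z hZ = c.obj ◁ i ≫ T.pair T' hX hY ≫ p ▷ Q.obj := by
  have hnat : ∀ {X X' Y Y' : C} (hX : deg h X) (hX' : deg h X') (hY : deg g Y) (hY' : deg g Y')
      (f : X ⊗ Y ⟶ X' ⊗ Y'), c.obj ◁ f ≫ T.pair T' hX' hY' = T.pair T' hX hY ≫ f ▷ Q.obj :=
    T.pair_natural T' hs
  obtain ⟨V, W, s, r, hV, hW, hsr⟩ := hs
  rw [inv_inv] at hW
  have hVZ : ∀ {Z}, deg (h * g) Z → deg g (V ⊗ Z) := fun hZ => by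
    have := IsGGrading.tensor_mem hV hZ
    rwa [inv_mul_cancel_left] at this
  have hir := insertPair_removePair s r hsr
  let τ : ∀ Z, deg (h * g) Z → (c.obj ⊗ Z ⟶ Z ⊗ Q.obj) := fun Z hZ =>
    c.obj ◁ insertPair s Z ≫ T.pair T' hW (hVZ hZ) ≫ removePair r Z ▷ Q.obj
  have hτ : ∀ {X Y Z : C} (hX : deg h X) (hY : deg g Y)
      (hZ : deg (h * g) Z) (i : Z ⟶ X ⊗ Y) (p : X ⊗ Y ⟶ Z), i ≫ p = 𝟙 Z →
        τ Z hZ = c.obj ◁ i ≫ T.pair T' hX hY ≫ p ▷ Q.obj := by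
    intro X Y Z hX hY hZ i p hip
    have h1 := hnat hX hW hY (hVZ hZ) (p ≫ insertPair s Z)
    calc
      _ = c.obj ◁ i ≫ (c.obj ◁ (p ≫ insertPair s Z) ≫ T.pair T' hW (hVZ hZ)) ≫
            removePair r Z ▷ Q.obj := by
        simp only [τ]
        rw [Category.assoc, ← MonoidalCategory.whiskerLeft_comp_assoc, reassoc_of% hip]
      _ = _ := by
        rw [h1]
        simp only [Category.assoc, ← comp_whiskerRight, hir, Category.comp_id]
  have hiso : ∀ Z hZ, IsIso (τ Z hZ) := by
    intro Z hZ
    have hp := T.isIso_pair T' hW (hVZ hZ)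
    have h1 := hnat hW hW (hVZ hZ) (hVZ hZ) (removePair r Z ≫ insertPair s Z)
    refine ⟨insertPair s Z ▷ Q.obj ≫ inv (T.pair T' hW (hVZ hZ)) ≫ c.obj ◁ removePair r Z, ?_, ?_⟩
    · calc
        _ = c.obj ◁ insertPair s Z ≫ (T.pair T' hW (hVZ hZ) ≫
              (removePair r Z ≫ insertPair s Z) ▷ Q.obj) ≫ inv (T.pair T' hW (hVZ hZ)) ≫
                c.obj ◁ removePair r Z := by simp [τ]
        _ = _ := by
          rw [← h1]
          simp only [Category.assoc, IsIso.hom_inv_id_assoc, ← MonoidalCategory.whiskerLeft_comp,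
            hir, Category.comp_id, MonoidalCategory.whiskerLeft_id]
    · calc
        _ = insertPair s Z ▷ Q.obj ≫ inv (T.pair T' hW (hVZ hZ)) ≫
              (c.obj ◁ (removePair r Z ≫ insertPair s Z) ≫ T.pair T' hW (hVZ hZ)) ≫
                removePair r Z ▷ Q.obj := by simp [τ]
        _ = _ := by
          rw [h1]
          simp only [Category.assoc, IsIso.inv_hom_id_assoc, ← comp_whiskerRight,
            hir, Category.comp_id, id_whiskerRight]
  refine ⟨⟨⟨τ, hiso, fun X Y hX hY f => ?_, fun U X hU hX hUX => ?_⟩,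
    fun X U hX hU hXU => ?_⟩, hτ⟩
  · have h1 := hnat hW hW (hVZ hX) (hVZ hY) (removePair r X ≫ f ≫ insertPair s Y)
    calc
      _ = c.obj ◁ insertPair s X ≫ (c.obj ◁ (removePair r X ≫ f ≫ insertPair s Y) ≫
            T.pair T' hW (hVZ hY)) ≫ removePair r Y ▷ Q.obj := by
        simp only [τ]
        rw [Category.assoc, ← MonoidalCategory.whiskerLeft_comp_assoc,
          ← MonoidalCategory.whiskerLeft_comp_assoc, reassoc_of% (hir X)]
      _ = _ := by
        rw [h1]
        simp only [τ, Category.assoc, ← comp_whiskerRight, hir, Category.comp_id]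
  · rw [hτ (deg_neutral_tensor hU hW) (hVZ hX) hUX (U ◁ insertPair s X ≫ (α_ _ _ _).inv)
      ((α_ _ _ _).hom ≫ U ◁ removePair r X) (by
        simp only [Category.assoc, Iso.inv_hom_id_assoc, ← MonoidalCategory.whiskerLeft_comp, hir,
          MonoidalCategory.whiskerLeft_id]), T.pair_left T' hW hU (hVZ hX)]
    calc
      _ = 𝟙 _ ⊗≫ ((c.obj ⊗ U) ◁ insertPair s X ≫ c.β U hU ▷ (W ⊗ (V ⊗ X))) ⊗≫
          U ◁ T.pair T' hW (hVZ hX) ⊗≫ (U ◁ removePair r X) ▷ Q.obj := by monoidal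
      _ = _ := by
        rw [whisker_exchange]
        simp only [τ]
        monoidal
  · change τ (X ⊗ U) hXU = (α_ c.obj X U).inv ≫ τ X hX ▷ U ≫ (α_ X Q.obj U).hom ≫
      X ◁ Q.β U hU ≫ (α_ X U Q.obj).inv
    rw [hτ hW (deg_tensor_neutral (hVZ hX) hU) hXU (insertPair s X ▷ U ≫ (α_ _ _ _).hom)
      ((α_ _ _ _).inv ≫ removePair r X ▷ U) (by
        simp only [Category.assoc, Iso.hom_inv_id_assoc, ← comp_whiskerRight, hir,
          id_whiskerRight]), T.pair_right T' hW hU (hVZ hX)]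
    calc
      _ = 𝟙 _ ⊗≫ c.obj ◁ insertPair s X ▷ U ⊗≫ T.pair T' hW (hVZ hX) ▷ U ⊗≫
          ((W ⊗ (V ⊗ X)) ◁ Q.β U hU ≫ removePair r X ▷ (U ⊗ Q.obj)) ⊗≫ 𝟙 _ := by monoidal
      _ = _ := by
        rw [whisker_exchange]
        simp only [τ]
        monoidal

/-- The composite of transports along `h` and `g`. -/
def comp (T : CenterTransport h c P) (T' : CenterTransport g P Q)
    (hs : IsSplitDegree deg h⁻¹) : CenterTransport (h * g) c Q :=
  (T.exists_comp T' hs).choose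

theorem comp_σ_tensor (T : CenterTransport h c P) (T' : CenterTransport g P Q)
    (hs : IsSplitDegree deg h⁻¹) {X Y : C} (hX : deg h X) (hY : deg g Y)
    (hXY : deg (h * g) (X ⊗ Y)) :
    (T.comp T' hs).σ (X ⊗ Y) hXY = T.pair T' hX hY := by
  have : (T.comp T' hs).σ (X ⊗ Y) hXY = _ :=
    (T.exists_comp T' hs).choose_spec hX hY hXY (𝟙 _) (𝟙 _) (Category.comp_id _)
  simpa using this

/-! ### Morphisms over transports -/

/-- At the object `X`, the morphism `f'` is induced by `f` on the transports. -/
def IsOverAt (T : CenterTransport h c P) (T' : CenterTransport h d Q) (f : c ⟶ d) (f' : P ⟶ Q)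
    {X : C} (hX : deg h X) : Prop :=
  T.σ X hX ≫ X ◁ f'.hom = f.hom ▷ X ≫ T'.σ X hX

/-- The morphism `f'` is the one which `f` induces on the transports. -/
def IsOver (T : CenterTransport h c P) (T' : CenterTransport h d Q) (f : c ⟶ d)
    (f' : P ⟶ Q) : Prop :=
  ∀ ⦃X : C⦄ (hX : deg h X), T.IsOverAt T' f f' hX

theorem IsOver.unique {T : CenterTransport h c P} {T' : CenterTransport h d Q} {f : c ⟶ d}
    {f₁ f₂ : P ⟶ Q} (h₁ : T.IsOver T' f f₁) (h₂ : T.IsOver T' f f₂)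
    (hs : IsSplitDegree deg h) : f₁ = f₂ :=
  T.hom_ext hs fun _ hX => (h₁ hX).trans (h₂ hX).symm

theorem isOver_map (T : CenterTransport h c P) (T' : CenterTransport h d Q)
    (hs : IsSplitDegree deg h) (f : c ⟶ d) : T.IsOver T' f (T.map T' hs f) :=
  fun X hX => T.map_spec T' hs f X hX

theorem isOver_id (T : CenterTransport h c P) : T.IsOver T (𝟙 c) (𝟙 P) := fun X hX => by
  simp [IsOverAt]

theorem IsOver.trans {T : CenterTransport h c P} {T' : CenterTransport h d Q}
    {T'' : CenterTransport h e R} {f : c ⟶ d} {f' : P ⟶ Q} {k : d ⟶ e} {k' : Q ⟶ R}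
    (h₁ : T.IsOver T' f f') (h₂ : T'.IsOver T'' k k') : T.IsOver T'' (f ≫ k) (f' ≫ k') :=
  fun X hX => by
    have e₁ := h₁ hX
    have e₂ := h₂ hX
    unfold IsOverAt at *
    rw [RelCenter.comp_hom, RelCenter.comp_hom, MonoidalCategory.whiskerLeft_comp,
      reassoc_of% e₁, e₂, comp_whiskerRight, Category.assoc]

theorem IsOverAt.of_retract {T : CenterTransport h c P} {T' : CenterTransport h d Q} {f : c ⟶ d}
    {f' : P ⟶ Q} {X Z : C} {hX : deg h X} (H : T.IsOverAt T' f f' hX) (hZ : deg h Z)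
    (i : Z ⟶ X) (p : X ⟶ Z) (hip : i ≫ p = 𝟙 Z) : T.IsOverAt T' f f' hZ := by
  unfold IsOverAt at *
  have h1 : T.σ Z hZ = c.obj ◁ i ≫ T.σ X hX ≫ p ▷ P.obj := by
    rw [← T.natural X Z hX hZ, ← MonoidalCategory.whiskerLeft_comp_assoc, hip]; simp
  have h2 : T'.σ Z hZ = d.obj ◁ i ≫ T'.σ X hX ≫ p ▷ Q.obj := by
    rw [← T'.natural X Z hX hZ, ← MonoidalCategory.whiskerLeft_comp_assoc, hip]; simp
  rw [h1, h2, Category.assoc, Category.assoc, ← whisker_exchange, reassoc_of% H,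
    whisker_exchange_assoc]

theorem exists_retract_tensor (hs : IsSplitDegree deg h⁻¹) {Z : C} (hZ : deg (h * g) Z) :
    ∃ (X Y : C) (i : Z ⟶ X ⊗ Y) (p : X ⊗ Y ⟶ Z), deg h X ∧ deg g Y ∧ i ≫ p = 𝟙 Z := by
  obtain ⟨V, W, s, r, hV, hW, hsr⟩ := hs
  rw [inv_inv] at hW
  have hVZ : deg g (V ⊗ Z) := by
    have := IsGGrading.tensor_mem hV hZ
    rwa [inv_mul_cancel_left] at this
  exact ⟨W, V ⊗ Z, _, _, hW, hVZ, insertPair_removePair s r hsr Z⟩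

/-- Along the degree `h * g` it suffices to compare transports past `X ⊗ Y`. -/
theorem isOver_of_tensor {T : CenterTransport (h * g) c P} {T' : CenterTransport (h * g) d Q}
    {f : c ⟶ d} {f' : P ⟶ Q} (hs : IsSplitDegree deg h⁻¹)
    (H : ∀ {X Y : C} (hX : deg h X) (hY : deg g Y),
      T.IsOverAt T' f f' (IsGGrading.tensor_mem hX hY)) : T.IsOver T' f f' := by
  intro Z hZ
  obtain ⟨X, Y, i, p, hX, hY, hip⟩ := exists_retract_tensor hs hZ
  exact (H hX hY).of_retract hZ i p hip

theorem IsOver.comp {T : CenterTransport h c P} {T' : CenterTransport h d Q} {f : c ⟶ d}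
    {f' : P ⟶ Q} {P' Q' : GCenter deg} {U : CenterTransport g P P'} {U' : CenterTransport g Q Q'}
    {f'' : P' ⟶ Q'} (h₁ : T.IsOver T' f f') (h₂ : U.IsOver U' f' f'')
    (hs : IsSplitDegree deg h⁻¹) : (T.comp U hs).IsOver (T'.comp U' hs) f f'' := by
  refine isOver_of_tensor hs fun {X Y} hX hY => ?_
  have e₁ := h₁ hX
  have e₂ := h₂ hY
  unfold IsOverAt at *
  rw [comp_σ_tensor _ _ _ hX hY, comp_σ_tensor _ _ _ hX hY]
  unfold pair
  calc
    _ = 𝟙 _ ⊗≫ T.σ X hX ▷ Y ⊗≫ X ◁ (U.σ Y hY ≫ Y ◁ f''.hom) ⊗≫ 𝟙 _ := by monoidal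
    _ = 𝟙 _ ⊗≫ (T.σ X hX ≫ X ◁ f'.hom) ▷ Y ⊗≫ X ◁ U'.σ Y hY ⊗≫ 𝟙 _ := by rw [e₂]; monoidal
    _ = _ := by rw [e₁]; monoidal

theorem IsOver.tensor {T : CenterTransport h c P} {T' : CenterTransport h d Q} {f : c ⟶ d}
    {f' : P ⟶ Q} {c' d' P' Q' : GCenter deg} {U : CenterTransport h c' P'}
    {U' : CenterTransport h d' Q'} {k : c' ⟶ d'} {k' : P' ⟶ Q'} (h₁ : T.IsOver T' f f')
    (h₂ : U.IsOver U' k k') : (T.tensor U).IsOver (T'.tensor U') (f ⊗ₘ k) (f' ⊗ₘ k') := by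
  intro X hX
  have e₁ := h₁ hX
  have e₂ := h₂ hX
  unfold IsOverAt at *
  rw [tensor_σ, tensor_σ]
  change _ ≫ X ◁ (f'.hom ⊗ₘ k'.hom) = (f.hom ⊗ₘ k.hom) ▷ X ≫ _
  calc
    _ = 𝟙 _ ⊗≫ c.obj ◁ U.σ X hX ⊗≫ (T.σ X hX ≫ X ◁ f'.hom) ▷ P'.obj ⊗≫
          X ◁ Q.obj ◁ k'.hom ⊗≫ 𝟙 _ := by
      rw [MonoidalCategory.tensorHom_def]; monoidal
    _ = 𝟙 _ ⊗≫ c.obj ◁ U.σ X hX ⊗≫ (f.hom ▷ (X ⊗ P'.obj) ≫ d.obj ◁ X ◁ k'.hom) ⊗≫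
          (T'.σ X hX ▷ Q'.obj) ⊗≫ 𝟙 _ := by
      rw [e₁, ← whisker_exchange]
      have := whisker_exchange (T'.σ X hX) k'.hom
      calc
        _ = 𝟙 _ ⊗≫ c.obj ◁ U.σ X hX ⊗≫ f.hom ▷ X ▷ P'.obj ⊗≫
              (T'.σ X hX ▷ P'.obj ≫ (X ⊗ Q.obj) ◁ k'.hom) ⊗≫ 𝟙 _ := by monoidal
        _ = 𝟙 _ ⊗≫ c.obj ◁ U.σ X hX ⊗≫ (f.hom ▷ (X ⊗ P'.obj) ≫ d.obj ◁ X ◁ k'.hom) ⊗≫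
              (T'.σ X hX ▷ Q'.obj) ⊗≫ 𝟙 _ := by rw [← this]; monoidal
        _ = _ := by rw [whisker_exchange]
    _ = 𝟙 _ ⊗≫ c.obj ◁ (U.σ X hX ≫ X ◁ k'.hom) ⊗≫ f.hom ▷ (X ⊗ Q'.obj) ⊗≫
          (T'.σ X hX ▷ Q'.obj) ⊗≫ 𝟙 _ := by
      rw [← whisker_exchange]; monoidal
    _ = 𝟙 _ ⊗≫ c.obj ◁ k.hom ▷ X ⊗≫ (c.obj ◁ U'.σ X hX ≫ f.hom ▷ (X ⊗ Q'.obj)) ⊗≫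
          (T'.σ X hX ▷ Q'.obj) ⊗≫ 𝟙 _ := by
      rw [e₂]; monoidal
    _ = 𝟙 _ ⊗≫ (c.obj ◁ k.hom ≫ f.hom ▷ d'.obj) ▷ X ⊗≫ d.obj ◁ U'.σ X hX ⊗≫
          (T'.σ X hX ▷ Q'.obj) ⊗≫ 𝟙 _ := by
      rw [whisker_exchange]; monoidal
    _ = _ := by
      rw [whisker_exchange, MonoidalCategory.tensorHom_def]; monoidal

theorem isOver_associator {c₁ c₂ c₃ P₁ P₂ P₃ : GCenter deg} (T₁ : CenterTransport h c₁ P₁)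
    (T₂ : CenterTransport h c₂ P₂) (T₃ : CenterTransport h c₃ P₃) :
    ((T₁.tensor T₂).tensor T₃).IsOver (T₁.tensor (T₂.tensor T₃)) (α_ c₁ c₂ c₃).hom
      (α_ P₁ P₂ P₃).hom := by
  intro X hX
  unfold IsOverAt
  rw [tensor_σ, tensor_σ, tensor_σ, tensor_σ]
  change ((α_ (c₁.obj ⊗ c₂.obj) c₃.obj X).hom ≫ (c₁.obj ⊗ c₂.obj) ◁ _ ≫
    (α_ (c₁.obj ⊗ c₂.obj) X P₃.obj).inv ≫ _ ▷ P₃.obj ≫ (α_ X (P₁.obj ⊗ P₂.obj) P₃.obj).hom) ≫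
      X ◁ (α_ P₁.obj P₂.obj P₃.obj).hom = (α_ c₁.obj c₂.obj c₃.obj).hom ▷ X ≫
      (α_ c₁.obj (c₂.obj ⊗ c₃.obj) X).hom ≫ c₁.obj ◁ _ ≫ (α_ c₁.obj X (P₂.obj ⊗ P₃.obj)).inv ≫
      _ ▷ (P₂.obj ⊗ P₃.obj) ≫ (α_ X P₁.obj (P₂.obj ⊗ P₃.obj)).hom
  monoidal

theorem isOver_leftUnitor (T : CenterTransport h c P) :
    ((unit deg h).tensor T).IsOver T (λ_ c).hom (λ_ P).hom := by
  intro X hX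
  unfold IsOverAt
  rw [tensor_σ]
  change ((α_ (𝟙_ C) c.obj X).hom ≫ (𝟙_ C) ◁ _ ≫ (α_ (𝟙_ C) X P.obj).inv ≫
    ((λ_ X).hom ≫ (ρ_ X).inv) ▷ P.obj ≫ (α_ X (𝟙_ C) P.obj).hom) ≫ X ◁ (λ_ P.obj).hom =
      (λ_ c.obj).hom ▷ X ≫ _
  monoidal

theorem isOver_rightUnitor (T : CenterTransport h c P) :
    (T.tensor (unit deg h)).IsOver T (ρ_ c).hom (ρ_ P).hom := by
  intro X hX
  unfold IsOverAt
  rw [tensor_σ]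
  change ((α_ c.obj (𝟙_ C) X).hom ≫ c.obj ◁ ((λ_ X).hom ≫ (ρ_ X).inv) ≫
    (α_ c.obj X (𝟙_ C)).inv ≫ _ ▷ (𝟙_ C) ≫ (α_ X P.obj (𝟙_ C)).hom) ≫ X ◁ (ρ_ P.obj).hom =
      (ρ_ c.obj).hom ▷ X ≫ _
  monoidal

theorem isOver_tensor_comp {c₁ c₂ P₁ P₂ Q₁ Q₂ : GCenter deg} (T₁ : CenterTransport h c₁ P₁)
    (T₂ : CenterTransport h c₂ P₂) (U₁ : CenterTransport g P₁ Q₁) (U₂ : CenterTransport g P₂ Q₂)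
    (hs : IsSplitDegree deg h⁻¹) :
    ((T₁.comp U₁ hs).tensor (T₂.comp U₂ hs)).IsOver ((T₁.tensor T₂).comp (U₁.tensor U₂) hs)
      (𝟙 _) (𝟙 _) := by
  refine isOver_of_tensor hs fun {X Y} hX hY => ?_
  unfold IsOverAt
  rw [tensor_σ, comp_σ_tensor _ _ _ hX hY, comp_σ_tensor _ _ _ hX hY, comp_σ_tensor _ _ _ hX hY]
  unfold pair
  rw [tensor_σ, tensor_σ]
  simp only [RelCenter.id_hom, MonoidalCategory.whiskerLeft_id, id_whiskerRight,
    Category.id_comp]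
  change ((α_ c₁.obj c₂.obj (X ⊗ Y)).hom ≫ c₁.obj ◁ _ ≫ (α_ c₁.obj (X ⊗ Y) Q₂.obj).inv ≫
    _ ▷ Q₂.obj ≫ (α_ (X ⊗ Y) Q₁.obj Q₂.obj).hom) ≫ 𝟙 ((X ⊗ Y) ⊗ Q₁.obj ⊗ Q₂.obj) =
      (α_ (c₁.obj ⊗ c₂.obj) X Y).inv ≫ _ ▷ Y ≫ (α_ X (P₁.obj ⊗ P₂.obj) Y).hom ≫
    X ◁ _ ≫ (α_ X Y (Q₁.obj ⊗ Q₂.obj)).inv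
  calc
    _ = 𝟙 _ ⊗≫ c₁.obj ◁ T₂.σ X hX ▷ Y ⊗≫ ((c₁.obj ⊗ X) ◁ U₂.σ Y hY ≫
          T₁.σ X hX ▷ (Y ⊗ Q₂.obj)) ⊗≫ X ◁ U₁.σ Y hY ▷ Q₂.obj ⊗≫ 𝟙 _ := by monoidal
    _ = _ := by rw [whisker_exchange]; monoidal

theorem isOver_unit_comp (hs : IsSplitDegree deg h⁻¹) :
    (unit deg (h * g)).IsOver ((unit deg h).comp (unit deg g) hs) (𝟙 _) (𝟙 _) := by
  refine isOver_of_tensor hs fun {X Y} hX hY => ?_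
  unfold IsOverAt
  rw [comp_σ_tensor _ _ _ hX hY]
  change ((λ_ _).hom ≫ (ρ_ _).inv) ≫ (X ⊗ Y) ◁ 𝟙 (𝟙_ C) = 𝟙 (𝟙_ C) ▷ (X ⊗ Y) ≫
    (α_ (𝟙_ C) X Y).inv ≫ ((λ_ X).hom ≫ (ρ_ X).inv) ▷ Y ≫ (α_ X (𝟙_ C) Y).hom ≫
      X ◁ ((λ_ Y).hom ≫ (ρ_ Y).inv) ≫ (α_ X Y (𝟙_ C)).inv
  monoidal

variable (c d) in
theorem isOver_refl_tensor :
    ((refl c).tensor (refl d)).IsOver (refl (c ⊗ d)) (𝟙 _) (𝟙 _) := by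
  intro X hX
  unfold IsOverAt
  simp only [RelCenter.id_hom, MonoidalCategory.whiskerLeft_id, id_whiskerRight, Category.comp_id,
    Category.id_comp]
  rfl

variable (deg) in
theorem isOver_unit_refl : (unit deg 1).IsOver (refl (𝟙_ (GCenter deg))) (𝟙 _) (𝟙 _) := by
  intro X hX
  unfold IsOverAt
  simp only [RelCenter.id_hom, MonoidalCategory.whiskerLeft_id, id_whiskerRight, Category.comp_id,
    Category.id_comp]
  rfl

/-- Rewriting the degree of a transport. -/
def cast (e : h = g) (T : CenterTransport h c P) : CenterTransport g c P := e ▸ T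

theorem cast_σ (e : h = g) (T : CenterTransport h c P) (X : C) (hX : deg g X) :
    (T.cast e).σ X hX = T.σ X (e ▸ hX) := by
  subst e; rfl

theorem IsOver.cast {T : CenterTransport h c P} {T' : CenterTransport h d Q} {f : c ⟶ d}
    {f' : P ⟶ Q} (H : T.IsOver T' f f') (e : h = g) : (T.cast e).IsOver (T'.cast e) f f' := by
  subst e; exact H

theorem isOver_comp_assoc {c₁ c₂ c₃ c₄ : GCenter deg} (T₁ : CenterTransport h c₁ c₂)
    (T₂ : CenterTransport g c₂ c₃) (T₃ : CenterTransport k c₃ c₄) (hs₁ : IsSplitDegree deg h⁻¹)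
    (hs₂ : IsSplitDegree deg g⁻¹) (hs₃ : IsSplitDegree deg (h * g)⁻¹) :
    (((T₁.comp T₂ hs₁).comp T₃ hs₃).cast (mul_assoc h g k)).IsOver
      (T₁.comp (T₂.comp T₃ hs₂) hs₁) (𝟙 _) (𝟙 _) := by
  refine isOver_of_tensor hs₁ fun {X Z} hX hZ => ?_
  obtain ⟨W, Y, i, p, hW, hVZ, hip⟩ := exists_retract_tensor hs₂ hZ
  have hWY : deg (g * k) (W ⊗ Y) := IsGGrading.tensor_mem hW hVZ
  refine IsOverAt.of_retract (X := X ⊗ (W ⊗ Y)) (hX := IsGGrading.tensor_mem hX hWY) ?_ _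
    (X ◁ i) (X ◁ p) ?_
  · have hXW : deg (h * g) (X ⊗ W) := IsGGrading.tensor_mem hX hW
    have h1 : deg (h * g * k) ((X ⊗ W) ⊗ Y) := IsGGrading.tensor_mem hXW hVZ
    have h2 : deg (h * g * k) (X ⊗ (W ⊗ Y)) := deg_of_iso (α_ X W Y) h1
    unfold IsOverAt
    rw [cast_σ, comp_σ_tensor _ _ _ hX hWY]
    have h3 := ((T₁.comp T₂ hs₁).comp T₃ hs₃).natural _ _ h1 h2 (α_ X W Y).hom
    rw [comp_σ_tensor _ _ _ hXW hVZ] at h3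
    rw [← cancel_epi (c₁.obj ◁ (α_ X W Y).hom), reassoc_of% h3]
    unfold pair
    rw [comp_σ_tensor _ _ _ hX hW, comp_σ_tensor _ _ _ hW hVZ]
    unfold pair
    simp only [RelCenter.id_hom]
    monoidal
  · rw [← MonoidalCategory.whiskerLeft_comp, hip, MonoidalCategory.whiskerLeft_id]

theorem isOver_refl_comp (T : CenterTransport h c P) (hs : IsSplitDegree deg (1 : G)⁻¹) :
    (((refl c).comp T hs).cast (one_mul h)).IsOver T (𝟙 _) (𝟙 _) := by
  intro X hX
  have h1 : deg (1 * h) (𝟙_ C ⊗ X) := IsGGrading.tensor_mem IsGGrading.unit_mem hX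
  have h2 : deg (1 * h) X := by rwa [one_mul]
  have h3 : deg h (𝟙_ C ⊗ X) := by rwa [one_mul] at h1
  unfold IsOverAt
  rw [cast_σ]
  have h4 := ((refl c).comp T hs).natural _ _ h1 h2 (λ_ X).hom
  rw [comp_σ_tensor _ _ _ IsGGrading.unit_mem hX] at h4
  rw [← cancel_epi (c.obj ◁ (λ_ X).hom), reassoc_of% h4]
  have h5 := T.natural _ _ h3 hX (λ_ X).hom
  rw [T.left (𝟙_ C) X IsGGrading.unit_mem hX] at h5
  simp only [RelCenter.id_hom, MonoidalCategory.whiskerLeft_id, id_whiskerRight, Category.comp_id,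
    Category.id_comp]
  rw [h5]
  rfl

theorem isOver_comp_refl (T : CenterTransport h c P) (hs : IsSplitDegree deg h⁻¹) :
    ((T.comp (refl P) hs).cast (mul_one h)).IsOver T (𝟙 _) (𝟙 _) := by
  intro X hX
  have h1 : deg (h * 1) (X ⊗ 𝟙_ C) := IsGGrading.tensor_mem hX IsGGrading.unit_mem
  have h2 : deg (h * 1) X := by rwa [mul_one]
  have h3 : deg h (X ⊗ 𝟙_ C) := by rwa [mul_one] at h1
  unfold IsOverAt
  rw [cast_σ]
  have h4 := (T.comp (refl P) hs).natural _ _ h1 h2 (ρ_ X).hom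
  rw [comp_σ_tensor _ _ _ hX IsGGrading.unit_mem] at h4
  rw [← cancel_epi (c.obj ◁ (ρ_ X).hom), reassoc_of% h4]
  have h5 := T.natural _ _ h3 hX (ρ_ X).hom
  rw [T.right X (𝟙_ C) hX IsGGrading.unit_mem] at h5
  simp only [RelCenter.id_hom, MonoidalCategory.whiskerLeft_id, id_whiskerRight, Category.comp_id,
    Category.id_comp]
  rw [h5]
  rfl

end CenterTransport

end CenterTransport

/-! ### Families of transports form a crossing -/

section TransportFunctor

variable {G : Type*} [Group G] {C : Type u} [Category.{v} C] [Abelian C] [MonoidalCategory C]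
  {deg : G → ObjectProperty C} [IsGGrading deg]

open CenterTransport

/-- A functor which sends every object of the center to a transport of it, and every morphism to
the morphism which it induces on the transports. -/
structure TransportFunctor (h : G) (F : GCenter deg ⥤ GCenter deg) where
  T : ∀ c : GCenter deg, CenterTransport h c (F.obj c)
  isOver_map : ∀ {c d : GCenter deg} (f : c ⟶ d), (T c).IsOver (T d) f (F.map f)

namespace CenterTransport

variable {h g : G} {c d P Q : GCenter deg}

theorem IsOver.eq_of_eq {T : CenterTransport h c P} {T' : CenterTransport h d Q} {f g : c ⟶ d}
    {f' g' : P ⟶ Q} (h₁ : T.IsOver T' f f') (h₂ : T.IsOver T' g g')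
    (hs : IsSplitDegree deg h) (hfg : f = g) : f' = g' := by
  subst hfg; exact h₁.unique h₂ hs

theorem isOver_iso (T : CenterTransport h c P) (T' : CenterTransport h c Q)
    (hs : IsSplitDegree deg h) : T.IsOver T' (𝟙 c) (T.iso T' hs).hom :=
  T.isOver_map T' hs (𝟙 c)

/-- The target of a transport along `h` has the conjugate degree: it is a retract of
`X' ⊗ (X ⊗ P) ≅ X' ⊗ (c ⊗ X)`. -/
theorem deg_target (T : CenterTransport h c P) (hs : IsSplitDegree deg h) (hc : deg g c.obj) :
    deg (h⁻¹ * g * h) P.obj := by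
  obtain ⟨X, X', s, r, hX, hX', hsr⟩ := hs
  have := T.isIso X hX
  have h1 : deg (g * h) (X ⊗ P.obj) :=
    deg_of_iso (asIso (T.σ X hX)) (IsGGrading.tensor_mem hc hX)
  rw [mul_assoc]
  exact deg_of_retract _ _ (insertPair_removePair s r hsr P.obj) (IsGGrading.tensor_mem hX' h1)

section Linear

variable [MonoidalPreadditive C]

theorem IsOver.add {T : CenterTransport h c P} {T' : CenterTransport h d Q} {f g : c ⟶ d}
    {f' g' : P ⟶ Q} (h₁ : T.IsOver T' f f') (h₂ : T.IsOver T' g g') :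
    T.IsOver T' (f + g) (f' + g') := fun X hX => by
  have e₁ := h₁ hX
  have e₂ := h₂ hX
  unfold IsOverAt at *
  simp only [RelCenter.add_hom, MonoidalPreadditive.whiskerLeft_add, Preadditive.comp_add,
    MonoidalPreadditive.add_whiskerRight, Preadditive.add_comp, e₁, e₂]

theorem IsOver.smul {𝕂 : Type w} [Field 𝕂] [Linear 𝕂 C] [MonoidalLinear 𝕂 C]
    {T : CenterTransport h c P} {T' : CenterTransport h d Q} {f : c ⟶ d}
    {f' : P ⟶ Q} (h₁ : T.IsOver T' f f') (a : 𝕂) : T.IsOver T' (a • f) (a • f') := fun X hX => by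
  have e₁ := h₁ hX
  unfold IsOverAt at *
  simp only [RelCenter.smul_hom, MonoidalLinear.whiskerLeft_smul, Linear.comp_smul,
    MonoidalLinear.smul_whiskerRight, Linear.smul_comp, e₁]

end Linear

end CenterTransport

namespace TransportFunctor

variable {h g : G} {F F' F'' : GCenter deg ⥤ GCenter deg}

/-- The strong monoidal structure of a transport functor. -/
@[reducible]
def monoidal (A : TransportFunctor h F) (hs : IsSplitDegree deg h) : F.Monoidal :=
  Functor.CoreMonoidal.toMonoidal
    { εIso := (unit deg h).iso (A.T (𝟙_ _)) hs
      μIso := fun c d => ((A.T c).tensor (A.T d)).iso (A.T (c ⊗ d)) hs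
      μIso_hom_natural_left := fun {c d} f e => by
        have h1 := (A.isOver_map f).tensor (A.T e).isOver_id
        rw [tensorHom_id, tensorHom_id] at h1
        exact (h1.trans (isOver_iso _ _ hs)).eq_of_eq
          ((isOver_iso _ _ hs).trans (A.isOver_map (f ▷ e))) hs (by simp)
      μIso_hom_natural_right := fun {c d} e f => by
        have h1 := (A.T e).isOver_id.tensor (A.isOver_map f)
        rw [id_tensorHom, id_tensorHom] at h1
        exact (h1.trans (isOver_iso _ _ hs)).eq_of_eq
          ((isOver_iso _ _ hs).trans (A.isOver_map (e ◁ f))) hs (by simp)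
      associativity := fun c d e => by
        have h1 := (isOver_iso ((A.T c).tensor (A.T d)) (A.T (c ⊗ d)) hs).tensor (A.T e).isOver_id
        have h2 := (A.T c).isOver_id.tensor (isOver_iso ((A.T d).tensor (A.T e)) (A.T (d ⊗ e)) hs)
        rw [tensorHom_id, tensorHom_id] at h1
        rw [id_tensorHom, id_tensorHom] at h2
        exact (h1.trans ((isOver_iso _ _ hs).trans (A.isOver_map (α_ c d e).hom))).eq_of_eq
          ((isOver_associator _ _ _).trans (h2.trans (isOver_iso _ _ hs))) hs (by simp)
      left_unitality := fun c => by
        have h1 := (isOver_iso (unit deg h) (A.T (𝟙_ _)) hs).tensor (A.T c).isOver_id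
        rw [tensorHom_id, tensorHom_id] at h1
        exact (isOver_leftUnitor (A.T c)).eq_of_eq
          (h1.trans ((isOver_iso _ _ hs).trans (A.isOver_map (λ_ c).hom))) hs (by simp)
      right_unitality := fun c => by
        have h1 := (A.T c).isOver_id.tensor (isOver_iso (unit deg h) (A.T (𝟙_ _)) hs)
        rw [id_tensorHom, id_tensorHom] at h1
        exact (isOver_rightUnitor (A.T c)).eq_of_eq
          (h1.trans ((isOver_iso _ _ hs).trans (A.isOver_map (ρ_ c).hom))) hs (by simp) }

theorem isOver_ε (A : TransportFunctor h F) (hs : IsSplitDegree deg h) :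
    (unit deg h).IsOver (A.T (𝟙_ _)) (𝟙 _)
      (@Functor.LaxMonoidal.ε _ _ _ _ _ _ F (A.monoidal hs).toLaxMonoidal) :=
  isOver_iso _ _ hs

theorem isOver_μ (A : TransportFunctor h F) (hs : IsSplitDegree deg h) (c d : GCenter deg) :
    ((A.T c).tensor (A.T d)).IsOver (A.T (c ⊗ d)) (𝟙 _)
      (@Functor.LaxMonoidal.μ _ _ _ _ _ _ F (A.monoidal hs).toLaxMonoidal c d) :=
  isOver_iso _ _ hs

/-- Transport functors compose, up to isomorphism. -/
def mulIso (A : TransportFunctor h F) (B : TransportFunctor g F') (E : TransportFunctor (h * g) F'')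
    (hs : ∀ h : G, IsSplitDegree deg h) : F ⋙ F' ≅ F'' :=
  NatIso.ofComponents
    (fun c => ((A.T c).comp (B.T (F.obj c)) (hs _)).iso (E.T c) (hs _)) fun {c d} f =>
      (((A.isOver_map f).comp (B.isOver_map (F.map f)) (hs _)).trans
        (isOver_iso _ _ (hs _))).eq_of_eq
        ((isOver_iso _ _ (hs _)).trans (E.isOver_map f)) (hs _) (by simp)

theorem isOver_mulIso (A : TransportFunctor h F) (B : TransportFunctor g F')
    (E : TransportFunctor (h * g) F'') (hs : ∀ h : G, IsSplitDegree deg h) (c : GCenter deg) :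
    ((A.T c).comp (B.T (F.obj c)) (hs _)).IsOver (E.T c) (𝟙 c) ((A.mulIso B E hs).hom.app c) :=
  isOver_iso _ _ (hs _)

/-- The identity functor is, up to isomorphism, the transport functor of the neutral degree. -/
def oneIso (A : TransportFunctor 1 F) (hs : IsSplitDegree deg (1 : G)) : 𝟭 (GCenter deg) ≅ F :=
  NatIso.ofComponents (fun c => (refl c).iso (A.T c) hs) fun {c d} f => by
    have h1 : (refl c).IsOver (refl d) f f := fun U hU => (f.comm U hU).symm
    exact (h1.trans (isOver_iso _ _ hs)).eq_of_eq
      ((isOver_iso _ _ hs).trans (A.isOver_map f)) hs (by simp)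

theorem isOver_oneIso (A : TransportFunctor 1 F) (hs : IsSplitDegree deg (1 : G))
    (c : GCenter deg) : (refl c).IsOver (A.T c) (𝟙 c) ((A.oneIso hs).hom.app c) :=
  isOver_iso _ _ hs

variable {F : G → GCenter deg ⥤ GCenter deg} (A : ∀ h, TransportFunctor h (F h))

theorem isOver_eqToHom {h h' : G} (e : h = h') (c : GCenter deg)
    (p : (F h).obj c = (F h').obj c) :
    (((A h).T c).cast e).IsOver ((A h').T c) (𝟙 c) (eqToHom p) := by
  subst e
  exact isOver_id _

theorem isOver_eqToHom' {h h' : G} (e : h' = h) (c : GCenter deg)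
    (p : (F h).obj c = (F h').obj c) :
    ((A h).T c).IsOver (((A h').T c).cast e) (𝟙 c) (eqToHom p) := by
  subst e
  exact isOver_id _

/-- Transport functors for all degrees form a crossing: all structure maps are the canonical
isomorphisms between transports of the same object, so that all diagrams commute. -/
def gCrossing (hs : ∀ h : G, IsSplitDegree deg h) {𝕂 : Type w} [Field 𝕂] [Linear 𝕂 C]
    [MonoidalPreadditive C] [MonoidalLinear 𝕂 C] : GCrossing 𝕂 (centerDeg deg) F where
  additive h := ⟨fun {c d f g} => ((A h).isOver_map (f + g)).unique
    (((A h).isOver_map f).add ((A h).isOver_map g)) (hs h)⟩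
  linear h := ⟨fun {c d} f a => ((A h).isOver_map (a • f)).unique
    (((A h).isOver_map f).smul a) (hs h)⟩
  isEquivalence h := by
    let e : ∀ a b : G, a * b = 1 → (F a ⋙ F b ≅ 𝟭 _) := fun a b hab =>
      (A a).mulIso (A b) (A (a * b)) hs ≪≫ eqToIso (by rw [hab]) ≪≫ ((A 1).oneIso (hs 1)).symm
    exact (CategoryTheory.Equivalence.mk (F h) (F h⁻¹) (e h h⁻¹ (mul_inv_cancel h)).symm
      (e h⁻¹ h (inv_mul_cancel h))).isEquivalence_functor
  monoidal h := (A h).monoidal (hs h)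
  map_deg h g c hc := ((A h).T c).deg_target (hs h) hc
  mul h g := (A h).mulIso (A g) (A (h * g)) hs
  one := (A 1).oneIso (hs 1)
  mul_monoidal h g := by
    let := fun h => (A h).monoidal (hs h)
    constructor
    · have h1 := ((isOver_unit_comp (deg := deg) (h := h) (g := g) (hs _)).trans
        (((unit deg h).isOver_id.comp ((A g).isOver_ε (hs g)) (hs _)).trans
        ((((A h).isOver_ε (hs h)).comp ((A g).isOver_map _) (hs _)).trans
          ((A h).isOver_mulIso (A g) (A (h * g)) hs _))))
      have h2 := (A (h * g)).isOver_ε (hs (h * g))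
      have := h1.eq_of_eq h2 (hs _) (by simp)
      rw [Category.id_comp] at this
      rw [Functor.LaxMonoidal.comp_ε, Category.assoc]
      exact this
    · intro c d
      have h1 := ((isOver_tensor_comp ((A h).T c) ((A h).T d) ((A g).T _) ((A g).T _) (hs _)).trans
        (((isOver_id _).comp ((A g).isOver_μ (hs g) _ _) (hs _)).trans
        ((((A h).isOver_μ (hs h) c d).comp ((A g).isOver_map _) (hs _)).trans
          ((A h).isOver_mulIso (A g) (A (h * g)) hs _))))
      have h2 := (((A h).isOver_mulIso (A g) (A (h * g)) hs c).tensor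
        ((A h).isOver_mulIso (A g) (A (h * g)) hs d)).trans
          ((A (h * g)).isOver_μ (hs (h * g)) c d)
      have := h1.eq_of_eq h2 (hs _) (by simp)
      rw [Category.id_comp] at this
      rw [Functor.LaxMonoidal.comp_μ, Category.assoc]
      exact this
  one_monoidal := by
    let := fun h => (A h).monoidal (hs h)
    constructor
    · have h1 := (isOver_unit_refl deg).trans ((A 1).isOver_oneIso (hs 1) (𝟙_ _))
      have := h1.eq_of_eq ((A 1).isOver_ε (hs 1)) (hs _) (by simp)
      exact this
    · intro c d
      have h1 := (isOver_refl_tensor c d).trans ((A 1).isOver_oneIso (hs 1) (c ⊗ d))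
      have h2 := (((A 1).isOver_oneIso (hs 1) c).tensor ((A 1).isOver_oneIso (hs 1) d)).trans
        ((A 1).isOver_μ (hs 1) c d)
      have := h1.eq_of_eq h2 (hs _) (by simp)
      exact this
  assoc h g k c := by
    have h1 := ((((A h).isOver_mulIso (A g) (A (h * g)) hs c).comp ((A k).isOver_map _)
      (hs _)).trans ((A (h * g)).isOver_mulIso (A k) (A (h * g * k)) hs c)).cast (mul_assoc h g k)
    have h2 := (isOver_comp_assoc ((A h).T c) ((A g).T _) ((A k).T _) (hs _) (hs _) (hs _)).trans
      (((isOver_id _).comp ((A g).isOver_mulIso (A k) (A (g * k)) hs _) (hs _)).trans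
        ((A h).isOver_mulIso (A (g * k)) (A (h * (g * k))) hs c))
    have := (h1.trans (isOver_eqToHom A (mul_assoc h g k) c (by rw [mul_assoc]))).eq_of_eq h2
      (hs _) (by simp)
    rw [Category.id_comp, Category.assoc] at this
    exact this
  one_left h c := by
    have h1 := ((((A 1).isOver_oneIso (hs 1) c).comp ((A h).isOver_map _) (hs _)).trans
      ((A 1).isOver_mulIso (A h) (A (1 * h)) hs c)).cast (one_mul h)
    have h2 := (isOver_refl_comp ((A h).T c) (hs _)).trans
      (isOver_eqToHom' A (one_mul h) c (by rw [one_mul]))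
    have := h1.eq_of_eq h2 (hs _) (by simp)
    rw [Category.id_comp] at this
    exact this
  one_right h c := by
    have h1 := (((isOver_id ((A h).T c)).comp ((A 1).isOver_oneIso (hs 1) _) (hs _)).trans
      ((A h).isOver_mulIso (A 1) (A (h * 1)) hs c)).cast (mul_one h)
    have h2 := (isOver_comp_refl ((A h).T c) (hs _)).trans
      (isOver_eqToHom' A (mul_one h) c (by rw [mul_one]))
    have := h1.eq_of_eq h2 (hs _) (by simp)
    rw [Category.id_comp] at this
    exact this

end TransportFunctor

end TransportFunctor

/-! ### Matrices of morphisms -/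

section Biproduct

variable {C : Type u} [Category.{v} C] [Preadditive C] [HasFiniteBiproducts C] {𝕂 : Type w}
  [Field 𝕂] [Linear 𝕂 C] {J : Type*} [Fintype J] {f : J → C} {t : ∀ i j, f i ⟶ f j} {a : J → 𝕂}

omit [Field 𝕂] [Linear 𝕂 C] in
theorem biproduct_ι_sum_π (t : ∀ i j, f i ⟶ f j) (i j : J) :
    biproduct.ι f i ≫ (∑ i, ∑ j, biproduct.π f i ≫ t i j ≫ biproduct.ι f j) ≫ biproduct.π f j =
      t i j := by
  classical
  simp only [Preadditive.sum_comp, Preadditive.comp_sum, Category.assoc]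
  rw [Finset.sum_eq_single i (fun k _ hk => Finset.sum_eq_zero fun l _ => by
      rw [biproduct.ι_π_ne_assoc _ hk.symm, zero_comp]) (by simp),
    Finset.sum_eq_single j (fun k _ hk => by
      rw [biproduct.ι_π_ne _ hk]; simp) (by simp)]
  simp

omit [Field 𝕂] [Linear 𝕂 C] in
variable (f) in
theorem biproduct_total : ∑ j, biproduct.π f j ≫ biproduct.ι f j = 𝟙 (⨁ f) := by
  classical
  refine biproduct.hom_ext' _ _ fun i => ?_
  rw [Preadditive.comp_sum, Finset.sum_eq_single i (fun k _ hk => by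
    rw [biproduct.ι_π_ne_assoc _ hk.symm, zero_comp]) (by simp)]
  simp

theorem sum_smul_eq (t : ∀ i j, f i ⟶ f j) (a : J → 𝕂) :
    ∑ i, ∑ j, a i • (biproduct.π f i ≫ t i j ≫ biproduct.ι f j) =
      ∑ i, ∑ j, biproduct.π f i ≫ (a i • t i j) ≫ biproduct.ι f j := by
  simp

theorem biproduct_matrix_idempotent {d : J → 𝕂} (ht : ∀ i j k, t i j ≫ t j k = d j • t i k)
    (had : ∑ j, a j * d j = 1) :
    (∑ i, ∑ j, a i • (biproduct.π f i ≫ t i j ≫ biproduct.ι f j)) ≫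
      (∑ i, ∑ j, a i • (biproduct.π f i ≫ t i j ≫ biproduct.ι f j)) =
        ∑ i, ∑ j, a i • (biproduct.π f i ≫ t i j ≫ biproduct.ι f j) := by
  rw [sum_smul_eq]
  set p := ∑ i, ∑ j, biproduct.π f i ≫ (a i • t i j) ≫ biproduct.ι f j with hp
  have hpij : ∀ i j, biproduct.ι f i ≫ p ≫ biproduct.π f j = a i • t i j :=
    fun i j => biproduct_ι_sum_π (fun i j => a i • t i j) i j
  refine biproduct.hom_ext' _ _ fun i => biproduct.hom_ext _ _ fun k => ?_
  calc
    _ = biproduct.ι f i ≫ p ≫ (∑ j, biproduct.π f j ≫ biproduct.ι f j) ≫ p ≫ biproduct.π f k := by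
      rw [biproduct_total]; simp
    _ = ∑ j, (biproduct.ι f i ≫ p ≫ biproduct.π f j) ≫
          (biproduct.ι f j ≫ p ≫ biproduct.π f k) := by
      simp only [Preadditive.sum_comp, Preadditive.comp_sum, Category.assoc]
    _ = ∑ j, (a j * d j) • (a i • t i k) := by
      refine Finset.sum_congr rfl fun j _ => ?_
      rw [hpij, hpij, Linear.smul_comp, Linear.comp_smul, ht]
      simp only [smul_smul]
      ring_nf
    _ = _ := by
      rw [← Finset.sum_smul, had, one_smul, Category.assoc, hpij]

theorem sum_restrict {P Q : C} (r : ⨁ f ⟶ Q) (e : P ⟶ ⨁ f) :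
    ∑ i, (e ≫ biproduct.π f i) ≫ (biproduct.ι f i ≫ r) = e ≫ r := by
  calc
    _ = e ≫ (∑ i, biproduct.π f i ≫ biproduct.ι f i) ≫ r := by
      simp only [Preadditive.sum_comp, Preadditive.comp_sum, Category.assoc]
    _ = _ := by rw [biproduct_total, Category.id_comp]

theorem biproduct_ι_restrict_π {P : C} (r : ⨁ f ⟶ P) (e : P ⟶ ⨁ f)
    (hre : r ≫ e = ∑ i, ∑ j, a i • (biproduct.π f i ≫ t i j ≫ biproduct.ι f j)) (i j : J) :
    (biproduct.ι f i ≫ r) ≫ (e ≫ biproduct.π f j) = a i • t i j := by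
  rw [Category.assoc, ← Category.assoc r, hre, sum_smul_eq]
  exact biproduct_ι_sum_π (fun i j => a i • t i j) i j

theorem restrict_map {f' : J → C} (g : ∀ i, f i ⟶ f' i) {P Q : C} (r : ⨁ f' ⟶ Q) (e : P ⟶ ⨁ f) :
    e ≫ biproduct.map g ≫ r = ∑ i, (e ≫ biproduct.π f i) ≫ g i ≫ biproduct.ι f' i ≫ r := by
  rw [← Category.assoc, ← sum_restrict]
  refine Finset.sum_congr rfl fun i _ => ?_
  simp

theorem comp_sum_smul_comp {A B D E : C} {Y Z : J → C} (e : A ⟶ B) (r : D ⟶ E) (u : ∀ i, B ⟶ Y i)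
    (b : ∀ i j, Y i ⟶ Z j) (w : ∀ j, Z j ⟶ D) (a : J → 𝕂) :
    e ≫ (∑ i, ∑ j, a i • (u i ≫ b i j ≫ w j)) ≫ r =
      ∑ i, ∑ j, a i • ((e ≫ u i) ≫ b i j ≫ w j ≫ r) := by
  simp only [Preadditive.sum_comp, Preadditive.comp_sum, Linear.comp_smul, Linear.smul_comp,
    Category.assoc]

end Biproduct

/-! ### Crossings and arcs -/

section Crossing

variable {G : Type*} [Group G] {C : Type u} [Category.{v} C] [Abelian C] [MonoidalCategory C]
  [RightRigidCategory C] [PivotalCategory C]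
  {deg : G → ObjectProperty C} [IsGGrading deg]

open Transport

/-- For `X, Y` of the same degree, the morphism which creates a pair `Y* ⊗ Y` and moves `X ⊗ Y*` to
the left across `c`. -/
def crossing {h : G} (c : GCenter deg) {X Y : C} (hX : deg h X) (hY : deg h Y) :
    c.obj ⊗ X ⟶ X ⊗ (rdual Y ⊗ c.obj ⊗ Y) :=
  𝟙 _ ⊗≫ (c.obj ⊗ X) ◁ pivCoev Y ⊗≫ c.β (X ⊗ rdual Y) (neutral_tensor_dual hX hY) ▷ Y ⊗≫ 𝟙 _

/-- The morphism which moves `X ⊗ Y*` to the right across `c` and evaluates `Y* ⊗ Y`. -/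
def uncrossing {h : G} (c : GCenter deg) {X Y : C} (hX : deg h X) (hY : deg h Y) :
    X ⊗ (rdual Y ⊗ c.obj ⊗ Y) ⟶ c.obj ⊗ X :=
  letI := c.isHalfBraiding.isIso (X ⊗ rdual Y) (neutral_tensor_dual hX hY)
  𝟙 _ ⊗≫ inv (c.β (X ⊗ rdual Y) (neutral_tensor_dual hX hY)) ▷ Y ⊗≫
    (c.obj ⊗ X) ◁ ε_ Y (rdual Y) ⊗≫ 𝟙 _

variable {h : G} {c d : GCenter deg} {X X' Y Z U : C}

omit [RightRigidCategory C] [PivotalCategory C] in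
theorem β_tensor_assoc (c : GCenter deg) {U V W : C} (h₁ : neutral deg ((U ⊗ V) ⊗ W))
    (h₂ : neutral deg (U ⊗ (V ⊗ W))) :
    c.β ((U ⊗ V) ⊗ W) h₁ = c.obj ◁ (α_ U V W).hom ≫ c.β (U ⊗ (V ⊗ W)) h₂ ≫
      (α_ U V W).inv ▷ c.obj := by
  rw [← Category.assoc, c.isHalfBraiding.naturality _ _ h₁ h₂, Category.assoc,
    ← comp_whiskerRight, Iso.hom_inv_id, id_whiskerRight, Category.comp_id]

theorem crossing_natural (hX : deg h X) (hX' : deg h X') (hY : deg h Y) (f : X ⟶ X') :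
    c.obj ◁ f ≫ crossing c hX' hY = crossing c hX hY ≫ f ▷ (rdual Y ⊗ c.obj ⊗ Y) := by
  unfold crossing
  have h1 := c.isHalfBraiding.naturality _ _ (neutral_tensor_dual hX hY)
    (neutral_tensor_dual hX' hY) (f ▷ rdual Y)
  calc
    _ = 𝟙 _ ⊗≫ c.obj ◁ (f ▷ (𝟙_ C) ≫ X' ◁ pivCoev Y) ⊗≫
          c.β (X' ⊗ rdual Y) (neutral_tensor_dual hX' hY) ▷ Y ⊗≫ 𝟙 _ := by monoidal
    _ = 𝟙 _ ⊗≫ (c.obj ⊗ X) ◁ pivCoev Y ⊗≫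
          (c.obj ◁ (f ▷ rdual Y) ≫ c.β (X' ⊗ rdual Y) (neutral_tensor_dual hX' hY)) ▷ Y ⊗≫
            𝟙 _ := by rw [← whisker_exchange]; monoidal
    _ = _ := by rw [h1]; monoidal

theorem crossing_left (hU : neutral deg U) (hX : deg h X) (hY : deg h Y)
    (hUX : deg h (U ⊗ X)) :
    crossing c hUX hY = (α_ c.obj U X).inv ≫ c.β U hU ▷ X ≫ (α_ U c.obj X).hom ≫
      U ◁ crossing c hX hY ≫ (α_ U X (rdual Y ⊗ c.obj ⊗ Y)).inv := by
  have h2 : neutral deg (U ⊗ (X ⊗ rdual Y)) :=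
    deg_neutral_tensor (h := 1) hU (neutral_tensor_dual hX hY)
  unfold crossing
  rw [β_tensor_assoc c _ h2, c.isHalfBraiding.monoidal _ _ hU (neutral_tensor_dual hX hY)]
  symm
  calc
    _ = 𝟙 _ ⊗≫ (c.β U hU ▷ (X ⊗ 𝟙_ C) ≫ (U ⊗ c.obj) ◁ X ◁ pivCoev Y) ⊗≫
          U ◁ c.β (X ⊗ rdual Y) (neutral_tensor_dual hX hY) ▷ Y ⊗≫ 𝟙 _ := by monoidal
    _ = _ := by rw [← whisker_exchange]; monoidal

theorem crossing_map (f : c ⟶ d) (hX : deg h X) (hY : deg h Y) :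
    f.hom ▷ X ≫ crossing d hX hY = crossing c hX hY ≫ X ◁ rdual Y ◁ f.hom ▷ Y := by
  unfold crossing
  calc
    _ = 𝟙 _ ⊗≫ (f.hom ▷ (X ⊗ 𝟙_ C) ≫ d.obj ◁ X ◁ pivCoev Y) ⊗≫
          d.β (X ⊗ rdual Y) (neutral_tensor_dual hX hY) ▷ Y ⊗≫ 𝟙 _ := by monoidal
    _ = 𝟙 _ ⊗≫ (c.obj ⊗ X) ◁ pivCoev Y ⊗≫ (f.hom ▷ (X ⊗ rdual Y) ≫
          d.β (X ⊗ rdual Y) (neutral_tensor_dual hX hY)) ▷ Y ⊗≫ 𝟙 _ := by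
      rw [← whisker_exchange]; monoidal
    _ = _ := by rw [f.comm]; monoidal

theorem arc_eq (hX : deg h X) (hY : deg h Y) :
    arc c hX hY = 𝟙 _ ⊗≫ rdual X ◁ crossing c hX hY ⊗≫
      ε_ X (rdual X) ▷ (rdual Y ⊗ c.obj ⊗ Y) ⊗≫ 𝟙 _ := by
  unfold arc crossing
  monoidal

theorem arcBraid_eq (hX : deg h X) (hY : deg h Y) (hU : neutral deg U) :
    arcBraid c hX hY U hU = 𝟙 _ ⊗≫ rdual X ◁ crossing c (deg_tensor_neutral hX hU) hY ⊗≫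
      ε_ X (rdual X) ▷ (U ⊗ rdual Y ⊗ c.obj ⊗ Y) ⊗≫ 𝟙 _ := by
  unfold arcBraid crossing
  rw [β_tensor_assoc c _ (neutral_tensor_tensor_dual hX hY hU)]
  monoidal

/-- The strand `X` is not affected: `X ⊗ Y*` crosses `c` back and forth. -/
theorem uncrossing_crossing (hX : deg h X) (hY : deg h Y) (hZ : deg h Z) :
    uncrossing c hX hY ≫ crossing c hX hZ = X ◁ arc c hY hZ := by
  have := c.isHalfBraiding.isIso (X ⊗ rdual Y) (neutral_tensor_dual hX hY)
  have hXY := deg_neutral_tensor (neutral_tensor_dual hX hY) hY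
  unfold uncrossing
  rw [arc_eq]
  calc
    _ = 𝟙 _ ⊗≫ inv (c.β (X ⊗ rdual Y) (neutral_tensor_dual hX hY)) ▷ Y ⊗≫
          (c.obj ◁ ((α_ X (rdual Y) Y).hom ≫ X ◁ ε_ Y (rdual Y) ≫ (ρ_ X).hom) ≫
            crossing c hX hZ) := by monoidal
    _ = 𝟙 _ ⊗≫ (inv (c.β (X ⊗ rdual Y) (neutral_tensor_dual hX hY)) ≫
            c.β (X ⊗ rdual Y) (neutral_tensor_dual hX hY)) ▷ Y ⊗≫
          (X ⊗ rdual Y) ◁ crossing c hY hZ ⊗≫ X ◁ ε_ Y (rdual Y) ▷ (rdual Z ⊗ c.obj ⊗ Z) ⊗≫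
            𝟙 _ := by
      rw [crossing_natural hXY hX hZ, crossing_left (neutral_tensor_dual hX hY) hY hZ hXY]
      monoidal
    _ = _ := by rw [IsIso.inv_hom_id]; monoidal

variable {𝕂 : Type w} [Field 𝕂] [Linear 𝕂 C] [MonoidalPreadditive C] [MonoidalLinear 𝕂 C]

section

variable (hev : ∀ X : C, pivCoev X ≫ ε_ X (rdual X) = objDim 𝕂 X • 𝟙 (𝟙_ C))

include hev

theorem crossing_uncrossing (hX : deg h X) (hY : deg h Y) :
    crossing c hX hY ≫ uncrossing c hX hY = objDim 𝕂 Y • 𝟙 (c.obj ⊗ X) := by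
  have := c.isHalfBraiding.isIso (X ⊗ rdual Y) (neutral_tensor_dual hX hY)
  unfold crossing uncrossing
  calc
    _ = 𝟙 _ ⊗≫ (c.obj ⊗ X) ◁ pivCoev Y ⊗≫ (c.β (X ⊗ rdual Y) (neutral_tensor_dual hX hY) ≫
          inv (c.β (X ⊗ rdual Y) (neutral_tensor_dual hX hY))) ▷ Y ⊗≫
            (c.obj ⊗ X) ◁ ε_ Y (rdual Y) ⊗≫ 𝟙 _ := by monoidal
    _ = 𝟙 _ ⊗≫ (c.obj ⊗ X) ◁ (pivCoev Y ≫ ε_ Y (rdual Y)) ⊗≫ 𝟙 _ := by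
      rw [IsIso.hom_inv_id]; monoidal
    _ = _ := by rw [hev]; simp [monoidalComp]

/-- A crossing followed by an arc: the bubble labelled `Y` is removed by naturality of the
half-braiding. -/
theorem crossing_arc (hX : deg h X) (hY : deg h Y) (hZ : deg h Z) :
    crossing c hX hY ≫ X ◁ arc c hY hZ = objDim 𝕂 Y • crossing c hX hZ := by
  rw [← uncrossing_crossing, ← Category.assoc, crossing_uncrossing hev, Linear.smul_comp,
    Category.id_comp]

theorem crossing_arcBraid (hX : deg h X) (hY : deg h Y) (hZ : deg h Z) (hU : neutral deg U) :
    crossing c hX hY ▷ U ≫ (α_ X _ U).hom ≫ X ◁ arcBraid c hY hZ U hU =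
      objDim 𝕂 Y • ((α_ c.obj X U).hom ≫ crossing c (deg_tensor_neutral hX hU) hZ ≫
        (α_ X U _).hom) := by
  have hYU := deg_tensor_neutral hY hU
  have hXU := deg_tensor_neutral hX hU
  have hXY := deg_neutral_tensor (neutral_tensor_dual hX hY) hYU
  let k : X ⊗ U ⟶ (X ⊗ rdual Y) ⊗ (Y ⊗ U) := 𝟙 _ ⊗≫ X ◁ pivCoev Y ▷ U ⊗≫ 𝟙 _
  let p : (X ⊗ rdual Y) ⊗ (Y ⊗ U) ⟶ X ⊗ U := 𝟙 _ ⊗≫ X ◁ ε_ Y (rdual Y) ▷ U ⊗≫ 𝟙 _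
  have hkp : k ≫ p = objDim 𝕂 Y • 𝟙 (X ⊗ U) := by
    calc
      _ = 𝟙 _ ⊗≫ X ◁ (pivCoev Y ≫ ε_ Y (rdual Y)) ▷ U ⊗≫ 𝟙 _ := by simp only [k, p]; monoidal
      _ = _ := by rw [hev]; simp [monoidalComp]
  rw [arcBraid_eq hY hZ hU]
  calc
    _ = (α_ c.obj X U).hom ≫ c.obj ◁ k ≫ ((α_ c.obj (X ⊗ rdual Y) (Y ⊗ U)).inv ≫
          c.β (X ⊗ rdual Y) (neutral_tensor_dual hX hY) ▷ (Y ⊗ U) ≫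
          (α_ (X ⊗ rdual Y) c.obj (Y ⊗ U)).hom ≫ (X ⊗ rdual Y) ◁ crossing c hYU hZ ≫
          (α_ (X ⊗ rdual Y) (Y ⊗ U) _).inv) ≫ p ▷ (rdual Z ⊗ c.obj ⊗ Z) ≫ (α_ X U _).hom := by
      simp only [crossing.eq_1 c hX hY, k, p]
      monoidal
    _ = (α_ c.obj X U).hom ≫ c.obj ◁ (k ≫ p) ≫ crossing c hXU hZ ≫ (α_ X U _).hom := by
      rw [← crossing_left (neutral_tensor_dual hX hY) hYU hZ hXY,
        ← reassoc_of% (crossing_natural (c := c) hXY hXU hZ p)]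
      simp
    _ = _ := by rw [hkp]; simp

theorem arc_arc (hX : deg h X) (hY : deg h Y) (hZ : deg h Z) :
    arc c hX hY ≫ arc c hY hZ = objDim 𝕂 Y • arc c hX hZ := by
  rw [arc_eq hX hY, arc_eq hX hZ]
  calc
    _ = 𝟙 _ ⊗≫ rdual X ◁ crossing c hX hY ⊗≫ (ε_ X (rdual X) ▷ (rdual Y ⊗ c.obj ⊗ Y) ≫
          𝟙_ C ◁ arc c hY hZ) ⊗≫ 𝟙 _ := by monoidal
    _ = 𝟙 _ ⊗≫ rdual X ◁ (crossing c hX hY ≫ X ◁ arc c hY hZ) ⊗≫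
          ε_ X (rdual X) ▷ (rdual Z ⊗ c.obj ⊗ Z) ⊗≫ 𝟙 _ := by
      rw [← whisker_exchange]; monoidal
    _ = _ := by rw [crossing_arc hev]; simp [monoidalComp]

end

/-! ### The conjugate object as a transport -/

variable {ι : Type*} [Finite ι] (S : ι → C)

variable (𝕂) in
/-- The component `P(c) ⟶ i* ⊗ c ⊗ i` of the inclusion. -/
def crossπ (h : G) (c : GCenter deg) (i : SimpleIdx deg S h) :
    crossObj 𝕂 S h c ⟶ rdual (S i.1) ⊗ c.obj ⊗ S i.1 :=
  crossIncl 𝕂 S h c ≫ biproduct.π (fun i : SimpleIdx deg S h => rdual (S i.1) ⊗ c.obj ⊗ S i.1) i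

variable (𝕂) in
/-- The component `i* ⊗ c ⊗ i ⟶ P(c)` of the restriction. -/
def crossι (h : G) (c : GCenter deg) (i : SimpleIdx deg S h) :
    rdual (S i.1) ⊗ c.obj ⊗ S i.1 ⟶ crossObj 𝕂 S h c :=
  biproduct.ι (fun i : SimpleIdx deg S h => rdual (S i.1) ⊗ c.obj ⊗ S i.1) i ≫ crossRestr 𝕂 S h c

theorem crossRestr_crossIncl (h : G) (c : GCenter deg) :
    crossRestr 𝕂 S h c ≫ crossIncl 𝕂 S h c = crossProj 𝕂 S h c := image.fac _

theorem crossι_crossπ (h : G) (c : GCenter deg) (i j : SimpleIdx deg S h) :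
    crossι 𝕂 S h c i ≫ crossπ 𝕂 S h c j =
      (objDim 𝕂 (S i.1) / neutralDim 𝕂 deg S) • arc c i.2 j.2 := by
  exact biproduct_ι_restrict_π (crossRestr 𝕂 S h c) (crossIncl 𝕂 S h c)
    (crossRestr_crossIncl S h c) i j

variable (hev : ∀ X : C, pivCoev X ≫ ε_ X (rdual X) = objDim 𝕂 X • 𝟙 (𝟙_ C))
  (hsum : ∀ h : G, ∑ i : SimpleIdx deg S h,
    objDim 𝕂 (S i.1) / neutralDim 𝕂 deg S * objDim 𝕂 (S i.1) = 1)

include hev hsum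

theorem crossProj_idempotent (h : G) (c : GCenter deg) :
    crossProj 𝕂 S h c ≫ crossProj 𝕂 S h c = crossProj 𝕂 S h c := by
  exact biproduct_matrix_idempotent (t := fun i j => arc c i.2 j.2)
    (fun i j k => arc_arc hev i.2 j.2 k.2) (hsum h)

theorem crossIncl_crossRestr (h : G) (c : GCenter deg) :
    crossIncl 𝕂 S h c ≫ crossRestr 𝕂 S h c = 𝟙 _ := by
  have : Mono (crossIncl 𝕂 S h c) := inferInstanceAs (Mono (image.ι _))
  have : Epi (crossRestr 𝕂 S h c) := inferInstanceAs (Epi (factorThruImage _))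
  rw [← cancel_mono (crossIncl 𝕂 S h c), ← cancel_epi (crossRestr 𝕂 S h c), Category.assoc,
    crossRestr_crossIncl, ← Category.assoc, crossRestr_crossIncl, Category.id_comp,
    crossRestr_crossIncl, crossProj_idempotent S hev hsum]

theorem sum_crossπ_crossι (h : G) (c : GCenter deg) :
    ∑ i, crossπ 𝕂 S h c i ≫ crossι 𝕂 S h c i = 𝟙 _ := by
  exact (sum_restrict (crossRestr 𝕂 S h c) (crossIncl 𝕂 S h c)).trans
    (crossIncl_crossRestr S hev hsum h c)

omit hev hsum in
theorem crossMap_eq_sum (h : G) {c d : GCenter deg} (f : c ⟶ d) :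
    crossMap 𝕂 S h f =
      ∑ i, crossπ 𝕂 S h c i ≫ (rdual (S i.1) ◁ f.hom ▷ S i.1) ≫ crossι 𝕂 S h d i :=
  restrict_map (fun i : SimpleIdx deg S h => rdual (S i.1) ◁ f.hom ▷ S i.1) (crossRestr 𝕂 S h d) (crossIncl 𝕂 S h c)

omit hev hsum in
theorem crossβ_eq_sum (h : G) (c : GCenter deg) (U : C) (hU : neutral deg U) :
    crossβ 𝕂 S h c U hU = ∑ i : SimpleIdx deg S h, ∑ j : SimpleIdx deg S h,
      (objDim 𝕂 (S i.1) / neutralDim 𝕂 deg S) • (crossπ 𝕂 S h c i ▷ U ≫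
        arcBraid c i.2 j.2 U hU ≫ U ◁ crossι 𝕂 S h c j) := by
  have h1 : ∀ i, crossπ 𝕂 S h c i ▷ U = crossIncl 𝕂 S h c ▷ U ≫ biproduct.π
      (fun i : SimpleIdx deg S h => rdual (S i.1) ⊗ c.obj ⊗ S i.1) i ▷ U :=
    fun i => comp_whiskerRight _ _ _
  have h2 : ∀ i, U ◁ crossι 𝕂 S h c i = U ◁ biproduct.ι
      (fun i : SimpleIdx deg S h => rdual (S i.1) ⊗ c.obj ⊗ S i.1) i ≫ U ◁ crossRestr 𝕂 S h c :=
    fun i => MonoidalCategory.whiskerLeft_comp _ _ _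
  simp only [h1, h2]
  exact comp_sum_smul_comp (crossIncl 𝕂 S h c ▷ U) (U ◁ crossRestr 𝕂 S h c) _ _ _ _

variable (𝕂) in
/-- The canonical isomorphism `c ⊗ X ≅ X ⊗ P(c)`. -/
def crossσ (h : G) (c : GCenter deg) (X : C) (hX : deg h X) :
    c.obj ⊗ X ⟶ X ⊗ crossObj 𝕂 S h c :=
  ∑ i : SimpleIdx deg S h, crossing c hX i.2 ≫ X ◁ crossι 𝕂 S h c i

theorem crossσ_crossπ (h : G) (c : GCenter deg) (X : C) (hX : deg h X) (i : SimpleIdx deg S h) :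
    crossσ 𝕂 S h c X hX ≫ X ◁ crossπ 𝕂 S h c i = crossing c hX i.2 := by
  unfold crossσ
  rw [Preadditive.sum_comp]
  calc
    _ = ∑ j : SimpleIdx deg S h, (objDim 𝕂 (S j.1) / neutralDim 𝕂 deg S * objDim 𝕂 (S j.1)) •
          crossing c hX i.2 := by
      refine Finset.sum_congr rfl fun j _ => ?_
      rw [Category.assoc, ← MonoidalCategory.whiskerLeft_comp, crossι_crossπ,
        MonoidalLinear.whiskerLeft_smul, Linear.comp_smul, crossing_arc hev, smul_smul]
    _ = _ := by rw [← Finset.sum_smul, hsum, one_smul]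

variable (𝕂) in
/-- The transport of `c` to `P(c)`. -/
def crossTransport (h : G) (c : GCenter deg) : Transport h c (crossObj 𝕂 S h c) where
  σ X hX := crossσ 𝕂 S h c X hX
  isIso X hX := by
    refine ⟨∑ i : SimpleIdx deg S h, (objDim 𝕂 (S i.1) / neutralDim 𝕂 deg S) •
      (X ◁ crossπ 𝕂 S h c i ≫ uncrossing c hX i.2), ?_, ?_⟩
    · rw [Preadditive.comp_sum]
      calc
        _ = ∑ i : SimpleIdx deg S h, (objDim 𝕂 (S i.1) / neutralDim 𝕂 deg S *
              objDim 𝕂 (S i.1)) • 𝟙 (c.obj ⊗ X) := by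
          refine Finset.sum_congr rfl fun i _ => ?_
          rw [Linear.comp_smul, ← Category.assoc, crossσ_crossπ S hev hsum,
            crossing_uncrossing hev, smul_smul]
        _ = _ := by rw [← Finset.sum_smul, hsum, one_smul]
    · calc
        _ = ∑ i : SimpleIdx deg S h, ∑ j : SimpleIdx deg S h, X ◁ (crossπ 𝕂 S h c i ≫
              (crossι 𝕂 S h c i ≫ crossπ 𝕂 S h c j) ≫ crossι 𝕂 S h c j) := by
          rw [Preadditive.sum_comp]
          refine Finset.sum_congr rfl fun i _ => ?_
          unfold crossσ
          rw [Preadditive.comp_sum]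
          refine Finset.sum_congr rfl fun j _ => ?_
          rw [crossι_crossπ, Linear.smul_comp, Category.assoc, ← Category.assoc (uncrossing _ _ _),
            uncrossing_crossing]
          simp
        _ = X ◁ ((∑ i, crossπ 𝕂 S h c i ≫ crossι 𝕂 S h c i) ≫
              (∑ j, crossπ 𝕂 S h c j ≫ crossι 𝕂 S h c j)) := by
          simp only [Preadditive.sum_comp, Preadditive.comp_sum, whiskerLeft_sum, Category.assoc]
          rw [Finset.sum_comm]
        _ = _ := by
          rw [sum_crossπ_crossι S hev hsum, Category.comp_id, MonoidalCategory.whiskerLeft_id]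
  natural X Y hX hY f := by
    unfold crossσ
    simp only [Preadditive.sum_comp, Preadditive.comp_sum, Category.assoc, whisker_exchange]
    refine Finset.sum_congr rfl fun i _ => ?_
    rw [← Category.assoc, crossing_natural hX hY, Category.assoc]
  left U X hU hX hUX := by
    unfold crossσ
    simp only [Preadditive.sum_comp, Preadditive.comp_sum, whiskerLeft_sum]
    refine Finset.sum_congr rfl fun i _ => ?_
    rw [crossing_left hU hX i.2]
    simp

theorem crossTransport_isRight (h : G) (c : GCenter deg) :
    (crossTransport 𝕂 S hev hsum h c).IsRight (crossβ 𝕂 S h c) := by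
  intro X U hX hU hXU
  have key : crossσ 𝕂 S h c X hX ▷ U ≫ (α_ X _ U).hom ≫ X ◁ crossβ 𝕂 S h c U hU =
      (α_ c.obj X U).hom ≫ crossσ 𝕂 S h c (X ⊗ U) hXU ≫ (α_ X U _).hom := by
    calc
      _ = ∑ i : SimpleIdx deg S h, ∑ j : SimpleIdx deg S h,
            (objDim 𝕂 (S i.1) / neutralDim 𝕂 deg S) •
              ((crossσ 𝕂 S h c X hX ≫ X ◁ crossπ 𝕂 S h c i) ▷ U ≫ (α_ X _ U).hom ≫
                X ◁ arcBraid c i.2 j.2 U hU ≫ X ◁ U ◁ crossι 𝕂 S h c j) := by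
        rw [crossβ_eq_sum]
        simp only [whiskerLeft_sum, Preadditive.comp_sum, MonoidalLinear.whiskerLeft_smul,
          Linear.comp_smul]
        refine Finset.sum_congr rfl fun i _ => Finset.sum_congr rfl fun j _ => ?_
        congr 1
        simp
      _ = ∑ i : SimpleIdx deg S h, ∑ j : SimpleIdx deg S h,
            (objDim 𝕂 (S i.1) / neutralDim 𝕂 deg S * objDim 𝕂 (S i.1)) •
              ((α_ c.obj X U).hom ≫ (crossing c hXU j.2 ≫ (X ⊗ U) ◁ crossι 𝕂 S h c j) ≫
                (α_ X U _).hom) := by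
        refine Finset.sum_congr rfl fun i _ => Finset.sum_congr rfl fun j _ => ?_
        have := crossing_arcBraid (c := c) hev hX i.2 j.2 hU
        rw [crossσ_crossπ S hev hsum, reassoc_of% this, ← smul_smul]
        congr 1
        simp
      _ = _ := by
        rw [Finset.sum_comm]
        simp only [← Finset.sum_smul, hsum, one_smul]
        unfold crossσ
        simp only [Preadditive.sum_comp, Preadditive.comp_sum]
  change crossσ 𝕂 S h c (X ⊗ U) hXU = (α_ c.obj X U).inv ≫ crossσ 𝕂 S h c X hX ▷ U ≫
    (α_ X _ U).hom ≫ X ◁ crossβ 𝕂 S h c U hU ≫ (α_ X U _).inv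
  rw [reassoc_of% key]
  simp

theorem crossσ_crossMap (h : G) {c d : GCenter deg} (f : c ⟶ d) (X : C) (hX : deg h X) :
    crossσ 𝕂 S h c X hX ≫ X ◁ crossMap 𝕂 S h f = f.hom ▷ X ≫ crossσ 𝕂 S h d X hX := by
  rw [crossMap_eq_sum, whiskerLeft_sum, Preadditive.comp_sum]
  conv_rhs => rw [crossσ, Preadditive.comp_sum]
  refine Finset.sum_congr rfl fun i _ => ?_
  rw [MonoidalCategory.whiskerLeft_comp, ← Category.assoc, crossσ_crossπ S hev hsum,
    ← Category.assoc (f.hom ▷ X), crossing_map, MonoidalCategory.whiskerLeft_comp, Category.assoc]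

variable (hs : ∀ h : G, IsSplitDegree deg h)

include hs

variable (𝕂) in
/-- The object `P(c)` of the center. -/
def crossCenterObj (h : G) (c : GCenter deg) : GCenter deg where
  obj := crossObj 𝕂 S h c
  β := crossβ 𝕂 S h c
  isHalfBraiding := (crossTransport_isRight S hev hsum h c).isHalfBraiding (hs h)

variable (𝕂) in
/-- `P(c)`, with `γ_{P(c)}`, is the transport of `c` past the objects of degree `h`, by means of the
morphisms `crossσ`. -/
def crossCenterTransport (h : G) (c : GCenter deg) :
    CenterTransport h c (crossCenterObj 𝕂 S hev hsum hs h c) where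
  toTransport := crossTransport 𝕂 S hev hsum h c
  right := crossTransport_isRight S hev hsum h c

/-- `P(f)` is the morphism induced by `f` on the transports; in particular it is a morphism of the
center and functorial in `f`. -/
theorem crossMap_eq_map (h : G) {c d : GCenter deg} (f : c ⟶ d) :
    crossMap 𝕂 S h f = ((crossCenterTransport 𝕂 S hev hsum hs h c).map
      (crossCenterTransport 𝕂 S hev hsum hs h d) (hs h) f).hom := by
  have hmap := (crossCenterTransport 𝕂 S hev hsum hs h c).map_spec
    (crossCenterTransport 𝕂 S hev hsum hs h d) (hs h) f
  have h2 := crossσ_crossMap S hev hsum h f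
  have hi := (crossTransport 𝕂 S hev hsum h c).isIso
  obtain ⟨X, X', s, r, hX, hX', hsr⟩ := hs h
  apply whiskerLeft_injective_of_split s r hsr
  have := hi X hX
  refine (cancel_epi ((crossTransport 𝕂 S hev hsum h c).σ X hX)).1 ?_
  exact (h2 X hX).trans (hmap X hX).symm

theorem crossWellDefined : CrossWellDefined 𝕂 deg S where
  idempotent := crossProj_idempotent S hev hsum
  isHalfBraiding h c := (crossTransport_isRight S hev hsum h c).isHalfBraiding (hs h)
  map_comm h c d f U hU := by
    rw [crossMap_eq_map S hev hsum hs]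
    exact RelCenter.Hom.comm _ U hU
  map_id h c := by
    rw [crossMap_eq_map S hev hsum hs, CenterTransport.map_id]
    rfl
  map_comp h c d e f f' := by
    simp only [crossMap_eq_map S hev hsum hs]
    rw [← CenterTransport.map_comp_map _ (crossCenterTransport 𝕂 S hev hsum hs h d)]
    rfl

/-- `φ_h` is a transport functor: each `φ_h(c)` is a transport of `c`, and `φ_h(f)` is the morphism
induced by `f`. -/
def crossTransportFunctor (W : CrossWellDefined 𝕂 deg S) (h : G) :
    TransportFunctor h (W.functor h) where
  T := crossCenterTransport 𝕂 S hev hsum hs h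
  isOver_map f := fun X hX => crossσ_crossMap S hev hsum h f X hX

end Crossing

/-! ### The grading of the center -/

section CenterGrading

namespace RelCenter

variable {C : Type u} [Category.{v} C] [MonoidalCategory C] {S : ObjectProperty C}

/-- The half-braiding induced on a retract by an idempotent of the center. -/
def retract (X : RelCenter S) {Y : C} (i : Y ⟶ X.obj) (p : X.obj ⟶ Y) (hip : i ≫ p = 𝟙 Y)
    (hcomm : ∀ U (hU : S U), (p ≫ i) ▷ U ≫ X.β U hU = X.β U hU ≫ U ◁ (p ≫ i)) : RelCenter S where
  obj := Y
  β U hU := i ▷ U ≫ X.β U hU ≫ U ◁ p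
  isHalfBraiding :=
    { isIso := fun U hU => by
        have := X.isHalfBraiding.isIso U hU
        have hinv : U ◁ (p ≫ i) ≫ inv (X.β U hU) = inv (X.β U hU) ≫ (p ≫ i) ▷ U := by
          rw [← cancel_epi (X.β U hU), ← Category.assoc, ← hcomm]
          simp
        refine ⟨U ◁ i ≫ inv (X.β U hU) ≫ p ▷ U, ?_, ?_⟩
        · calc
            _ = i ▷ U ≫ X.β U hU ≫ (U ◁ (p ≫ i) ≫ inv (X.β U hU)) ≫ p ▷ U := by simp
            _ = (i ≫ p) ▷ U ≫ (i ≫ p) ▷ U := by rw [hinv]; simp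
            _ = _ := by rw [hip]; simp
        · calc
            _ = U ◁ i ≫ inv (X.β U hU) ≫ ((p ≫ i) ▷ U ≫ X.β U hU) ≫ U ◁ p := by simp
            _ = U ◁ (i ≫ p) ≫ U ◁ (i ≫ p) := by rw [hcomm]; simp
            _ = _ := by rw [hip]; simp
      naturality := fun U V hU hV f => by
        calc
          _ = i ▷ U ≫ (X.obj ◁ f ≫ X.β V hV) ≫ V ◁ p := by
            rw [← Category.assoc, whisker_exchange]; simp
          _ = _ := by
            rw [X.isHalfBraiding.naturality U V hU hV]
            simp only [Category.assoc, whisker_exchange]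
      monoidal := fun U V hU hV hUV => by
        rw [X.isHalfBraiding.monoidal U V hU hV hUV]
        symm
        calc
          _ = 𝟙 _ ⊗≫ i ▷ U ▷ V ⊗≫ X.β U hU ▷ V ⊗≫ U ◁ ((p ≫ i) ▷ V ≫ X.β V hV) ⊗≫
                U ◁ V ◁ p ⊗≫ 𝟙 _ := by monoidal
          _ = 𝟙 _ ⊗≫ (i ▷ U ≫ X.β U hU) ▷ V ⊗≫ U ◁ (X.β V hV ≫ V ◁ (p ≫ (i ≫ p))) ⊗≫ 𝟙 _ := by
            rw [hcomm]; monoidal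
          _ = _ := by rw [hip]; monoidal }

/-- The inclusion of a retract. -/
def retractι (X : RelCenter S) {Y : C} (i : Y ⟶ X.obj) (p : X.obj ⟶ Y) (hip : i ≫ p = 𝟙 Y)
    (hcomm : ∀ U (hU : S U), (p ≫ i) ▷ U ≫ X.β U hU = X.β U hU ≫ U ◁ (p ≫ i)) :
    X.retract i p hip hcomm ⟶ X where
  hom := i
  comm U hU := by
    change i ▷ U ≫ X.β U hU = (i ▷ U ≫ X.β U hU ≫ U ◁ p) ≫ U ◁ i
    simp only [Category.assoc, ← MonoidalCategory.whiskerLeft_comp]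
    rw [← hcomm, ← comp_whiskerRight_assoc, ← Category.assoc i, hip, Category.id_comp]

/-- The projection onto a retract. -/
def retractπ (X : RelCenter S) {Y : C} (i : Y ⟶ X.obj) (p : X.obj ⟶ Y) (hip : i ≫ p = 𝟙 Y)
    (hcomm : ∀ U (hU : S U), (p ≫ i) ▷ U ≫ X.β U hU = X.β U hU ≫ U ◁ (p ≫ i)) :
    X ⟶ X.retract i p hip hcomm where
  hom := p
  comm U hU := by
    change p ▷ U ≫ i ▷ U ≫ X.β U hU ≫ U ◁ p = X.β U hU ≫ U ◁ p
    rw [← comp_whiskerRight_assoc, ← Category.assoc, hcomm, Category.assoc,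
      ← MonoidalCategory.whiskerLeft_comp, Category.assoc, hip, Category.comp_id]

variable (S) in
/-- The forgetful functor from the relative center. -/
@[simps]
def forget : RelCenter S ⥤ C where
  obj X := X.obj
  map f := f.hom

instance [Preadditive C] [MonoidalPreadditive C] : (forget S).Additive where

end RelCenter

variable {G : Type*} [Group G] {C : Type u} [Category.{v} C] [Abelian C] [MonoidalCategory C]
  {deg : G → ObjectProperty C} [IsGGrading deg]

/-- Every object is the direct sum of its homogeneous components. -/
theorem exists_homogeneous_components [Fintype G] (X : C) :
    ∃ (Y : G → C) (i : ∀ g, Y g ⟶ X) (p : ∀ g, X ⟶ Y g), (∀ g, deg g (Y g)) ∧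
      (∀ g, i g ≫ p g = 𝟙 (Y g)) ∧ ∑ g, p g ≫ i g = 𝟙 X := by
  classical
  obtain ⟨n, γ, f, b, hf, ⟨hb⟩, ⟨e⟩⟩ := IsGGrading.decomp (deg := deg) X
  obtain ⟨Z₀, hZ₀⟩ := HasZeroObject.zero (C := C)
  have hsub : ∀ (g : G) (k : Fin n), ∃ (Z : C) (i : Z ⟶ f k) (p : f k ⟶ Z), deg g Z ∧
      i ≫ p = 𝟙 Z ∧ p ≫ i = if γ k = g then 𝟙 (f k) else 0 := by
    intro g k
    by_cases hk : γ k = g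
    · exact ⟨f k, 𝟙 _, 𝟙 _, hk ▸ hf k, Category.comp_id _, by rw [if_pos hk, Category.comp_id]⟩
    · exact ⟨Z₀, 0, 0, deg_of_isZero g hZ₀, hZ₀.eq_of_src _ _,
        by rw [if_neg hk, comp_zero]⟩
  choose Z i p hZ hip hpi using hsub
  refine ⟨fun g => ⨁ Z g, fun g => biproduct.desc (fun k => i g k ≫ b.ι k) ≫ e.inv,
    fun g => e.hom ≫ biproduct.lift (fun k => b.π k ≫ p g k), fun g => ?_, fun g => ?_, ?_⟩
  · exact IsGGrading.sum_mem g (Z g) (biproduct.bicone (Z g)) ⟨biproduct.isBilimit _⟩ (hZ g)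
  · refine biproduct.hom_ext' _ _ fun k => biproduct.hom_ext _ _ fun l => ?_
    simp only [Category.assoc, Iso.inv_hom_id_assoc, biproduct.ι_desc_assoc, biproduct.lift_π]
    by_cases hkl : k = l
    · subst hkl
      simp [hip]
    · rw [bicone_ι_π_ne_assoc b hkl]
      simp [biproduct.ι_π_ne _ hkl]
  · have h1 : ∀ g, biproduct.lift (fun k => b.π k ≫ p g k) ≫
        biproduct.desc (fun k => i g k ≫ b.ι k) = ∑ k, if γ k = g then b.π k ≫ b.ι k else 0 := by
      intro g
      rw [biproduct.lift_desc]
      refine Finset.sum_congr rfl fun k _ => ?_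
      rw [Category.assoc, ← Category.assoc (p g k), hpi]
      split_ifs <;> simp
    calc
      _ = e.hom ≫ (∑ g, ∑ k, if γ k = g then b.π k ≫ b.ι k else 0) ≫ e.inv := by
        simp only [← h1, Preadditive.comp_sum, Preadditive.sum_comp, Category.assoc]
      _ = e.hom ≫ (∑ k, b.π k ≫ b.ι k) ≫ e.inv := by
        rw [Finset.sum_comm]
        simp
      _ = _ := by
        rw [IsBilimit.total hb]
        simp

variable [MonoidalPreadditive C]

/-- The `G`-center is graded by the degree of the underlying objects: a half-braiding with neutral
objects preserves degrees, so that the projections onto homogeneous components are morphisms of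
the center. -/
theorem isGGrading_centerDeg [Finite G] : IsGGrading (centerDeg deg) where
  sum_mem g n f b hb hf := by
    obtain ⟨hb⟩ := hb
    refine IsGGrading.sum_mem g (fun k => (f k).obj)
      ((RelCenter.forget (neutral deg)).mapBicone b) ⟨?_⟩ hf
    apply isBilimitOfTotal
    have := congrArg (RelCenter.forget (neutral deg)).map (IsBilimit.total hb)
    rw [Functor.map_sum] at this
    simp only [Functor.map_comp] at this
    exact this.trans (CategoryTheory.Functor.map_id _ _)
  decomp X := by
    classical
    have := Fintype.ofFinite G
    obtain ⟨Y, i, p, hY, hip, hpi⟩ := exists_homogeneous_components (deg := deg) X.obj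
    have hzero : ∀ g g' : G, g ≠ g' → ∀ U (hU : neutral deg U),
        (p g ≫ i g) ▷ U ≫ X.β U hU ≫ U ◁ (p g' ≫ i g') = 0 := by
      intro g g' hgg' U hU
      have h0 : i g ▷ U ≫ X.β U hU ≫ U ◁ p g' = 0 :=
        IsGGrading.hom_eq_zero (Transport.deg_tensor_neutral (hY g) hU)
          (Transport.deg_neutral_tensor hU (hY g')) hgg' _
      simp only [comp_whiskerRight, MonoidalCategory.whiskerLeft_comp, Category.assoc]
      rw [reassoc_of% h0]
      simp
    have hcomm : ∀ (g : G) U (hU : neutral deg U),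
        (p g ≫ i g) ▷ U ≫ X.β U hU = X.β U hU ≫ U ◁ (p g ≫ i g) := by
      intro g U hU
      calc
        _ = (p g ≫ i g) ▷ U ≫ X.β U hU ≫ U ◁ (∑ g', p g' ≫ i g') := by rw [hpi]; simp
        _ = (p g ≫ i g) ▷ U ≫ X.β U hU ≫ U ◁ (p g ≫ i g) := by
          rw [whiskerLeft_sum, Preadditive.comp_sum, Preadditive.comp_sum]
          exact Finset.sum_eq_single g (fun g' _ hg' => hzero g g' hg'.symm U hU) (by simp)
        _ = (∑ g', p g' ≫ i g') ▷ U ≫ X.β U hU ≫ U ◁ (p g ≫ i g) := by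
          rw [sum_whiskerRight, Preadditive.sum_comp]
          exact (Finset.sum_eq_single g (fun g' _ hg' => hzero g' g hg' U hU) (by simp)).symm
        _ = _ := by rw [hpi]; simp
    obtain ⟨n, ⟨e⟩⟩ := Finite.exists_equiv_fin G
    let b : Bicone (fun k : Fin n => X.retract (i (e.symm k)) (p (e.symm k)) (hip _) (hcomm _)) :=
      { pt := X
        π := fun k => X.retractπ _ _ (hip _) (hcomm _)
        ι := fun k => X.retractι _ _ (hip _) (hcomm _)
        ι_π := fun k l => by
          by_cases hkl : k = l
          · subst hkl
            rw [dif_pos rfl]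
            exact RelCenter.Hom.ext (hip _)
          · rw [dif_neg hkl]
            exact RelCenter.Hom.ext (IsGGrading.hom_eq_zero (hY _) (hY _)
              (fun h => hkl (e.symm.injective h)) _) }
    refine ⟨n, e.symm, _, b, fun k => hY _, ⟨isBilimitOfTotal b ?_⟩, ⟨Iso.refl X⟩⟩
    exact RelCenter.Hom.ext (((RelCenter.forget (neutral deg)).map_sum _ _).trans
      ((Equiv.sum_comp e.symm (fun g => p g ≫ i g)).trans hpi))
  tensor_mem hX hY := IsGGrading.tensor_mem (deg := deg) hX hY
  hom_eq_zero hX hY hne f := RelCenter.Hom.ext (IsGGrading.hom_eq_zero (deg := deg) hX hY hne f.hom)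
  unit_mem := IsGGrading.unit_mem (deg := deg)

end CenterGrading

end

/-- As `d_X ≠ 0` for simple `X`, the unit is a retract of `X* ⊗ X`. -/
theorem isSplitDegree_of_simple {𝕂 : Type w} [Field 𝕂] [IsAlgClosed 𝕂]
    {G : Type*} [Group G] {C : Type u} [Category.{v} C] [Abelian C] [Linear 𝕂 C]
    [MonoidalCategory C] [MonoidalPreadditive C] [MonoidalLinear 𝕂 C] [RightRigidCategory C]
    [PivotalCategory C] (hC : IsFusion 𝕂 C) (hsph : IsSpherical C)
    {deg : G → ObjectProperty C} [IsGGrading deg] {h : G} {X : C} [Simple X] (hX : deg h X) :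
    IsSplitDegree deg h := by
  refine ⟨X, rdual X, pivCoev X, (objDim 𝕂 X)⁻¹ • ε_ X (rdual X), hX, deg_dual hX, ?_⟩
  rw [Linear.comp_smul, pivCoev_evaluation hC hsph, smul_smul,
    inv_mul_cancel₀ (objDim_ne_zero hC X), one_smul]

theorem mainTheorem7 {𝕂 : Type w} [Field 𝕂] [IsAlgClosed 𝕂] [CharZero 𝕂]
    {G : Type*} [Group G] [Finite G]
    {C : Type u} [Category.{v} C] [Abelian C] [Linear 𝕂 C] [MonoidalCategory C]
    [MonoidalPreadditive C] [MonoidalLinear 𝕂 C] [RightRigidCategory C] [PivotalCategory C]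
    (hfusion : IsFusion 𝕂 C) (hspherical : IsSpherical C)
    (deg : G → ObjectProperty C) [IsGGrading deg] (hdeg : ∀ g, ∃ X : C, deg g X ∧ Simple X)
    {ι : Type*} [Finite ι] (S : ι → C) (hS : IsSimpleReps S) :
    IsGGrading (centerDeg deg) ∧
      ∃ W : CrossWellDefined 𝕂 deg S, Nonempty (GCrossing 𝕂 (centerDeg deg) W.functor) := by
  have hev := pivCoev_evaluation hfusion hspherical
  have hs : ∀ h : G, IsSplitDegree deg h := fun h => by
    obtain ⟨X, hX, hXs⟩ := hdeg h
    exact isSplitDegree_of_simple hfusion hspherical hX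
  have hsum : ∀ h : G, ∑ i : SimpleIdx deg S h,
      objDim 𝕂 (S i.1) / neutralDim 𝕂 deg S * objDim 𝕂 (S i.1) = 1 := fun h => by
    have hne : Nonempty (SimpleIdx deg S h) := by
      obtain ⟨X, hX, hXs⟩ := hdeg h
      obtain ⟨i, ⟨e⟩⟩ := hS.surj X hXs
      exact ⟨⟨i, deg_of_iso e hX⟩⟩
    rw [← div_self (neutralDim_ne_zero (𝕂 := 𝕂) (deg := deg) hfusion hS hspherical)]
    nth_rewrite 2 [← sum_objDim_sq hfusion hS hspherical h hne]
    rw [Finset.sum_div]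
    exact Finset.sum_congr rfl fun i _ => by ring
  exact ⟨isGGrading_centerDeg, crossWellDefined S hev hsum hs,
    ⟨TransportFunctor.gCrossing (crossTransportFunctor S hev hsum hs _) hs⟩⟩
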